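/- **Setting.** Let $n\ge 1$, let $\mathcal K$ be a field of characteristic $0$, let $t\in\mathcal K^\times$ not be a root of unity, and put $q=t^{-2}$. *Affine permutations.* Let $\widehat{\mathfrak S}_n$ be the group of bijections $w:\mathbb Z\to\mathbb Z$ with $w(i+n)=w(i)+n$. It contains $\pi: i\mapsto i+1$, the simple reflections $s_i$ ($i\in\mathbb Z$, $s_{i+n}=s_i$; $n\ge 2$) exchanging $i+mn$ and $i+1+mn$ for all $m$, the translations $i\mapsto i+n\beta_{i \bmod n}$ for $\beta\in\mathbb Z^n$, and the finite symmetric group $\mathfrak S_n$ (permutations of $\{1,\dots,n\}$, extended quasi-periodically). Let $\gamma\in\widehat{\mathfrak S}_n$ be the translation by $-\rho=(0,-1,\dots,1-n)$. A reduced expression of $w$ is an expression $w=\pi^k s_{i_1}\cdots s_{i_m}$ with $m$ minimal. *The DAHA.* Let $\mathbb H=\mathbb H_n^{\mathrm{GL}}(q,t)$ be the $\mathcal K$-algebra generated by $T_i$ ($i\in\mathbb Z/n$), $\pi^{\pm1}$ and commuting $Y_1^{\pm1},\dots,Y_n^{\pm1}$, where we set $Y_{i+mn}:=q^{-m}Y_i$,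 with the relations, for all integers $i,j$, $$(T_i-t)(T_i+t^{-1})=0,\quad T_iT_{i+1}T_i=T_{i+1}T_iT_{i+1}\ (n\ge 3),\quad T_iT_j=T_jT_i\ (n\ge3,\ j\not\equiv i\pm1 \bmod n),$$ $$\pi T_i\pi^{-1}=T_{i+1},\quad T_iY_iT_i=Y_{i+1},\quad T_iY_j=Y_jT_i\ (j\not\equiv i,i+1 \bmod n),\quad \pi Y_i\pi^{-1}=Y_{i+1}.$$ For a reduced expression $w=\pi^k s_{i_1}\cdots s_{i_m}$ put $T_w=\pi^kT_{i_1}\cdots T_{i_m}$. *Intertwiners.* Put $f_{i,j}=tY_i-t^{-1}Y_j$. Let $\widetilde{\mathbb H}$ and $\mathcal K[\widetilde{\mathcal Y}]$ be the localizations of $\mathbb H$ and of $\mathcal K[\mathcal Y]=\mathcal K[Y_1^{\pm1},\dots,Y_n^{\pm1}]$ at the $f_{i,j}$ with $i\not\equiv j \bmod n$. The renormalized intertwiners are $\nu_i=(T_iY_i-Y_iT_i)f_{i,i+1}^{-1}\in\widetilde{\mathbb H}$, and $\nu_w=\pi^k\nu_{i_1}\cdots\nu_{i_m}$ for a reduced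 expression of $w$. The normal ordering of $h\in\widetilde{\mathbb H}$ is the expression ${:}h{:}=\sum_{x\in\widehat{\mathfrak S}_n}T_xg_x$ of $h$ with $g_x\in\mathcal K[\widetilde{\mathcal Y}]$, almost all zero. *The induced module.* Let $q^\rho=t^{-2\rho}$ be the one-dimensional $\mathcal K[\mathcal Y]$-module $\mathcal K\mathbf v$ on which $Y_i$ acts by $q^{i-1}=t^{2-2i}$, and let $\operatorname{Ind}_{\mathcal Y}^{\mathbb H}(q^\rho)=\mathbb H\otimes_{\mathcal K[\mathcal Y]}\mathcal K\mathbf v$. **Theorem.** For each $w\in\mathfrak S_n$, the element $\nu_{\gamma^{-1}w\gamma}$ has a unique normal ordering $\sum_xT_xg_x$, and none of its coefficients $g_x$ has a pole at $q^\rho$. There are well-defined $\mathbb H$-linear endomorphisms $\Phi_w$ of $\operatorname{Ind}_{\mathcal Y}^{\mathbb H}(q^\rho)$ with $$\Phi_w(h\otimes\mathbf v)=\bigl(h\,{:}\nu_{\gamma^{-1}w\gamma}{:}\bigr)\otimes\mathbf v:=\sum_x g_x(q^\rho)\,hT_x\otimes\mathbf v\qquad(h\in\mathbb H),$$ and $w\mapsto\Phi_w$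 extends linearly to an isomorphism of $\mathcal K$-algebras $$\Phi:\mathcal K[\mathfrak S_n]^{\mathrm{op}}\ \xrightarrow{\ \sim\ }\ \operatorname{End}_{\mathbb H}\bigl(\operatorname{Ind}_{\mathcal Y}^{\mathbb H}(q^\rho)\bigr).$$ -/

import Mathlib

open scoped TensorProduct

noncomputable section

namespace GLDaha

/-! ### The extended affine symmetric group -/

/-- The extended affine symmetric group: bijections `w : ℤ → ℤ` with `w (i + n) = w i + n`,
with composition as multiplication. -/
def AffSym (n : ℕ) : Subgroup (Equiv.Perm ℤ) where
  carrier := {w | ∀ i : ℤ, w (i + n) = w i + n}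
  mul_mem' := by
    intro a b ha hb i
    simp only [Equiv.Perm.mul_apply]
    rw [hb i, ha]
  one_mem' := fun _ => rfl
  inv_mem' := by
    intro a ha i
    apply a.injective
    rw [ha]
    simp

/-- The underlying function of `s_i`: it exchanges `i + m n` and `i + 1 + m n` for all `m`.
(For `n = 1` there are no simple reflections, and this is the identity.) -/
def simpleFun (n : ℕ) (i x : ℤ) : ℤ :=
  if (n : ℤ) ∣ x - i ∧ ¬ (n : ℤ) ∣ x - (i + 1) then x + 1
  else if (n : ℤ) ∣ x - (i + 1) ∧ ¬ (n : ℤ) ∣ x - i then x - 1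
  else x

theorem simpleFun_involutive (n : ℕ) (i : ℤ) : Function.Involutive (simpleFun n i) := by
  intro x
  by_cases h1 : (n : ℤ) ∣ x - i <;> by_cases h2 : (n : ℤ) ∣ x - (i + 1)
  · simp [simpleFun, h1, h2]
  · have h3 : (n : ℤ) ∣ x + 1 - (i + 1) := by
      rw [show x + 1 - (i + 1) = x - i by ring]; exact h1
    have h4 : ¬ (n : ℤ) ∣ x + 1 - i := by
      intro h
      have h5 : (n : ℤ) ∣ 1 := by
        have := dvd_sub h h1
        rwa [show x + 1 - i - (x - i) = 1 by ring] at this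
      exact h2 (h5.trans (one_dvd _))
    simp [simpleFun, h1, h2, h4]
  · have h3 : (n : ℤ) ∣ x - 1 - i := by
      rw [show x - 1 - i = x - (i + 1) by ring]; exact h2
    have h4 : ¬ (n : ℤ) ∣ x - 1 - (i + 1) := by
      intro h
      have h5 : (n : ℤ) ∣ 1 := by
        have := dvd_sub h2 h
        rwa [show x - (i + 1) - (x - 1 - (i + 1)) = 1 by ring] at this
      exact h1 (h5.trans (one_dvd _))
    simp [simpleFun, h1, h2, h3, h4]
  · simp [simpleFun, h1, h2]

/-- The simple reflection `s_i`, for any integer subscript `i`. -/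
def simple (n : ℕ) (i : ℤ) : AffSym n :=
  ⟨(simpleFun_involutive n i).toPerm, by
    intro x
    have e : ∀ j : ℤ, ((n : ℤ) ∣ x + n - j ↔ (n : ℤ) ∣ x - j) := by
      intro j
      rw [show x + n - j = x - j + n by ring]; simp
    change simpleFun n i (x + n) = simpleFun n i x + n
    unfold simpleFun
    simp only [e]
    split_ifs <;> ring⟩

/-- The rotation `π`, sending `i` to `i + 1`. -/
def rot (n : ℕ) : AffSym n :=
  ⟨Equiv.addRight 1, by intro i; simp; ring⟩

variable {n : ℕ} [NeZero n]

/-- The residue of `i` modulo `n`, the residues of `1, …, n` being the elements `0, …, n - 1`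
of `Fin n`. -/
def residue (n : ℕ) [NeZero n] (i : ℤ) : Fin n := (Int.divModEquiv n (i - 1)).2

/-- The integer `m` with `i - m n ∈ {1, …, n}`. -/
def wind (n : ℕ) [NeZero n] (i : ℤ) : ℤ := (Int.divModEquiv n (i - 1)).1

theorem residue_add (i : ℤ) : residue n (i + n) = residue n i := by
  apply Fin.ext
  simp only [residue, Int.divModEquiv, Equiv.coe_fn_mk, Fin.val_ofNat, Int.natMod]
  rw [show i + n - 1 = i - 1 + n by ring, Int.add_emod_right]

theorem wind_add (i : ℤ) : wind n (i + n) = wind n i + 1 := by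
  simp only [wind, Int.divModEquiv, Equiv.coe_fn_mk]
  rw [show i + n - 1 = i - 1 + n * 1 by ring,
    Int.add_mul_ediv_left _ _ (by exact_mod_cast NeZero.ne n)]

theorem eq_residue_wind (i : ℤ) : i = wind n i * n + (residue n i : ℕ) + 1 := by
  have h := (Int.divModEquiv n).symm_apply_apply (i - 1)
  rw [Int.divModEquiv_symm_apply] at h
  simp only [residue, wind]
  omega

/-- Translation by `β`: `i ↦ i + n β_{i mod n}`. -/
def translation (β : Fin n → ℤ) : AffSym n :=
  ⟨{ toFun := fun i => i + n * β (residue n i)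
     invFun := fun i => i - n * β (residue n i)
     left_inv := by
       intro i
       have h : ∀ (m : ℤ) (i : ℤ), residue n (i + n * m) = residue n i := by
         intro m i
         apply Fin.ext
         simp only [residue, Int.divModEquiv, Equiv.coe_fn_mk, Fin.val_ofNat, Int.natMod]
         rw [show i + n * m - 1 = i - 1 + n * m by ring, Int.add_mul_emod_self_left]
       simp only [h]; ring
     right_inv := by
       intro i
       have h : ∀ (m : ℤ) (i : ℤ), residue n (i - n * m) = residue n i := by
         intro m i
         apply Fin.ext
         simp only [residue, Int.divModEquiv, Equiv.coe_fn_mk, Fin.val_ofNat, Int.natMod]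
         rw [show i - n * m - 1 = i - 1 + n * (-m) by ring, Int.add_mul_emod_self_left]
       simp only [h]; ring }, by
    intro i
    simp only [Equiv.coe_fn_mk, residue_add]
    ring⟩

/-- The embedding of the finite symmetric group: a permutation of `{1, …, n}` is extended
to `ℤ` by `w (i + n) = w i + n`. -/
def finiteSym (σ : Equiv.Perm (Fin n)) : AffSym n :=
  ⟨(((Equiv.subRight 1).trans (Int.divModEquiv n)).trans
      (Equiv.prodCongr (Equiv.refl ℤ) σ)).trans
      ((Int.divModEquiv n).symm.trans (Equiv.addRight 1)), by
    intro i
    change (Int.divModEquiv n).symm (wind n (i + n), σ (residue n (i + n))) + 1 =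
      (Int.divModEquiv n).symm (wind n i, σ (residue n i)) + 1 + n
    rw [wind_add, residue_add]
    simp only [Int.divModEquiv_symm_apply]
    ring⟩

/-- `γ`, the translation by `-ρ = (0, -1, …, 1 - n)`. -/
def gam (n : ℕ) [NeZero n] : AffSym n := translation fun r : Fin n => -((r : ℕ) : ℤ)

/-- `w = π ^ k s_{l_1} ⋯ s_{l_m}` is a reduced expression: no expression of `w` of this form
uses fewer simple reflections. -/
def IsReducedExpr (w : AffSym n) (p : ℤ × List ℤ) : Prop :=
  w = rot n ^ p.1 * (p.2.map (simple n)).prod ∧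
    ∀ p' : ℤ × List ℤ, w = rot n ^ p'.1 * (p'.2.map (simple n)).prod →
      p.2.length ≤ p'.2.length

/-- A choice of a reduced expression. -/
def reducedExpr (w : AffSym n) : ℤ × List ℤ := Classical.epsilon (IsReducedExpr w)

variable {K : Type*} [Field K]

/-! ### The double affine Hecke algebra of `GL_n` -/

/-- Quasi-periodic extension of a family `y_1, …, y_n` to integer subscripts:
`y_{i + m n} = q ^ (-m) y_i`. -/
def extend {M : Type*} [AddCommGroup M] [Module K M] (q : Kˣ) (y : Fin n → M) (i : ℤ) : M :=
  ((q ^ (-(wind n i)) : Kˣ) : K) • y (residue n i)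

/-- The generators. -/
inductive Gen (n : ℕ)
  | T (i : ZMod n)
  | pi
  | piInv
  | Y (i : Fin n)
  | YInv (i : Fin n)

/-- The generator `T_i`, with subscript read modulo `n`, in the free algebra. -/
def freeT (K : Type*) [Field K] (n : ℕ) (i : ℤ) : FreeAlgebra K (Gen n) :=
  FreeAlgebra.ι K (Gen.T (i : ZMod n))

/-- `Y_i` for any integer `i`, where `Y_{i + m n} = q ^ (-m) Y_i`, in the free algebra. -/
def freeY (q : Kˣ) (i : ℤ) : FreeAlgebra K (Gen n) :=
  extend q (fun r : Fin n => FreeAlgebra.ι K (Gen.Y r)) i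

/-- The defining relations of the double affine Hecke algebra of `GL_n`, written with integer
subscripts. For instance `T_0 Y_0 T_0 = Y_1` says `T_0 Y_n T_0 = q⁻¹ Y_1`, and
`π Y_n = Y_{n+1} π` says `π Y_n π⁻¹ = q⁻¹ Y_1`. -/
inductive Rel (n : ℕ) [NeZero n] (q t : Kˣ) :
    FreeAlgebra K (Gen n) → FreeAlgebra K (Gen n) → Prop
  | quadratic (i : ℤ) : Rel n q t
      ((freeT K n i - algebraMap K _ (t : K)) *
        (freeT K n i + algebraMap K _ ((t⁻¹ : Kˣ) : K))) 0
  | braid (i : ℤ) (hn : 3 ≤ n) : Rel n q t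
      (freeT K n i * freeT K n (i + 1) * freeT K n i)
      (freeT K n (i + 1) * freeT K n i * freeT K n (i + 1))
  | comm (i j : ℤ) (hn : 3 ≤ n) (h₁ : ¬ j ≡ i + 1 [ZMOD n]) (h₂ : ¬ j ≡ i - 1 [ZMOD n]) :
      Rel n q t (freeT K n i * freeT K n j) (freeT K n j * freeT K n i)
  | pi_mul_piInv : Rel n q t
      (FreeAlgebra.ι K Gen.pi * FreeAlgebra.ι K Gen.piInv) 1
  | piInv_mul_pi : Rel n q t
      (FreeAlgebra.ι K Gen.piInv * FreeAlgebra.ι K Gen.pi) 1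
  | pi_T (i : ℤ) : Rel n q t
      (FreeAlgebra.ι K Gen.pi * freeT K n i) (freeT K n (i + 1) * FreeAlgebra.ι K Gen.pi)
  | Y_mul_YInv (i : Fin n) : Rel n q t
      (FreeAlgebra.ι K (Gen.Y i) * FreeAlgebra.ι K (Gen.YInv i)) 1
  | YInv_mul_Y (i : Fin n) : Rel n q t
      (FreeAlgebra.ι K (Gen.YInv i) * FreeAlgebra.ι K (Gen.Y i)) 1
  | Y_comm (i j : Fin n) : Rel n q t
      (FreeAlgebra.ι K (Gen.Y i) * FreeAlgebra.ι K (Gen.Y j))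
      (FreeAlgebra.ι K (Gen.Y j) * FreeAlgebra.ι K (Gen.Y i))
  | T_Y_T (i : ℤ) : Rel n q t
      (freeT K n i * freeY q i * freeT K n i) (freeY q (i + 1))
  | T_Y (i j : ℤ) (h₁ : ¬ j ≡ i [ZMOD n]) (h₂ : ¬ j ≡ i + 1 [ZMOD n]) : Rel n q t
      (freeT K n i * freeY q j) (freeY q j * freeT K n i)
  | pi_Y (i : ℤ) : Rel n q t
      (FreeAlgebra.ι K Gen.pi * freeY q i) (freeY q (i + 1) * FreeAlgebra.ι K Gen.pi)

/-- The double affine Hecke algebra of `GL_n` with loop parameter `q` and quadratic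
parameter `t`. -/
def DAHA (n : ℕ) [NeZero n] (q t : Kˣ) : Type _ := RingQuot (Rel n q t)

instance (q t : Kˣ) : Ring (DAHA n q t) := inferInstanceAs (Ring (RingQuot _))

instance (q t : Kˣ) : Algebra K (DAHA n q t) := inferInstanceAs (Algebra K (RingQuot _))

variable {q t : Kˣ}

/-- The quotient map from the free algebra. -/
def ofFree (q t : Kˣ) : FreeAlgebra K (Gen n) →ₐ[K] DAHA n q t := RingQuot.mkAlgHom K (Rel n q t)

theorem ofFree_rel {x y : FreeAlgebra K (Gen n)} (h : Rel n q t x y) :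
    ofFree q t x = ofFree q t y := RingQuot.mkAlgHom_rel K h

/-- `T_i`, with `T_{i + m n} = T_i`. -/
def T (q t : Kˣ) (i : ℤ) : DAHA n q t := ofFree q t (freeT K n i)

/-- `π`, as a unit. -/
def piU (q t : Kˣ) : (DAHA n q t)ˣ where
  val := ofFree q t (FreeAlgebra.ι K Gen.pi)
  inv := ofFree q t (FreeAlgebra.ι K Gen.piInv)
  val_inv := by rw [← map_mul, ofFree_rel Rel.pi_mul_piInv, map_one]
  inv_val := by rw [← map_mul, ofFree_rel Rel.piInv_mul_pi, map_one]

/-- `Y_1, …, Y_n`, as units. -/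
def YU (q t : Kˣ) (i : Fin n) : (DAHA n q t)ˣ where
  val := ofFree q t (FreeAlgebra.ι K (Gen.Y i))
  inv := ofFree q t (FreeAlgebra.ι K (Gen.YInv i))
  val_inv := by rw [← map_mul, ofFree_rel (Rel.Y_mul_YInv i), map_one]
  inv_val := by rw [← map_mul, ofFree_rel (Rel.YInv_mul_Y i), map_one]

theorem YU_comm (q t : Kˣ) (i j : Fin n) : Commute (YU q t i) (YU q t j) := by
  apply Units.ext
  simp only [Units.val_mul, YU]
  rw [← map_mul, ← map_mul, ofFree_rel (Rel.Y_comm i j)]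

/-- `Y_i` for any integer `i`, with `Y_{i + m n} = q ^ (-m) Y_i`. -/
def Y (q t : Kˣ) (i : ℤ) : DAHA n q t := extend q (fun r : Fin n => (YU q t r : DAHA n q t)) i

/-- `T_w = π ^ k T_{l_1} ⋯ T_{l_m}` for a reduced expression `w = π ^ k s_{l_1} ⋯ s_{l_m}`. -/
def TW (q t : Kˣ) (w : AffSym n) : DAHA n q t :=
  ((piU q t ^ (reducedExpr w).1 : (DAHA n q t)ˣ) : DAHA n q t) *
    ((reducedExpr w).2.map (T q t)).prod

/-! ### Laurent polynomials in the `Y_i` and their localization -/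

/-- `K[Y_1^{±1}, …, Y_n^{±1}]`. -/
abbrev Laurent (K : Type*) [Field K] (n : ℕ) : Type _ :=
  MonoidAlgebra K (Fin n → Multiplicative ℤ)

/-- The homomorphism from Laurent polynomials that sends `Y_i` to `y i`, for commuting
invertible elements `y i`. -/
def laurentLift {A : Type*} [Ring A] [Algebra K A] (y : Fin n → Aˣ)
    (hy : ∀ i j, Commute (y i) (y j)) : Laurent K n →ₐ[K] A :=
  MonoidAlgebra.lift K A (Fin n → Multiplicative ℤ)
    ((Units.coeHom A).comp
      (MonoidHom.noncommPiCoprod (fun i => zpowersHom Aˣ (y i)) (by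
        intro i j _ a b
        exact (hy i j).zpow_zpow _ _)))

/-- The Laurent monomial `Y_r`. -/
def lY (K : Type*) [Field K] (r : Fin n) : Laurent K n :=
  MonoidAlgebra.of K _ (Pi.mulSingle r (Multiplicative.ofAdd 1))

theorem laurentLift_lY {A : Type*} [Ring A] [Algebra K A] (y : Fin n → Aˣ)
    (hy : ∀ i j, Commute (y i) (y j)) (r : Fin n) : laurentLift (K := K) y hy (lY K r) = y r := by
  have h := MonoidHom.noncommPiCoprod_mulSingle (fun i => zpowersHom Aˣ (y i))
    (hcomm := fun i j _ a b => (hy i j).zpow_zpow _ _) r (Multiplicative.ofAdd 1)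
  simp only [laurentLift, lY, MonoidAlgebra.lift_of, MonoidHom.comp_apply, Units.coeHom_apply]
  exact congrArg Units.val (h.trans (by simp))

/-- Evaluation of Laurent polynomials at `a = (a_1, …, a_n)`. -/
def evalAt (a : Fin n → Kˣ) : Laurent K n →ₐ[K] K :=
  laurentLift a fun i j => Commute.all (a i) (a j)

/-- The inclusion of the Laurent polynomials in the double affine Hecke algebra. -/
def incl (q t : Kˣ) : Laurent K n →ₐ[K] DAHA n q t := laurentLift (YU q t) (YU_comm q t)

/-- The pairs of integers `(i, j)` with `i ≢ j mod n`. -/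
abbrev Pair (n : ℕ) : Type := {p : ℤ × ℤ // ¬ p.1 ≡ p.2 [ZMOD n]}

/-- `f_{i,j} = t Y_i - t⁻¹ Y_j` as a Laurent polynomial. -/
def lf (q t : Kˣ) (i j : ℤ) : Laurent K n :=
  (t : K) • extend q (lY K) i - ((t⁻¹ : Kˣ) : K) • extend q (lY K) j

/-- `f_{i,j} = t Y_i - t⁻¹ Y_j` in the double affine Hecke algebra. -/
def f (q t : Kˣ) (i j : ℤ) : DAHA n q t :=
  (t : K) • Y q t i - ((t⁻¹ : Kˣ) : K) • Y q t j

theorem incl_lf (q t : Kˣ) (i j : ℤ) : incl (n := n) q t (lf q t i j) = f q t i j := by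
  simp only [lf, f, Y, extend, map_sub, map_smul, incl, laurentLift_lY]

/-- The multiplicative set generated by the `f_{i,j}` with `i ≢ j mod n`. -/
def fMonoid (n : ℕ) [NeZero n] (q t : Kˣ) : Submonoid (Laurent K n) :=
  Submonoid.closure (Set.range fun p : Pair n => lf q t p.1.1 p.1.2)

/-- The localization of the Laurent polynomials at the `f_{i,j}` with `i ≢ j mod n`. -/
abbrev LaurentLoc (n : ℕ) [NeZero n] (q t : Kˣ) : Type _ := Localization (fMonoid n q t)

/-- `g` has no pole at `a`, and its value there is `c`. -/
def HasValueAt (a : Fin n → Kˣ) (g : LaurentLoc n q t) (c : K) : Prop :=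
  ∃ (p : Laurent K n) (s : fMonoid n q t), evalAt a s ≠ 0 ∧
    g = Localization.mk p s ∧ c = evalAt a p / evalAt a s

/-! ### The localized double affine Hecke algebra -/

/-- Relations for adjoining to the double affine Hecke algebra two-sided inverses of the
`f_{i,j}` with `i ≢ j mod n`: the left summand of `DAHA n q t ⊕ Pair n` carries the given
algebra, the right summand the new inverses. -/
inductive LocRel (n : ℕ) [NeZero n] (q t : Kˣ) :
    FreeAlgebra K (DAHA n q t ⊕ Pair n) → FreeAlgebra K (DAHA n q t ⊕ Pair n) → Prop
  | add (x y : DAHA n q t) : LocRel n q t (FreeAlgebra.ι K (Sum.inl (x + y)))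
      (FreeAlgebra.ι K (Sum.inl x) + FreeAlgebra.ι K (Sum.inl y))
  | mul (x y : DAHA n q t) : LocRel n q t (FreeAlgebra.ι K (Sum.inl (x * y)))
      (FreeAlgebra.ι K (Sum.inl x) * FreeAlgebra.ι K (Sum.inl y))
  | scalar (c : K) : LocRel n q t (FreeAlgebra.ι K (Sum.inl (algebraMap K _ c)))
      (algebraMap K _ c)
  | mul_inv (p : Pair n) : LocRel n q t
      (FreeAlgebra.ι K (Sum.inl (f q t p.1.1 p.1.2)) * FreeAlgebra.ι K (Sum.inr p)) 1
  | inv_mul (p : Pair n) : LocRel n q t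
      (FreeAlgebra.ι K (Sum.inr p) * FreeAlgebra.ι K (Sum.inl (f q t p.1.1 p.1.2))) 1

/-- The localization of the double affine Hecke algebra at the `f_{i,j}` with `i ≢ j mod n`.
It is given by the universal property that also characterizes the Ore localization (the
`f_{i,j}` generate an Ore set): it is the universal algebra under `DAHA n q t` in which these
elements become invertible. -/
def DAHALoc (n : ℕ) [NeZero n] (q t : Kˣ) : Type _ := RingQuot (LocRel n q t)

instance (q t : Kˣ) : Ring (DAHALoc n q t) := inferInstanceAs (Ring (RingQuot _))

instance (q t : Kˣ) : Algebra K (DAHALoc n q t) := inferInstanceAs (Algebra K (RingQuot _))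

/-- The quotient map from the free algebra. -/
def ofFreeLoc (q t : Kˣ) : FreeAlgebra K (DAHA n q t ⊕ Pair n) →ₐ[K] DAHALoc n q t :=
  RingQuot.mkAlgHom K (LocRel n q t)

theorem ofFreeLoc_rel {x y : FreeAlgebra K (DAHA n q t ⊕ Pair n)} (h : LocRel n q t x y) :
    ofFreeLoc q t x = ofFreeLoc q t y := RingQuot.mkAlgHom_rel K h

/-- The canonical map from the double affine Hecke algebra to its localization. -/
def toLoc (q t : Kˣ) : DAHA n q t →ₐ[K] DAHALoc n q t where
  toFun x := ofFreeLoc q t (FreeAlgebra.ι K (Sum.inl x))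
  map_one' := by
    have h := ofFreeLoc_rel (LocRel.scalar (n := n) (q := q) (t := t) 1)
    simpa using h
  map_zero' := by
    have h := ofFreeLoc_rel (LocRel.scalar (n := n) (q := q) (t := t) 0)
    simpa using h
  map_mul' x y := by rw [ofFreeLoc_rel (LocRel.mul x y), map_mul]
  map_add' x y := by rw [ofFreeLoc_rel (LocRel.add x y), map_add]
  commutes' c := by rw [ofFreeLoc_rel (LocRel.scalar c), AlgHom.commutes]

theorem isUnit_f (p : Pair n) : IsUnit (toLoc q t (f (n := n) q t p.1.1 p.1.2)) := by
  refine ⟨⟨_, ofFreeLoc q t (FreeAlgebra.ι K (Sum.inr p)), ?_, ?_⟩, rfl⟩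
  · change ofFreeLoc q t (FreeAlgebra.ι K (Sum.inl (f q t p.1.1 p.1.2))) * _ = 1
    rw [← map_mul, ofFreeLoc_rel (LocRel.mul_inv p), map_one]
  · change _ * ofFreeLoc q t (FreeAlgebra.ι K (Sum.inl (f q t p.1.1 p.1.2))) = 1
    rw [← map_mul, ofFreeLoc_rel (LocRel.inv_mul p), map_one]

/-- The map from the Laurent polynomials to the localized double affine Hecke algebra. -/
def inclToLoc (n : ℕ) [NeZero n] (q t : Kˣ) : Laurent K n →+* DAHALoc n q t :=
  (toLoc (n := n) q t : DAHA n q t →+* DAHALoc n q t).comp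
    (incl (n := n) q t : Laurent K n →+* DAHA n q t)

theorem isUnit_fMonoid (s : fMonoid n q t) :
    IsUnit (((inclToLoc n q t : Laurent K n →* DAHALoc n q t).comp (fMonoid n q t).subtype) s) := by
  obtain ⟨s, hs⟩ := s
  change IsUnit (inclToLoc n q t s)
  induction hs using Submonoid.closure_induction with
  | mem x hx =>
    obtain ⟨p, rfl⟩ := hx
    change IsUnit (toLoc q t (incl q t (lf q t p.1.1 p.1.2)))
    rw [incl_lf]
    exact isUnit_f p
  | one => rw [map_one]; exact isUnit_one
  | mul x y _ _ hx hy => rw [map_mul]; exact hx.mul hy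

/-- The map from the localized Laurent polynomials to the localized double affine Hecke algebra
which extends the inclusion of the Laurent polynomials. -/
def inclLoc (n : ℕ) [NeZero n] (q t : Kˣ) : LaurentLoc n q t →+* DAHALoc n q t :=
  OreLocalization.universalHom (inclToLoc n q t)
    (IsUnit.liftRight _ isUnit_fMonoid) (fun _ => rfl)

/-- Cherednik's intertwiner `φ_i = T_i Y_i - Y_i T_i`. -/
def phi (q t : Kˣ) (i : ℤ) : DAHA n q t := T q t i * Y q t i - Y q t i * T q t i

/-- The renormalized intertwiner `ν_i = φ_i f_{i,i+1}⁻¹`. (`Ring.inverse` is the inverse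
of a unit; for `n ≥ 2` the element `f_{i,i+1}` is one in the localization, and for `n = 1` there
are no simple reflections.) -/
def nu (q t : Kˣ) (i : ℤ) : DAHALoc n q t :=
  toLoc q t (phi q t i) * Ring.inverse (toLoc q t (f q t i (i + 1)))

/-- `ν_w = π ^ k ν_{l_1} ⋯ ν_{l_m}` for a reduced expression `w = π ^ k s_{l_1} ⋯ s_{l_m}`. -/
def nuW (q t : Kˣ) (w : AffSym n) : DAHALoc n q t :=
  toLoc q t ((piU q t ^ (reducedExpr w).1 : (DAHA n q t)ˣ) : DAHA n q t) *
    ((reducedExpr w).2.map (nu q t)).prod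

/-- `h = ∑_x T_x g_x` is the normal ordering of `h`. -/
def IsNormalOrdering (h : DAHALoc n q t) (g : AffSym n →₀ LaurentLoc n q t) : Prop :=
  h = ∑ x ∈ g.support, toLoc q t (TW q t x) * inclLoc n q t (g x)

/-! ### Induced modules -/

/-- The one-dimensional module over the Laurent polynomials on which `Y_i` acts by `a_i`. -/
def CharLine (_a : Fin n → Kˣ) : Type _ := K

instance (a : Fin n → Kˣ) : AddCommGroup (CharLine a) := inferInstanceAs (AddCommGroup K)

instance (a : Fin n → Kˣ) : Module (Laurent K n) (CharLine a) :=
  Module.compHom K (evalAt a : Laurent K n →+* K)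

/-- The basis vector of the one-dimensional module. -/
def basisVec (a : Fin n → Kˣ) : CharLine a := (1 : K)

/-- The double affine Hecke algebra as a right module over the commutative ring of Laurent
polynomials. -/
instance rightModule (q t : Kˣ) : Module (Laurent K n) (DAHA n q t) where
  smul p h := h * incl q t p
  one_smul h := by change h * incl q t 1 = h; rw [map_one, mul_one]
  mul_smul p p' h := by
    change h * incl q t (p * p') = h * incl q t p' * incl q t p
    rw [mul_comm p p', map_mul, mul_assoc]
  smul_zero p := zero_mul _
  zero_smul h := by change h * incl q t 0 = 0; rw [map_zero, mul_zero]
  smul_add p h h' := add_mul _ _ _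
  add_smul p p' h := by
    change h * incl q t (p + p') = h * incl q t p + h * incl q t p'
    rw [map_add, mul_add]

instance (q t : Kˣ) : SMulCommClass (Laurent K n) (DAHA n q t) (DAHA n q t) where
  smul_comm p x h := mul_assoc x h (incl q t p)

instance (q t : Kˣ) : SMulCommClass (Laurent K n) K (DAHA n q t) where
  smul_comm p c h := smul_mul_assoc c h (incl q t p)

/-- The module induced from the one-dimensional module `a` of the Laurent polynomials: the tensor
product over the Laurent polynomials of the double affine Hecke algebra, with its right action,
and the one-dimensional module; the double affine Hecke algebra acts by left multiplication. -/
abbrev Ind (q t : Kˣ) (a : Fin n → Kˣ) : Type _ := DAHA n q t ⊗[Laurent K n] CharLine a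

/-- The character `q ^ ρ = (1, q, …, q ^ (n - 1))`. -/
def qRho (n : ℕ) (q : Kˣ) (r : Fin n) : Kˣ := q ^ (r : ℕ)

end GLDaha

end

/-!
The double affine Hecke algebra acts on the field of rational functions in the `Y_i`, the `Y_i` by
multiplication, `π` by `Y_i ↦ Y_{i+1}`, and `T_i` by the Demazure–Lusztig operator
`t + (s_i - 1) f_{i,i+1} / (Y_i - Y_{i+1})`. In this representation (`rho`, and `rhoLoc` for the
localization) the renormalized intertwiner `ν_w` becomes the substitution `Y_i ↦ Y_{w i}`
(`rhoLoc_nuW`). As `q = t⁻²`, the differences `Y_i - Y_j = t⁻¹ f_{i,j+n}` are among the inverted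
elements (`fF_add_n`).

*Normal orderings.* By Matsumoto's theorem (`wordVal_eq_of_reduced`) and the Bernstein relations, the
`T_x` generate `ℍ` over the Laurent polynomials, and the localization over the localized ones
(`span_TW_mul_incl`, `locSum_surjective`). The operator of `T_x` is `x λ_x⁻¹` plus terms with shorter
affine permutations, where `λ_x` is the product of `(Y_a - Y_b) / f_{a,b}` over the inversions
`(a, b)` of `x` (`rho_TW_sub_mem_low`). Substitutions are independent over the rational
functions, so the `T_x` are too (`opSum_injective`). Hence normal orderings exist and are unique, the
`T_x ⊗ v` form a basis of the induced module, and the coefficient of `T_w` in `:ν_w:` is `λ_w`, the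
other coefficients belonging to shorter elements (`coeff_of_opSum_eq_permOp`).

*Poles.* The relation `specRel` consists of the pairs of an operator `∑ h g`, with `g` without pole
at `q^ρ`, and its value `∑ g(q^ρ) h ⊗ v`. It is the graph of a function (`specRel_unique`), and it
is compatible with composition of the operators that stabilize `q^ρ` (`specRel_mul_permOp`). The
stabilizer is `γ⁻¹ 𝔖_n γ` (`mem_levelStab_iff`), so it suffices to treat the simple reflections of
`𝔖_n`. There `γ⁻¹ s γ = x s_j x⁻¹` exchanges `A` and `A + n + 1`, with `x = s_A ⋯ s_{j-1}` and
`j = A + n - 1`. The operator of `x⁻¹` has no pole, and the one of `x` is a product of the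
`T_i Y_i - Y_i T_i` divided by the `f_{A+i,j}`, of which only `f_{A,j} = -t⁻¹ (Y_j - Y_{j+1})`
vanishes at `q^ρ` after the conjugation. This factor cancels against the numerator of the
intertwiner of `s_j` (`permOp_reflection_mem_regOp`); the divided differences that arise when the
remaining denominators are moved to the right have no pole (`IsReg.divided_difference`).

*Endomorphisms.* The values `:ν_{γ⁻¹wγ}: ⊗ v` are therefore defined. They are weight vectors of
weight `q^ρ` and correspond to endomorphisms `Φ_w` by the universal property of the induced module
(`indLift`); uniqueness of values gives `Φ_w Φ_u = Φ_{uw}` (`weightVec_mul`). The longest terms of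
a weight vector are multiples of `T_x ⊗ v` with `x` in the stabilizer (`eq_zero_of_isWeight`), so the
weight space embeds in `K^{𝔖_n}`. The `n!` vectors above are triangular with respect to length, and
their diagonal entries `λ_x(q^ρ)` do not vanish, because in `λ_x` the zeros and poles at `q^ρ` pair off
(`isReg_inv_lam`). So they form a basis of the weight space, which is the endomorphism algebra.
-/

set_option linter.unusedSectionVars false

noncomputable section

namespace GLDaha

variable {n : ℕ} [NeZero n]

/-! ### Combinatorics of affine permutations -/

theorem apply_add_mul (w : AffSym n) (i m : ℤ) : w.1 (i + m * n) = w.1 i + m * n := by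
  induction m using Int.induction_on with
  | zero => simp
  | succ k ih =>
    rw [show i + ((k : ℤ) + 1) * n = i + k * n + n by ring, w.2, ih]; ring
  | pred k ih =>
    have h := w.2 (i + (-(k : ℤ) - 1) * n)
    rw [show i + (-(k : ℤ) - 1) * n + n = i + -(k : ℤ) * n by ring, ih] at h
    linarith

theorem dvd_apply_sub_iff (w : AffSym n) (i j : ℤ) :
    (n : ℤ) ∣ w.1 i - w.1 j ↔ (n : ℤ) ∣ i - j := by
  constructor
  · rintro ⟨m, hm⟩
    refine ⟨m, ?_⟩
    have h : w.1 i = w.1 (j + m * n) := by rw [apply_add_mul]; linarith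
    have := w.1.injective h
    linarith
  · rintro ⟨m, hm⟩
    refine ⟨m, ?_⟩
    rw [show i = j + m * n by linarith, apply_add_mul]; ring

/-- The representative in `{1, …, n}` of a residue. -/
def rep (r : Fin n) : ℤ := ((r : ℕ) : ℤ) + 1

theorem eq_rep_add (i : ℤ) : i = rep (residue n i) + wind n i * n := by
  have := eq_residue_wind (n := n) i
  simp only [rep]
  linarith

theorem residue_wind_of_eq {i : ℤ} {r : Fin n} {m : ℤ} (h : i = rep r + m * n) :
    residue n i = r ∧ wind n i = m := by
  have h1 := (Int.divModEquiv n).apply_symm_apply (m, r)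
  have h2 : (Int.divModEquiv n).symm (m, r) = i - 1 := by
    rw [Int.divModEquiv_symm_apply, h, rep]; ring
  rw [h2] at h1
  exact ⟨congrArg Prod.snd h1, congrArg Prod.fst h1⟩

@[simp] theorem residue_rep (r : Fin n) : residue n (rep r) = r :=
  (residue_wind_of_eq (m := 0) (by ring)).1

@[simp] theorem wind_rep (r : Fin n) : wind n (rep r) = 0 :=
  (residue_wind_of_eq (m := 0) (by ring)).2

theorem residue_wind_add_mul (i m : ℤ) :
    residue n (i + m * n) = residue n i ∧ wind n (i + m * n) = wind n i + m := by
  apply residue_wind_of_eq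
  nth_rewrite 1 [eq_rep_add (n := n) i]
  ring

theorem residue_eq_iff {i j : ℤ} : residue n i = residue n j ↔ (n : ℤ) ∣ i - j := by
  constructor
  · intro h
    refine ⟨wind n i - wind n j, ?_⟩
    have h1 := eq_rep_add (n := n) i
    have h2 := eq_rep_add (n := n) j
    rw [h] at h1
    linear_combination h1 - h2
  · rintro ⟨m, hm⟩
    rw [show i = j + m * n by linarith, (residue_wind_add_mul j m).1]

/-- Two affine permutations which agree on `{1, …, n}` are equal. -/
theorem ext_rep {w w' : AffSym n} (h : ∀ r : Fin n, w.1 (rep r) = w'.1 (rep r)) : w = w' := by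
  apply Subtype.ext
  ext i
  rw [eq_rep_add (n := n) i, apply_add_mul, apply_add_mul, h]

/-- An affine permutation permutes the residues. -/
def residuePerm (w : AffSym n) : Equiv.Perm (Fin n) where
  toFun r := residue n (w.1 (rep r))
  invFun r := residue n ((w⁻¹).1 (rep r))
  left_inv r := by
    conv_rhs => rw [← residue_rep r]
    rw [residue_eq_iff]
    have h := eq_rep_add (n := n) (w.1 (rep r))
    have h1 : rep r = (w⁻¹).1 (w.1 (rep r)) := (w.1.symm_apply_apply _).symm
    beta_reduce
    nth_rewrite 2 [h1]
    rw [dvd_apply_sub_iff, ← residue_eq_iff, residue_rep]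
  right_inv r := by
    conv_rhs => rw [← residue_rep r]
    rw [residue_eq_iff]
    have h1 : rep r = w.1 ((w⁻¹).1 (rep r)) := (w.1.apply_symm_apply _).symm
    beta_reduce
    nth_rewrite 2 [h1]
    rw [dvd_apply_sub_iff, ← residue_eq_iff, residue_rep]

/-- A periodic product over a window does not change when the window is moved by an affine
permutation. -/
theorem prod_apply_rep {M : Type*} [CommMonoid M] (w : AffSym n) (G : ℤ → M)
    (hG : ∀ a m : ℤ, G (a + m * n) = G a) :
    ∏ r : Fin n, G (w.1 (rep r)) = ∏ r : Fin n, G (rep r) := by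
  rw [← Equiv.prod_comp (residuePerm w) (fun r => G (rep r))]
  refine Finset.prod_congr rfl fun r _ => ?_
  conv_lhs => rw [eq_rep_add (n := n) (w.1 (rep r)), hG]
  rfl

/-! ### Simple reflections -/

theorem simple_of_dvd (hn : 1 < n) {i x : ℤ} (h : (n : ℤ) ∣ x - i) :
    (simple n i).1 x = x + 1 := by
  have h2 : ¬ (n : ℤ) ∣ x - (i + 1) := by
    intro h3
    have h4 := dvd_sub h h3
    rw [show x - i - (x - (i + 1)) = 1 by ring] at h4
    have := Int.le_of_dvd one_pos h4
    omega
  change simpleFun n i x = _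
  simp [simpleFun, h, h2]

theorem simple_of_dvd_succ (hn : 1 < n) {i x : ℤ} (h : (n : ℤ) ∣ x - (i + 1)) :
    (simple n i).1 x = x - 1 := by
  have h2 : ¬ (n : ℤ) ∣ x - i := by
    intro h3
    have h4 := dvd_sub h3 h
    rw [show x - i - (x - (i + 1)) = 1 by ring] at h4
    have := Int.le_of_dvd one_pos h4
    omega
  change simpleFun n i x = _
  simp [simpleFun, h, h2]

theorem simple_of_not_dvd {i x : ℤ} (h1 : ¬ (n : ℤ) ∣ x - i) (h2 : ¬ (n : ℤ) ∣ x - (i + 1)) :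
    (simple n i).1 x = x := by
  change simpleFun n i x = _
  simp [simpleFun, h1, h2]

theorem simple_self (hn : 1 < n) (i : ℤ) : (simple n i).1 i = i + 1 :=
  simple_of_dvd hn (by simp)

theorem simple_succ (hn : 1 < n) (i : ℤ) : (simple n i).1 (i + 1) = i := by
  rw [simple_of_dvd_succ hn (by simp)]; ring

theorem simple_mul_self (i : ℤ) : simple n i * simple n i = 1 := by
  apply Subtype.ext
  ext x
  exact simpleFun_involutive n i x

theorem simple_inv (i : ℤ) : (simple n i)⁻¹ = simple n i :=
  inv_eq_of_mul_eq_one_left (simple_mul_self i)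

theorem simple_apply_simple (i x : ℤ) : (simple n i).1 ((simple n i).1 x) = x :=
  simpleFun_involutive n i x

theorem simple_mul_simple_cancel (w : AffSym n) (i : ℤ) : w * simple n i * simple n i = w := by
  rw [mul_assoc, simple_mul_self, mul_one]

/-- An affine permutation is a conjugate of a simple reflection as soon as it exchanges two
entries and fixes those in the other residue classes. -/
theorem eq_conj_simple (hn : 1 < n) {v x : AffSym n} {i : ℤ} (h1 : v.1 (x.1 i) = x.1 (i + 1))
    (h2 : v.1 (x.1 (i + 1)) = x.1 i)
    (h3 : ∀ z, ¬ (n : ℤ) ∣ z - i → ¬ (n : ℤ) ∣ z - (i + 1) → v.1 (x.1 z) = x.1 z) :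
    v = x * simple n i * x⁻¹ := by
  rw [eq_mul_inv_iff_mul_eq]
  apply Subtype.ext
  ext z
  change v.1 (x.1 z) = x.1 ((simple n i).1 z)
  by_cases hz : (n : ℤ) ∣ z - i
  · obtain ⟨m, hm⟩ := hz
    obtain rfl : z = i + m * n := by linarith
    rw [apply_add_mul, apply_add_mul, apply_add_mul, apply_add_mul, simple_self hn, h1]
  by_cases hz' : (n : ℤ) ∣ z - (i + 1)
  · obtain ⟨m, hm⟩ := hz'
    obtain rfl : z = i + 1 + m * n := by linarith
    rw [apply_add_mul, apply_add_mul, apply_add_mul, apply_add_mul, simple_succ hn, h2]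
  rw [h3 z hz hz', simple_of_not_dvd hz hz']

/-- Conjugates of simple reflections are determined by one pair of entries which they exchange. -/
theorem conj_simple_eq (hn : 1 < n) {x y : AffSym n} {i j : ℤ} (h1 : x.1 i = y.1 j)
    (h2 : x.1 (i + 1) = y.1 (j + 1)) :
    x * simple n i * x⁻¹ = y * simple n j * y⁻¹ := by
  have hx : ∀ z, (x * simple n i * x⁻¹).1 (x.1 z) = x.1 ((simple n i).1 z) := by
    intro z
    change x.1 ((simple n i).1 (x.1.symm (x.1 z))) = _
    rw [Equiv.symm_apply_apply]
  apply eq_conj_simple hn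
  · rw [← h1, hx, simple_self hn, h2]
  · rw [← h2, hx, simple_succ hn, h1]
  · intro z hz1 hz2
    obtain ⟨z', hz'⟩ := x.1.surjective (y.1 z)
    rw [← hz', hx, simple_of_not_dvd]
    · rwa [← dvd_apply_sub_iff x, hz', h1, dvd_apply_sub_iff]
    · rwa [← dvd_apply_sub_iff x, hz', h2, dvd_apply_sub_iff]

theorem simple_eq_of_dvd {i j : ℤ} (h : (n : ℤ) ∣ i - j) : simple n i = simple n j := by
  have e : ∀ x c : ℤ, (n : ℤ) ∣ x - (i + c) ↔ (n : ℤ) ∣ x - (j + c) := by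
    intro x c
    rw [show x - (j + c) = x - (i + c) + (i - j) by ring]
    exact (dvd_add_left h).symm
  apply Subtype.ext
  ext x
  have e0 := e x 0
  simp only [add_zero] at e0
  change simpleFun n i x = simpleFun n j x
  simp only [simpleFun, e0, e x 1]

theorem simple_braid (hn : 3 ≤ n) (i : ℤ) :
    simple n i * simple n (i + 1) * simple n i =
      simple n (i + 1) * simple n i * simple n (i + 1) := by
  have hn' : 1 < n := by omega
  have h2 : ¬ (n : ℤ) ∣ i - (i + 1 + 1) := by
    rw [show i - (i + 1 + 1) = -2 by ring, dvd_neg]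
    intro h; have := Int.le_of_dvd two_pos h; omega
  have h3 : ¬ (n : ℤ) ∣ i - (i + 1) := by
    rw [show i - (i + 1) = -1 by ring, dvd_neg]
    intro h; have := Int.le_of_dvd one_pos h; omega
  have h4 : ¬ (n : ℤ) ∣ i + 1 + 1 - i := by
    rwa [← dvd_neg, neg_sub]
  have h5 : ¬ (n : ℤ) ∣ i + 1 + 1 - (i + 1) := by
    rwa [show i + 1 + 1 - (i + 1) = -(i - (i + 1)) by ring, dvd_neg]
  have := conj_simple_eq hn' (x := simple n i) (y := simple n (i + 1)) (i := i + 1) (j := i)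
    (by rw [simple_succ hn', simple_of_not_dvd h3 h2])
    (by rw [simple_of_not_dvd h4 h5, simple_self hn'])
  rwa [simple_inv, simple_inv] at this

theorem simple_comm (hn : 3 ≤ n) {i j : ℤ} (h1 : ¬ (n : ℤ) ∣ j - (i + 1))
    (h2 : ¬ (n : ℤ) ∣ j - (i - 1)) :
    simple n i * simple n j = simple n j * simple n i := by
  have hn' : 1 < n := by omega
  by_cases h : (n : ℤ) ∣ j - i
  · rw [simple_eq_of_dvd h]
  have := conj_simple_eq hn' (x := simple n i) (y := 1) (i := j) (j := j)
    (simple_of_not_dvd h h1)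
    (simple_of_not_dvd (by rwa [show j + 1 - i = j - (i - 1) by ring])
      (by rwa [show j + 1 - (i + 1) = j - i by ring]))
  simpa [mul_inv_eq_iff_eq_mul] using this

theorem rot_zpow_apply (k i : ℤ) : (rot n ^ k).1 i = i + k := by
  induction k using Int.induction_on generalizing i with
  | zero => simp
  | succ k ih =>
    rw [zpow_add_one]
    change (rot n ^ (k : ℤ)).1 (i + 1) = _
    rw [ih]; ring
  | pred k ih =>
    rw [zpow_sub_one]
    change (rot n ^ (-(k : ℤ))).1 ((Equiv.addRight (1 : ℤ)).symm i) = _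
    rw [ih]; simp; ring

theorem rot_zpow_mul_simple (k i : ℤ) :
    rot n ^ k * simple n i = simple n (i + k) * rot n ^ k := by
  apply Subtype.ext
  ext x
  change (rot n ^ k).1 (simpleFun n i x) = simpleFun n (i + k) ((rot n ^ k).1 x)
  rw [rot_zpow_apply, rot_zpow_apply]
  simp only [simpleFun, show x + k - (i + k) = x - i by ring,
    show x + k - (i + k + 1) = x - (i + 1) by ring]
  split_ifs <;> ring

/-! ### Inversions and length -/

theorem finite_inversions (w : AffSym n) (a : ℤ) : {b : ℤ | a < b ∧ w.1 b < w.1 a}.Finite := by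
  obtain ⟨C, hC⟩ : ∃ C : ℤ, ∀ x, x - w.1 x ≤ C := by
    obtain ⟨C, hC⟩ := (Set.finite_range fun r : Fin n => rep r - w.1 (rep r)).bddAbove
    refine ⟨C, fun x => ?_⟩
    have h := hC ⟨residue n x, rfl⟩
    rw [eq_rep_add (n := n) x, apply_add_mul]
    linarith
  refine (Set.finite_Ioo a (w.1 a + C)).subset fun b hb => ⟨hb.1, ?_⟩
  have := hC b
  linarith [hb.2]

/-- The entries `b > a` which form an inversion `w b < w a` with `a`. -/
def invAt (w : AffSym n) (a : ℤ) : Finset ℤ := (finite_inversions w a).toFinset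

@[simp] theorem mem_invAt {w : AffSym n} {a b : ℤ} : b ∈ invAt w a ↔ a < b ∧ w.1 b < w.1 a := by
  simp [invAt]

/-- The product of `φ` over the inversions of `w`, up to simultaneous shift by `n`. -/
def invProd {M : Type*} [CommMonoid M] (φ : ℤ → ℤ → M) (w : AffSym n) : M :=
  ∏ r : Fin n, ∏ b ∈ invAt w (rep r), φ (rep r) b

theorem prod_invAt_add_mul {M : Type*} [CommMonoid M] {φ : ℤ → ℤ → M}
    (hφ : ∀ a b m : ℤ, φ (a + m * n) (b + m * n) = φ a b) (w : AffSym n) (a m : ℤ) :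
    ∏ b ∈ invAt w (a + m * n), φ (a + m * n) b = ∏ b ∈ invAt w a, φ a b := by
  symm
  refine Finset.prod_bij' (fun b _ => b + m * n) (fun b _ => b - m * n) ?_ ?_ ?_ ?_ ?_
  · intro b hb
    rw [mem_invAt] at hb ⊢
    rw [apply_add_mul, apply_add_mul]
    exact ⟨by linarith [hb.1], by linarith [hb.2]⟩
  · intro b hb
    rw [mem_invAt] at hb ⊢
    rw [apply_add_mul] at hb
    rw [show b - m * n = b + -m * n by ring, apply_add_mul]
    exact ⟨by linarith [hb.1], by linarith [hb.2]⟩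
  · intro b _; ring
  · intro b _; ring
  · intro b _; exact (hφ a b m).symm

theorem simple_lt_iff {i a b : ℤ} (h : ¬ (n : ℤ) ∣ a - i ∨ b ≠ a + 1)
    (h' : ¬ (n : ℤ) ∣ b - i ∨ a ≠ b + 1) :
    (simple n i).1 a < (simple n i).1 b ↔ a < b := by
  have key : ∀ a b : ℤ, (¬ (n : ℤ) ∣ a - i ∨ b ≠ a + 1) → a < b →
      (simple n i).1 a < (simple n i).1 b := by
    intro a b h hab
    have hb : b - 1 ≤ (simple n i).1 b := by
      change b - 1 ≤ simpleFun n i b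
      unfold simpleFun; split_ifs <;> omega
    have ha : (simple n i).1 a ≤ a + 1 := by
      change simpleFun n i a ≤ a + 1
      unfold simpleFun; split_ifs <;> omega
    have hne : (simple n i).1 a ≠ (simple n i).1 b := fun e => by
      have := (simple n i).1.injective e; omega
    by_contra hc
    have h1 : a + 1 = b ∨ a + 2 = b := by omega
    rcases h1 with rfl | rfl
    · have h2 : ¬ (n : ℤ) ∣ a - i := by
        rcases h with h | h
        · exact h
        · exact absurd rfl h
      have h3 : ¬ (n : ℤ) ∣ a + 1 - (i + 1) := by
        rwa [show a + 1 - (i + 1) = a - i by ring]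
      have h4 : (simple n i).1 a ≤ a := by
        change simpleFun n i a ≤ a
        simp only [simpleFun, h2, false_and, if_false]; split_ifs <;> omega
      have h5 : a + 1 ≤ (simple n i).1 (a + 1) := by
        change a + 1 ≤ simpleFun n i (a + 1)
        simp only [simpleFun, h3, false_and, if_false]; split_ifs <;> omega
      omega
    · have h4 : (simple n i).1 a = a + 1 := by omega
      have h5 : (simple n i).1 (a + 2) = a + 1 := by omega
      omega
  constructor
  · intro hs
    by_contra hc
    rcases eq_or_lt_of_le (not_lt.mp hc) with e | hlt
    · rw [e] at hs; exact lt_irrefl _ hs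
    · exact lt_asymm hs (key b a h' hlt)
  · exact key a b h

theorem invAt_mul_simple (w : AffSym n) {i : ℤ} (hw : w.1 i < w.1 (i + 1)) (a : ℤ)
    (hai : ¬ (n : ℤ) ∣ a - i) :
    invAt (w * simple n i) a = (invAt w ((simple n i).1 a)).image (simple n i).1 := by
  ext b
  have hmul : ∀ x, (w * simple n i).1 x = w.1 ((simple n i).1 x) := fun _ => rfl
  simp only [Finset.mem_image, mem_invAt, hmul]
  constructor
  · rintro ⟨h1, h2⟩
    refine ⟨(simple n i).1 b, ⟨?_, h2⟩, simple_apply_simple i b⟩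
    rw [simple_lt_iff (Or.inl hai) (Or.inr (by omega))]
    exact h1
  · rintro ⟨c, ⟨h1, h2⟩, rfl⟩
    rw [simple_apply_simple]
    refine ⟨?_, h2⟩
    have key := (simple_lt_iff (n := n) (i := i) (a := (simple n i).1 a) (b := c) ?_
      (Or.inr (by omega))).mpr h1
    · rwa [simple_apply_simple] at key
    · by_contra hc
      push Not at hc
      obtain ⟨⟨m, hm⟩, h3⟩ := hc
      have h4 : (simple n i).1 a = i + m * n := by linarith
      rw [h3, h4, show i + m * n + 1 = i + 1 + m * n by ring, apply_add_mul, apply_add_mul] at h2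
      linarith

theorem invAt_mul_simple_self (hn : 1 < n) (w : AffSym n) {i : ℤ} (hw : w.1 i < w.1 (i + 1)) :
    invAt (w * simple n i) i =
      insert (i + 1) ((invAt w (i + 1)).image (simple n i).1) := by
  ext b
  have hmul : ∀ x, (w * simple n i).1 x = w.1 ((simple n i).1 x) := fun _ => rfl
  simp only [Finset.mem_insert, Finset.mem_image, mem_invAt, hmul, simple_self hn]
  constructor
  · rintro ⟨h1, h2⟩
    by_cases hb : b = i + 1
    · exact Or.inl hb
    refine Or.inr ⟨(simple n i).1 b, ⟨?_, h2⟩, simple_apply_simple i b⟩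
    rw [← simple_self hn i, simple_lt_iff (Or.inr hb) (Or.inr (by omega))]
    exact h1
  · rintro (rfl | ⟨c, ⟨h1, h2⟩, rfl⟩)
    · rw [simple_succ hn]; exact ⟨by omega, hw⟩
    · rw [simple_apply_simple]
      refine ⟨?_, h2⟩
      have key := (simple_lt_iff (n := n) (i := i) (a := i + 1) (b := c) ?_ (Or.inr (by omega))).mpr h1
      · rwa [simple_succ hn] at key
      · left
        intro h
        rw [show i + 1 - i = 1 by ring] at h
        have := Int.le_of_dvd one_pos h
        omega

/-- Right multiplication by `s_i` at an ascent adds exactly the inversion `(i, i + 1)` to the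
inversions transported by `s_i`. -/
theorem invProd_mul_simple (hn : 1 < n) {M : Type*} [CommMonoid M] {φ : ℤ → ℤ → M}
    (hφ : ∀ a b m : ℤ, φ (a + m * n) (b + m * n) = φ a b) (w : AffSym n) {i : ℤ}
    (hw : w.1 i < w.1 (i + 1)) :
    invProd φ (w * simple n i) =
      invProd (fun a b => φ ((simple n i).1 a) ((simple n i).1 b)) w * φ i (i + 1) := by
  set ψ : ℤ → ℤ → M := fun a b => φ ((simple n i).1 a) ((simple n i).1 b) with hψ
  have hψ' : ∀ a b m : ℤ, ψ (a + m * n) (b + m * n) = ψ a b := by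
    intro a b m
    simp only [hψ, apply_add_mul, hφ]
  have hinj : ∀ s : Finset ℤ, Set.InjOn (simple n i).1 s := fun s =>
    (simple n i).1.injective.injOn
  have key : ∀ a, ∏ b ∈ invAt (w * simple n i) a, φ a b =
      (∏ b ∈ invAt w ((simple n i).1 a), ψ ((simple n i).1 a) b) *
        if residue n a = residue n i then φ i (i + 1) else 1 := by
    intro a
    split_ifs with ha
    · rw [residue_eq_iff] at ha
      obtain ⟨m, hm⟩ := ha
      obtain rfl : a = i + m * n := by linarith
      rw [prod_invAt_add_mul hφ, apply_add_mul, prod_invAt_add_mul hψ',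
        invAt_mul_simple_self hn w hw, Finset.prod_insert, Finset.prod_image (hinj _), mul_comm,
        simple_self hn]
      · simp only [hψ, simple_succ hn]
      · simp only [Finset.mem_image, not_exists, mem_invAt]
        rintro c ⟨⟨h1, -⟩, h2⟩
        have := simple_apply_simple (n := n) i c
        rw [h2, simple_succ hn] at this
        omega
    · rw [residue_eq_iff] at ha
      rw [invAt_mul_simple w hw a ha, Finset.prod_image (hinj _), mul_one]
      simp only [hψ, simple_apply_simple]
  unfold invProd
  rw [Finset.prod_congr rfl fun r _ => key (rep r), Finset.prod_mul_distrib,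
    prod_apply_rep (simple n i) (fun a => ∏ b ∈ invAt w a, ψ a b)
      (fun a m => prod_invAt_add_mul hψ' w a m)]
  simp

/-- The length of an affine permutation: its number of inversions up to shift by `n`. -/
def len (w : AffSym n) : ℕ := Multiplicative.toAdd (invProd (fun _ _ => Multiplicative.ofAdd 1) w)

theorem len_mul_simple (hn : 1 < n) (w : AffSym n) {i : ℤ} (hw : w.1 i < w.1 (i + 1)) :
    len (w * simple n i) = len w + 1 := by
  unfold len
  rw [invProd_mul_simple hn (fun _ _ _ => rfl) w hw]
  rfl

theorem len_mul_simple_of_gt (hn : 1 < n) (w : AffSym n) {i : ℤ} (hw : w.1 (i + 1) < w.1 i) :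
    len w = len (w * simple n i) + 1 := by
  conv_lhs => rw [← simple_mul_simple_cancel w i]
  apply len_mul_simple hn
  change w.1 ((simple n i).1 i) < w.1 ((simple n i).1 (i + 1))
  rwa [simple_self hn, simple_succ hn]

theorem len_mul_simple_le (hn : 1 < n) (w : AffSym n) (i : ℤ) :
    len (w * simple n i) ≤ len w + 1 := by
  rcases lt_or_gt_of_ne (fun e => by have := w.1.injective e; omega : w.1 i ≠ w.1 (i + 1)) with h | h
  · exact (len_mul_simple hn w h).le
  · have := len_mul_simple_of_gt hn w h; omega

theorem len_eq_zero_of_forall {w : AffSym n} (h : ∀ i, w.1 i < w.1 (i + 1)) : len w = 0 := by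
  have hmono : StrictMono w.1 := strictMono_int_of_lt_succ h
  unfold len invProd
  rw [toAdd_eq_zero]
  refine Finset.prod_eq_one fun r _ => ?_
  rw [show invAt w (rep r) = ∅ from ?_, Finset.prod_empty]
  ext b
  simp only [mem_invAt, Finset.notMem_empty, iff_false, not_and]
  intro h1 h2
  exact lt_asymm h2 (hmono h1)

theorem eq_rot_zpow_of_forall {w : AffSym n} (h : ∀ i, w.1 i < w.1 (i + 1)) :
    w = rot n ^ (w.1 0) := by
  have hmono : StrictMono w.1 := strictMono_int_of_lt_succ h
  have hstep : ∀ i, w.1 (i + 1) = w.1 i + 1 := by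
    intro i
    obtain ⟨j, hj⟩ := w.1.surjective (w.1 i + 1)
    have h1 : i < j := by rw [← hmono.lt_iff_lt, hj]; omega
    have h2 : w.1 (i + 1) ≤ w.1 j := hmono.monotone (by omega)
    have := h i
    omega
  apply Subtype.ext
  ext i
  rw [rot_zpow_apply]
  induction i using Int.induction_on with
  | zero => simp
  | succ k ih => rw [hstep, ih]; ring
  | pred k ih =>
    have := hstep (-(k : ℤ) - 1)
    rw [show -(k : ℤ) - 1 + 1 = -k by ring, ih] at this
    linarith

theorem len_rot_zpow (k : ℤ) : len (rot n ^ k) = 0 := by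
  apply len_eq_zero_of_forall
  intro i
  simp only [rot_zpow_apply]
  omega

/-! ### Words and reduced words -/

/-- The affine permutation `π ^ k s_{l_1} ⋯ s_{l_m}` of a word. -/
def wordPerm (n : ℕ) (p : ℤ × List ℤ) : AffSym n := rot n ^ p.1 * (p.2.map (simple n)).prod

theorem wordPerm_append (k : ℤ) (l : List ℤ) (i : ℤ) :
    wordPerm n (k, l ++ [i]) = wordPerm n (k, l) * simple n i := by
  simp [wordPerm, mul_assoc]

theorem len_wordPerm_le (hn : 1 < n) (k : ℤ) (l : List ℤ) : len (wordPerm n (k, l)) ≤ l.length := by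
  induction l using List.reverseRecOn with
  | nil => simp [wordPerm, len_rot_zpow]
  | append_singleton l i ih =>
    rw [wordPerm_append, List.length_append]
    exact (len_mul_simple_le hn _ i).trans (by simpa using ih)

theorem exists_descent {w : AffSym n} (h : len w ≠ 0) : ∃ i, w.1 (i + 1) < w.1 i := by
  by_contra hc
  push Not at hc
  refine h (len_eq_zero_of_forall fun i => lt_of_le_of_ne (hc i) fun e => ?_)
  have := w.1.injective e
  omega

theorem exists_word (hn : 1 < n) (w : AffSym n) :
    ∃ p : ℤ × List ℤ, w = wordPerm n p ∧ p.2.length = len w := by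
  induction h : len w using Nat.strong_induction_on generalizing w with
  | _ m ih =>
    by_cases h0 : len w = 0
    · refine ⟨(w.1 0, []), ?_, by simp [← h, h0]⟩
      have := eq_rot_zpow_of_forall (w := w) (fun i => by
        by_contra hc
        have hne : w.1 i ≠ w.1 (i + 1) := fun e => by have := w.1.injective e; omega
        have := len_mul_simple_of_gt hn w (i := i) (lt_of_le_of_ne (not_lt.mp hc) hne.symm)
        omega)
      simpa [wordPerm] using this
    · obtain ⟨i, hi⟩ := exists_descent h0
      have h1 := len_mul_simple_of_gt hn w hi
      obtain ⟨⟨k, l⟩, hp, hl⟩ := ih (len (w * simple n i)) (by omega) (w * simple n i) rfl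
      refine ⟨(k, l ++ [i]), ?_, ?_⟩
      · rw [wordPerm_append, ← hp, simple_mul_simple_cancel]
      · simp only [List.length_append, List.length_singleton]
        simp only at hl
        omega

/-- Reduced expressions are the words whose number of letters is the number of inversions. -/
theorem isReducedExpr_iff (hn : 1 < n) {w : AffSym n} {p : ℤ × List ℤ} :
    IsReducedExpr w p ↔ w = wordPerm n p ∧ p.2.length = len w := by
  constructor
  · rintro ⟨h1, h2⟩
    refine ⟨h1, le_antisymm ?_ ?_⟩
    · obtain ⟨p', hp', hl⟩ := exists_word hn w
      exact (h2 p' hp').trans hl.le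
    · conv_lhs => rw [h1]
      exact len_wordPerm_le hn p.1 p.2
  · rintro ⟨h1, h2⟩
    refine ⟨h1, fun p' hp' => ?_⟩
    rw [h2]
    conv_lhs => rw [hp']
    exact len_wordPerm_le hn p'.1 p'.2

theorem reducedExpr_spec (hn : 1 < n) (w : AffSym n) :
    w = wordPerm n (reducedExpr w) ∧ (reducedExpr w).2.length = len w := by
  rw [← isReducedExpr_iff hn]
  apply Classical.epsilon_spec
  obtain ⟨p, hp⟩ := exists_word hn w
  exact ⟨p, (isReducedExpr_iff hn).mpr hp⟩

theorem simple_one_eq (i : ℤ) : simple 1 i = 1 := by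
  apply Subtype.ext
  ext x
  change simpleFun 1 i x = x
  simp [simpleFun]

theorem eq_rot_zpow_of_one (w : AffSym 1) : w = rot 1 ^ (w.1 0) := by
  apply eq_rot_zpow_of_forall
  intro i
  have := w.2 i
  simp only [Nat.cast_one] at this
  omega

theorem reducedExpr_one (w : AffSym 1) : reducedExpr w = (w.1 0, []) := by
  have h : IsReducedExpr w (reducedExpr w) :=
    Classical.epsilon_spec ⟨(w.1 0, []), by simpa using eq_rot_zpow_of_one w, by simp⟩
  have h1 := h.2 (w.1 0, []) (by simpa using eq_rot_zpow_of_one w)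
  have h2 : (reducedExpr w).2 = [] := by simpa using h1
  have h3 := h.1
  rw [h2] at h3
  simp only [List.map_nil, List.prod_nil, mul_one] at h3
  apply Prod.ext
  · conv_rhs => rw [h3, rot_zpow_apply]
    simp
  · exact h2

/-! ### Independence of the reduced word -/

section Matsumoto

variable {M : Type*} [Monoid M] (P : Mˣ) (τ : ℤ → M)

/-- The value `P ^ k τ_{l_1} ⋯ τ_{l_m}` of a word in a monoid. -/
def wordVal (p : ℤ × List ℤ) : M := ((P ^ p.1 : Mˣ) : M) * (p.2.map τ).prod

theorem wordVal_append (k : ℤ) (l : List ℤ) (i : ℤ) :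
    wordVal P τ (k, l ++ [i]) = wordVal P τ (k, l) * τ i := by
  simp [wordVal, mul_assoc]

variable {τ}

/-- Matsumoto's theorem: elements satisfying the braid relations have the same product along all
reduced words of an affine permutation. If two reduced words of `w` end in `i` and `j`, then `w` has
a reduced word that ends in the longest word in `i` and `j`; by induction on the length, each of
the given words can be compared with it. -/
theorem wordVal_eq_of_reduced (hn : 1 < n) (hper : ∀ i j : ℤ, (n : ℤ) ∣ i - j → τ i = τ j)
    (hbraid : 3 ≤ n → ∀ i, τ i * τ (i + 1) * τ i = τ (i + 1) * τ i * τ (i + 1))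
    (hcomm : 3 ≤ n → ∀ i j : ℤ, ¬ (n : ℤ) ∣ j - (i + 1) → ¬ (n : ℤ) ∣ j - (i - 1) →
      τ i * τ j = τ j * τ i)
    (p p' : ℤ × List ℤ) (h : wordPerm n p = wordPerm n p')
    (hp : p.2.length = len (wordPerm n p)) (hp' : p'.2.length = len (wordPerm n p')) :
    wordVal P τ p = wordVal P τ p' := by
  induction hm : len (wordPerm n p) using Nat.strong_induction_on generalizing p p' with
  | _ m ih =>
  obtain ⟨k, l⟩ := p
  obtain ⟨k', l'⟩ := p'
  rcases List.eq_nil_or_concat' l with rfl | ⟨l, i, rfl⟩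
  · have h1 : l' = [] := by
      rw [← h] at hp'
      rw [← hp] at hp'
      simpa using hp'
    subst h1
    have h2 : k = k' := by
      have := congrArg (fun w : AffSym n => w.1 0) h
      simpa only [wordPerm, List.map_nil, List.prod_nil, mul_one, rot_zpow_apply, zero_add]
        using this
    rw [h2]
  rcases List.eq_nil_or_concat' l' with rfl | ⟨l', j, rfl⟩
  · rw [← h, ← hp] at hp'
    simp at hp'
  rw [wordPerm_append] at h hp hm
  rw [wordPerm_append] at h hp'
  rw [wordVal_append, wordVal_append]
  set u := wordPerm n (k, l) with hu
  set u' := wordPerm n (k', l') with hu'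
  simp only [List.length_append, List.length_singleton] at hp hp'
  have hul : len u ≤ l.length := len_wordPerm_le hn k l
  have hul' : len u' ≤ l'.length := len_wordPerm_le hn k' l'
  have h1 := len_mul_simple_le hn u i
  have h1' := len_mul_simple_le hn u' j
  have hlu : l.length = len u := by omega
  have hlu' : l'.length = len u' := by omega
  set w := u * simple n i with hw
  have hwu : w * simple n i = u := simple_mul_simple_cancel u i
  have hwu' : w * simple n j = u' := by rw [h, simple_mul_simple_cancel]
  have hll : len u' = len u := by rw [h] at hp; omega
  -- `i` and `j` are descents of `w`
  have desc : ∀ a, len (w * simple n a) < len w → w.1 (a + 1) < w.1 a := by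
    intro a ha
    by_contra hc
    have hne : w.1 a ≠ w.1 (a + 1) := fun e => by have := w.1.injective e; omega
    have := len_mul_simple hn w (i := a) (lt_of_le_of_ne (not_lt.mp hc) hne)
    omega
  have hdi := desc i (by rw [hwu]; omega)
  have hdj := desc j (by rw [hwu']; omega)
  have ne_dvd : ∀ c : ℤ, 0 < c → c < n → ¬ (n : ℤ) ∣ c := fun c h0 h1 h2 => by
    have := Int.le_of_dvd h0 h2; omega
  by_cases hij : (n : ℤ) ∣ i - j
  · rw [hper i j hij]
    have huu : u = u' := by rw [← hwu, ← hwu', simple_eq_of_dvd hij]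
    rw [ih (len u) (by omega) (k, l) (k', l') huu hlu (by rw [← hu']; exact hlu') rfl]
  -- the adjacent case, for two reduced words of which the second ends in the successor
  have adj : ∀ (c : ℤ) (v v' : AffSym n) (y y' : ℤ × List ℤ), w * simple n c = v →
      w * simple n (c + 1) = v' → v = wordPerm n y → v' = wordPerm n y' →
      y.2.length = len v → y'.2.length = len v' → w.1 (c + 1) < w.1 c →
      w.1 (c + 1 + 1) < w.1 (c + 1) →
      wordVal P τ y * τ c = wordVal P τ y' * τ (c + 1) := by
    intro c v v' y y' hv hv' hvy hvy' hly hly' hc1 hc2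
    -- for `n = 2` adjacent descents would give `w (c + 2) < w c`, against quasi-periodicity
    have hn3 : 3 ≤ n := by
      by_contra hlt
      obtain rfl : n = 2 := by omega
      have := w.2 c
      rw [show c + ((2 : ℕ) : ℤ) = c + 1 + 1 by push_cast; ring] at this
      push_cast at this
      omega
    have lv := len_mul_simple_of_gt hn w hc1
    have lv' := len_mul_simple_of_gt hn w hc2
    rw [hv] at lv
    rw [hv'] at lv'
    have e1 : ∀ (x : ℤ), v.1 x = w.1 ((simple n c).1 x) := fun x => by rw [← hv]; rfl
    have e2 : ∀ (x : ℤ), v'.1 x = w.1 ((simple n (c + 1)).1 x) := fun x => by rw [← hv']; rfl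
    have f1 : (simple n c).1 (c + 1 + 1) = c + 1 + 1 := simple_of_not_dvd
      (by rw [show c + 1 + 1 - c = 2 by ring]; exact ne_dvd 2 (by omega) (by omega))
      (by rw [show c + 1 + 1 - (c + 1) = 1 by ring]; exact ne_dvd 1 (by omega) (by omega))
    have f2 : (simple n (c + 1)).1 c = c := simple_of_not_dvd
      (by rw [show c - (c + 1) = -1 by ring, dvd_neg]; exact ne_dvd 1 (by omega) (by omega))
      (by rw [show c - (c + 1 + 1) = -2 by ring, dvd_neg]; exact ne_dvd 2 (by omega) (by omega))
    have d1 : v.1 (c + 1 + 1) < v.1 (c + 1) := by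
      rw [e1, e1, f1, simple_succ hn]; omega
    have l1 := len_mul_simple_of_gt hn v d1
    have d2 : (v * simple n (c + 1)).1 (c + 1) < (v * simple n (c + 1)).1 c := by
      change v.1 ((simple n (c + 1)).1 (c + 1)) < v.1 ((simple n (c + 1)).1 c)
      rw [f2, simple_self hn, e1, e1, f1, simple_self hn]; omega
    have l2 := len_mul_simple_of_gt hn _ d2
    set x := v * simple n (c + 1) * simple n c with hx
    obtain ⟨⟨kx, lx⟩, hxp, hxl⟩ := exists_word hn x
    have hv1 : wordPerm n (kx, lx ++ [c] ++ [c + 1]) = v := by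
      rw [wordPerm_append, wordPerm_append, ← hxp, hx, simple_mul_simple_cancel,
        simple_mul_simple_cancel]
    have hv2 : wordPerm n (kx, lx ++ [c + 1] ++ [c]) = v' := by
      have hb : simple n c * simple n (c + 1) * simple n c * simple n (c + 1) * simple n c =
          simple n (c + 1) := by
        rw [simple_braid hn3, simple_mul_simple_cancel, simple_mul_simple_cancel]
      rw [wordPerm_append, wordPerm_append, ← hxp, hx, ← hv', ← hv]
      simp only [mul_assoc] at hb ⊢
      rw [hb]
    simp only at hxl
    have a1 := ih (len v) (by omega) y (kx, lx ++ [c] ++ [c + 1]) (by rw [hv1, hvy])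
      (by rw [hly, ← hvy]) (by rw [hv1]; simp; omega) (by rw [← hvy])
    have a2 := ih (len v') (by omega) y' (kx, lx ++ [c + 1] ++ [c]) (by rw [hv2, hvy'])
      (by rw [hly', ← hvy']) (by rw [hv2]; simp; omega) (by rw [← hvy'])
    rw [a1, a2, wordVal_append, wordVal_append, wordVal_append, wordVal_append, mul_assoc,
      mul_assoc, ← mul_assoc (τ c), hbraid hn3, mul_assoc, mul_assoc, mul_assoc]
  by_cases hj1 : (n : ℤ) ∣ j - (i + 1)
  · obtain ⟨s, hs⟩ := hj1
    have hj : simple n (i + 1) = simple n j := simple_eq_of_dvd ⟨-s, by linarith⟩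
    rw [← hper (i + 1) j ⟨-s, by linarith⟩]
    refine adj i u u' (k, l) (k', l') hwu (by rw [hj, hwu']) rfl rfl hlu hlu' hdi ?_
    obtain rfl : j = i + 1 + s * n := by linarith
    rw [show i + 1 + s * n + 1 = i + 1 + 1 + s * n by ring, apply_add_mul, apply_add_mul] at hdj
    linarith
  by_cases hj2 : (n : ℤ) ∣ j - (i - 1)
  · obtain ⟨s, hs⟩ := hj2
    have hi : simple n (j + 1) = simple n i := simple_eq_of_dvd ⟨s, by linarith⟩
    rw [← hper (j + 1) i ⟨s, by linarith⟩]
    refine (adj j u' u (k', l') (k, l) hwu' (by rw [hi, hwu]) rfl rfl hlu' hlu hdj ?_).symm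
    obtain rfl : j = i - 1 + s * n := by linarith
    rw [show i - 1 + s * n + 1 + 1 = i + 1 + s * n by ring,
      show i - 1 + s * n + 1 = i + s * n by ring, apply_add_mul, apply_add_mul]
    linarith
  -- the commuting case
  have hn3 : 3 ≤ n := by
    by_contra hlt
    obtain rfl : n = 2 := by omega
    push_cast at hj1 hij
    omega
  have e1 : ∀ (x : ℤ), u.1 x = w.1 ((simple n i).1 x) := fun x => by rw [← hwu]; rfl
  have fj : (simple n i).1 j = j := simple_of_not_dvd
    (fun h => hij (by rw [← dvd_neg, neg_sub]; exact h)) hj1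
  have fj' : (simple n i).1 (j + 1) = j + 1 := simple_of_not_dvd
    (by rwa [show j + 1 - i = j - (i - 1) by ring])
    (by rw [show j + 1 - (i + 1) = -(i - j) by ring, dvd_neg]; exact hij)
  have d1 : u.1 (j + 1) < u.1 j := by rw [e1, e1, fj, fj']; exact hdj
  have l1 := len_mul_simple_of_gt hn u d1
  set x := u * simple n j with hx
  obtain ⟨⟨kx, lx⟩, hxp, hxl⟩ := exists_word hn x
  simp only at hxl
  have hv1 : wordPerm n (kx, lx ++ [j]) = u := by
    rw [wordPerm_append, ← hxp, hx, simple_mul_simple_cancel]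
  have hv2 : wordPerm n (kx, lx ++ [i]) = u' := by
    rw [wordPerm_append, ← hxp, hx, ← hwu', hw, mul_assoc, mul_assoc,
      simple_comm hn3 hj1 hj2]
  have a1 := ih (len u) (by omega) (k, l) (kx, lx ++ [j]) (by rw [hv1]) hlu
    (by rw [hv1]; simp; omega) rfl
  have a2 := ih (len u') (by omega) (k', l') (kx, lx ++ [i]) (by rw [hv2]) hlu'
    (by rw [hv2]; simp; omega) rfl
  rw [a1, a2, wordVal_append, wordVal_append, mul_assoc, mul_assoc, hcomm hn3 i j hj1 hj2]

end Matsumoto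

variable {K : Type*} [Field K] {q t : Kˣ}

theorem len_mul_rot_zpow (hn : 1 < n) (w : AffSym n) (m : ℤ) : len (w * rot n ^ m) = len w := by
  have hword : ∀ (k : ℤ) (l : List ℤ) (m : ℤ),
      wordPerm n (k, l) * rot n ^ m = wordPerm n (k + m, l.map fun i => i - m) := by
    intro k l m
    have : ∀ l : List ℤ, (l.map (simple n)).prod * rot n ^ m =
        rot n ^ m * ((l.map fun i => i - m).map (simple n)).prod := by
      intro l
      induction l with
      | nil => simp
      | cons i l ih =>
        simp only [List.map_cons, List.prod_cons]
        rw [mul_assoc, ih, ← mul_assoc, ← mul_assoc, rot_zpow_mul_simple, sub_add_cancel]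
    simp only [wordPerm]
    rw [mul_assoc, this, ← mul_assoc, zpow_add]
  have hle : ∀ (w : AffSym n) (m : ℤ), len (w * rot n ^ m) ≤ len w := by
    intro w m
    obtain ⟨⟨k, l⟩, hw, hl⟩ := exists_word hn w
    rw [← hl]
    conv_lhs => rw [hw, hword]
    simpa using len_wordPerm_le hn (k + m) (l.map fun i => i - m)
  refine le_antisymm (hle w m) ?_
  have := hle (w * rot n ^ m) (-m)
  rwa [mul_assoc, ← zpow_add, add_neg_cancel, zpow_zero, mul_one] at this

/-! ### Laurent polynomials -/

section Extend

variable {M : Type*} [AddCommGroup M] [Module K M]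

theorem extend_add_mul (q : Kˣ) (y : Fin n → M) (i m : ℤ) :
    extend q y (i + m * n) = ((q ^ (-m) : Kˣ) : K) • extend q y i := by
  obtain ⟨h1, h2⟩ := residue_wind_add_mul (n := n) i m
  simp only [extend, h1, h2, smul_smul]
  rw [← Units.val_mul, ← zpow_add, neg_add, add_comm]

theorem extend_rep (q : Kˣ) (y : Fin n → M) (r : Fin n) : extend q y (rep r) = y r := by
  simp [extend]

theorem extend_eq (q : Kˣ) (y : Fin n → M) (i : ℤ) :
    extend q y i = ((q ^ (-wind n i) : Kˣ) : K) • y (residue n i) := rfl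

end Extend

/-- `Y_i` as a Laurent polynomial, for any integer `i`. -/
def yL (q : Kˣ) (i : ℤ) : Laurent K n := extend q (lY K) i

theorem yL_add_mul (i m : ℤ) :
    (yL q (i + m * n) : Laurent K n) = ((q ^ (-m) : Kˣ) : K) • yL q i :=
  extend_add_mul q _ i m

theorem yL_rep (r : Fin n) : (yL q (rep r) : Laurent K n) = lY K r := extend_rep q _ r

theorem isUnit_lY (r : Fin n) : IsUnit (lY K r : Laurent K n) :=
  (Group.isUnit _).map (MonoidAlgebra.of K (Fin n → Multiplicative ℤ))

theorem isUnit_yL (i : ℤ) : IsUnit (yL q i : Laurent K n) := by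
  rw [yL, extend_eq, Algebra.smul_def]
  exact ((Units.isUnit _).map _).mul (isUnit_lY _)

/-- Induction on Laurent polynomials: they are generated by the `Y_r` under the ring operations and
inverses. -/
theorem laurent_induction {C : Laurent K n → Prop} (hc : ∀ c : K, C (algebraMap K _ c))
    (hadd : ∀ x y, C x → C y → C (x + y)) (hmul : ∀ x y, C x → C y → C (x * y))
    (hY : ∀ r, C (lY K r)) (hinv : ∀ x y, C x → x * y = 1 → C y) (p : Laurent K n) : C p := by
  have h1 : C 1 := by rw [← map_one (algebraMap K (Laurent K n))]; exact hc 1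
  induction p using MonoidAlgebra.induction_on with
  | of g =>
    have hpow : ∀ (r : Fin n) (k : ℕ), C (MonoidAlgebra.of K _
        (Pi.mulSingle r (Multiplicative.ofAdd (k : ℤ)))) := by
      intro r k
      induction k with
      | zero => rw [Nat.cast_zero, ofAdd_zero, Pi.mulSingle_one, map_one]; exact h1
      | succ k ih =>
        rw [Nat.cast_succ, ofAdd_add, Pi.mulSingle_mul, map_mul]
        exact hmul _ _ ih (hY r)
    rw [← Finset.univ_prod_mulSingle g, map_prod]
    refine Finset.prod_induction _ C hmul h1 fun r _ => ?_
    obtain ⟨k, hk⟩ : ∃ k : ℤ, g r = Multiplicative.ofAdd k := ⟨_, rfl⟩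
    rw [hk]
    obtain ⟨m, rfl | rfl⟩ := Int.eq_nat_or_neg k
    · exact hpow r m
    · refine hinv _ _ (hpow r m) ?_
      rw [← map_mul, ← Pi.mulSingle_mul, ← ofAdd_add, add_neg_cancel, ofAdd_zero,
        Pi.mulSingle_one, map_one]
  | add x y hx hy => exact hadd _ _ hx hy
  | smul c x hx => rw [Algebra.smul_def]; exact hmul _ _ (hc c) hx

theorem laurent_algHom_ext {A : Type*} [Ring A] [Algebra K A] {φ ψ : Laurent K n →ₐ[K] A}
    (h : ∀ r, φ (lY K r) = ψ (lY K r)) : φ = ψ := by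
  refine AlgHom.ext fun p => ?_
  induction p using laurent_induction with
  | hc c => rw [AlgHom.commutes, AlgHom.commutes]
  | hadd x y hx hy => rw [map_add, map_add, hx, hy]
  | hmul x y hx hy => rw [map_mul, map_mul, hx, hy]
  | hY r => exact h r
  | hinv x y hx hxy =>
    have h1 : φ x * φ y = 1 := by rw [← map_mul, hxy, map_one]
    have h2 : ψ y * ψ x = 1 := by rw [← map_mul, mul_comm, hxy, map_one]
    rw [← hx] at h2
    exact (left_inv_eq_right_inv h2 h1).symm

/-- The action of an affine permutation on Laurent polynomials, `Y_i ↦ Y_{w i}`. -/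
def actHom (q : Kˣ) (w : AffSym n) : Laurent K n →ₐ[K] Laurent K n :=
  laurentLift (fun r => (isUnit_yL (q := q) (w.1 (rep r))).unit) fun i j => by
    exact Units.ext (mul_comm _ _)

theorem actHom_yL (w : AffSym n) (i : ℤ) : actHom (K := K) q w (yL q i) = yL q (w.1 i) := by
  conv_rhs => rw [eq_rep_add (n := n) i, apply_add_mul, yL_add_mul]
  rw [yL, extend_eq, map_smul]
  exact congrArg _ (laurentLift_lY _ _ _)

theorem actHom_lY (w : AffSym n) (r : Fin n) :
    actHom (K := K) q w (lY K r) = yL q (w.1 (rep r)) := by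
  rw [← yL_rep (q := q), actHom_yL]

/-- The action of the extended affine symmetric group on Laurent polynomials. -/
def act (q : Kˣ) : AffSym n →* (Laurent K n →ₐ[K] Laurent K n) where
  toFun := actHom q
  map_one' := laurent_algHom_ext fun r => by rw [actHom_lY]; exact yL_rep r
  map_mul' w w' := laurent_algHom_ext fun r => by
    rw [AlgHom.mul_apply, actHom_lY, actHom_lY, actHom_yL]
    rfl

theorem act_yL (w : AffSym n) (i : ℤ) : act (K := K) q w (yL q i) = yL q (w.1 i) :=
  actHom_yL w i

theorem act_mul_apply (w w' : AffSym n) (p : Laurent K n) :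
    act q (w * w') p = act q w (act q w' p) := by
  rw [map_mul]; rfl

theorem lf_eq (i j : ℤ) :
    (lf q t i j : Laurent K n) = (t : K) • yL q i - ((t⁻¹ : Kˣ) : K) • yL q j := rfl

theorem act_lf (w : AffSym n) (i j : ℤ) :
    act (K := K) q w (lf q t i j) = lf q t (w.1 i) (w.1 j) := by
  rw [lf_eq, lf_eq, map_sub, map_smul, map_smul, act_yL, act_yL]

theorem act_fMonoid (w : AffSym n) {s : Laurent K n} (hs : s ∈ fMonoid n q t) :
    act q w s ∈ fMonoid n q t := by
  induction hs using Submonoid.closure_induction with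
  | mem x hx =>
    obtain ⟨p, rfl⟩ := hx
    rw [act_lf]
    refine Submonoid.subset_closure ⟨⟨(w.1 p.1.1, w.1 p.1.2), ?_⟩, rfl⟩
    have := p.2
    rw [Int.modEq_comm, Int.modEq_iff_dvd] at this ⊢
    rwa [dvd_apply_sub_iff]
  | one => rw [map_one]; exact one_mem _
  | mul x y _ _ hx hy => rw [map_mul]; exact mul_mem hx hy

/-! ### Relations in the double affine Hecke algebra -/

theorem ofFree_freeY (i : ℤ) : ofFree q t (freeY q i) = Y (n := n) q t i := by
  simp only [freeY, Y, extend, map_smul]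
  rfl

theorem incl_yL (i : ℤ) : incl (n := n) q t (yL q i) = Y q t i := by
  simp only [yL, extend, map_smul, incl, laurentLift_lY, Y]

theorem Y_add_mul (i m : ℤ) : Y (n := n) q t (i + m * n) = ((q ^ (-m) : Kˣ) : K) • Y q t i :=
  extend_add_mul q _ i m

theorem isUnit_Y (i : ℤ) : IsUnit (Y (n := n) q t i) := by
  rw [← incl_yL]; exact (isUnit_yL i).map _

theorem T_mul_T (i : ℤ) :
    T (n := n) q t i * T q t i = ((t : K) - ((t⁻¹ : Kˣ) : K)) • T q t i + 1 := by
  have h := ofFree_rel (Rel.quadratic (n := n) (q := q) (t := t) i)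
  rw [map_mul, map_sub, map_add, map_zero, AlgHom.commutes, AlgHom.commutes] at h
  change (T q t i - _) * (T q t i + _) = 0 at h
  rw [sub_mul, mul_add, mul_add, ← map_mul, ← Units.val_mul, mul_inv_cancel, Units.val_one, map_one,
    Algebra.algebraMap_eq_smul_one, Algebra.algebraMap_eq_smul_one, mul_smul_comm, smul_mul_assoc,
    one_mul, mul_one] at h
  rw [sub_smul]
  rw [sub_eq_zero] at h
  rw [eq_sub_of_add_eq h]
  abel

theorem T_congr {i j : ℤ} (h : (n : ℤ) ∣ i - j) : T (n := n) q t i = T q t j := by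
  unfold T freeT
  rw [(ZMod.intCast_eq_intCast_iff_dvd_sub j i n).mpr h]

theorem T_braid (hn : 3 ≤ n) (i : ℤ) :
    T (n := n) q t i * T q t (i + 1) * T q t i = T q t (i + 1) * T q t i * T q t (i + 1) := by
  have h := ofFree_rel (Rel.braid (n := n) (q := q) (t := t) i hn)
  rw [map_mul, map_mul, map_mul, map_mul] at h
  exact h

theorem T_comm (hn : 3 ≤ n) (i j : ℤ) (h1 : ¬ (n : ℤ) ∣ j - (i + 1))
    (h2 : ¬ (n : ℤ) ∣ j - (i - 1)) : T (n := n) q t i * T q t j = T q t j * T q t i := by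
  have h := ofFree_rel (Rel.comm (n := n) (q := q) (t := t) i j hn
    (by rwa [Int.modEq_comm, Int.modEq_iff_dvd]) (by rwa [Int.modEq_comm, Int.modEq_iff_dvd]))
  rw [map_mul, map_mul] at h
  exact h

theorem piU_mul_T (i : ℤ) :
    (piU (n := n) q t).val * T q t i = T q t (i + 1) * (piU q t).val := by
  have h := ofFree_rel (Rel.pi_T (n := n) (q := q) (t := t) i)
  rw [map_mul, map_mul] at h
  exact h

theorem piU_mul_Y (i : ℤ) :
    (piU (n := n) q t).val * Y q t i = Y q t (i + 1) * (piU q t).val := by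
  have h := ofFree_rel (Rel.pi_Y (n := n) (q := q) (t := t) i)
  rw [map_mul, map_mul, ofFree_freeY, ofFree_freeY] at h
  exact h

theorem T_mul_Y_mul_T (i : ℤ) :
    T (n := n) q t i * Y q t i * T q t i = Y q t (i + 1) := by
  have h := ofFree_rel (Rel.T_Y_T (n := n) (q := q) (t := t) i)
  rwa [map_mul, map_mul, ofFree_freeY, ofFree_freeY] at h

theorem T_mul_Y_of_not_dvd {i j : ℤ} (h1 : ¬ (n : ℤ) ∣ j - i) (h2 : ¬ (n : ℤ) ∣ j - (i + 1)) :
    T (n := n) q t i * Y q t j = Y q t j * T q t i := by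
  have h := ofFree_rel (Rel.T_Y (n := n) (q := q) (t := t) i j
    (by rwa [Int.modEq_comm, Int.modEq_iff_dvd]) (by rwa [Int.modEq_comm, Int.modEq_iff_dvd]))
  rwa [map_mul, map_mul, ofFree_freeY] at h

theorem Y_mul_T (i : ℤ) : Y (n := n) q t i * T q t i =
    T q t i * Y q t (i + 1) - ((t : K) - ((t⁻¹ : Kˣ) : K)) • Y q t (i + 1) := by
  have h := T_mul_Y_mul_T (n := n) (q := q) (t := t) i
  have h1 : T q t i * Y q t (i + 1) =
      T q t i * T q t i * (Y (n := n) q t i * T q t i) := by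
    rw [← h]; simp only [mul_assoc]
  rw [h1, T_mul_T, add_mul, smul_mul_assoc, ← mul_assoc (T q t i), h, one_mul]
  abel

theorem Y_succ_mul_T (i : ℤ) : Y (n := n) q t (i + 1) * T q t i =
    T q t i * Y q t i + ((t : K) - ((t⁻¹ : Kˣ) : K)) • Y q t (i + 1) := by
  have h := T_mul_Y_mul_T (n := n) (q := q) (t := t) i
  nth_rewrite 1 [← h]
  rw [mul_assoc, T_mul_T, mul_add, mul_smul_comm, h, mul_one]
  abel

/-- The intertwiner relation `φ_i = T_i (Y_i - Y_{i+1}) + (t - t⁻¹) Y_{i+1}`. -/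
theorem phi_eq (i : ℤ) : phi (n := n) q t i =
    T q t i * (Y q t i - Y q t (i + 1)) + ((t : K) - ((t⁻¹ : Kˣ) : K)) • Y q t (i + 1) := by
  rw [phi, Y_mul_T, mul_sub]
  abel

theorem q_inv_eq (hq : q = t ^ (-2 : ℤ)) : ((q⁻¹ : Kˣ) : K) = (t : K) ^ 2 := by
  rw [hq, ← zpow_neg]
  simp only [neg_neg, Units.val_zpow_eq_zpow_val]
  norm_cast

/-- For `n = 1` the relations force `T_i = t`: here `Y_{i+1} = t² Y_i`, hence
`Y_i T_i Y_i⁻¹ = t² (T_i - t + t⁻¹)`. Both `T_i` and this conjugate satisfy the quadratic relation,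
and the difference of the two quadratic equations is linear in `T_i`. -/
theorem T_eq_of_one (ht : ∀ m : ℕ, 0 < m → t ^ m ≠ 1) (hq : q = t ^ (-2 : ℤ)) (i : ℤ) :
    T (n := 1) q t i = algebraMap K _ (t : K) := by
  obtain ⟨c, hc⟩ : ∃ c : K, c = (t : K) - ((t⁻¹ : Kˣ) : K) := ⟨_, rfl⟩
  set τ := T (n := 1) q t i with hτ
  have ht0 : (t : K) ≠ 0 := t.ne_zero
  have hT2 : τ * τ = c • τ + 1 := by rw [hc]; exact T_mul_T i
  have hYs : Y (n := 1) q t (i + 1) = (t : K) ^ 2 • Y q t i := by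
    have h := Y_add_mul (n := 1) (q := q) (t := t) i 1
    rw [zpow_neg_one, q_inv_eq hq] at h
    simpa using h
  obtain ⟨τ', hτ'⟩ : ∃ τ', τ' = (t : K) ^ 2 • (τ - c • 1) := ⟨_, rfl⟩
  have hYT : Y q t i * τ = τ' * Y q t i := by
    have h := Y_mul_T (n := 1) (q := q) (t := t) i
    rw [hYs, ← hc] at h
    rw [h, hτ']
    simp only [smul_mul_assoc, sub_mul, one_mul, mul_smul_comm, smul_sub]
    rw [smul_comm c]
  have h1 : (τ' * τ' - c • τ' - 1) * Y q t i = 0 := by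
    have : Y q t i * (τ * τ - c • τ - 1) = 0 := by rw [hT2]; simp
    rw [mul_sub, mul_sub, ← mul_assoc, hYT, mul_assoc, hYT, mul_smul_comm, hYT] at this
    rw [← this, sub_mul, sub_mul, smul_mul_assoc, mul_one, one_mul, mul_assoc]
  have h2 : τ' * τ' - c • τ' - 1 = 0 := by
    rwa [(isUnit_Y (n := 1) (q := q) (t := t) i).mul_left_eq_zero] at h1
  rw [hτ'] at h2
  simp only [smul_mul_assoc, mul_smul_comm, sub_mul, mul_sub, smul_sub, hT2, one_mul, mul_one,
    smul_smul, smul_add] at h2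
  have h3 : ((t : K) ^ 2 * (1 - (t : K) ^ 4) * (t : K)⁻¹) • (τ - (t : K) • 1) = 0 := by
    have e1 : (t : K)⁻¹ = ((t⁻¹ : Kˣ) : K) := by simp
    have hti : ((t⁻¹ : Kˣ) : K) * t = 1 := by simp
    rw [← h2, e1]
    rw [hc]
    generalize ((t⁻¹ : Kˣ) : K) = ti at *
    generalize (t : K) = tt at *
    match_scalars
    · field_simp
      have : ti = tt⁻¹ := eq_inv_of_mul_eq_one_left hti
      rw [this]; field_simp; ring
    · have : ti = tt⁻¹ := eq_inv_of_mul_eq_one_left hti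
      rw [this]; field_simp; ring
  have h4 : (1 - (t : K) ^ 4) ≠ 0 := by
    intro h
    apply ht 4 (by norm_num)
    apply Units.ext
    push_cast
    linear_combination -h
  rw [smul_eq_zero] at h3
  rcases h3 with h3 | h3
  · simp [ht0, h4] at h3
  · rw [Algebra.algebraMap_eq_smul_one]
    exact sub_eq_zero.mp h3

section DahaSpan

/-! ### The elements `T_w` -/

theorem TW_eq_wordVal (w : AffSym n) : TW q t w = wordVal (piU q t) (T q t) (reducedExpr w) := rfl

theorem TW_eq_of_word (hn : 1 < n) {w : AffSym n} {p : ℤ × List ℤ} (hw : w = wordPerm n p)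
    (hp : p.2.length = len w) : TW q t w = wordVal (piU q t) (T q t) p := by
  obtain ⟨h1, h2⟩ := reducedExpr_spec hn w
  rw [TW_eq_wordVal]
  exact wordVal_eq_of_reduced _ hn (fun i j h => T_congr h) (fun h => T_braid h)
    (fun h => T_comm h) _ _ (by rw [← h1, hw]) (by rw [← h1, h2]) (by rw [← hw, hp])

theorem TW_rot_zpow (k : ℤ) :
    TW (n := n) q t (rot n ^ k) = ((piU q t ^ k : (DAHA n q t)ˣ) : DAHA n q t) := by
  rcases Nat.lt_or_ge 1 n with hn | hn
  · rw [TW_eq_of_word (p := (k, [])) hn (by simp [wordPerm]) (by simp [len_rot_zpow])]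
    simp [wordVal]
  · obtain rfl : n = 1 := le_antisymm hn (NeZero.one_le)
    rw [TW_eq_wordVal, reducedExpr_one, rot_zpow_apply]
    simp [wordVal]

theorem TW_one : TW (n := n) q t 1 = 1 := by
  simpa using TW_rot_zpow (n := n) (q := q) (t := t) 0

/-- Since `T_w` does not depend on the reduced word, multiplication by `T_i` at an ascent extends
the word. -/
theorem TW_mul_T (hn : 1 < n) {w : AffSym n} {i : ℤ} (hw : w.1 i < w.1 (i + 1)) :
    TW q t w * T q t i = TW q t (w * simple n i) := by
  obtain ⟨⟨k, l⟩, h1, h2⟩ := exists_word hn w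
  rw [TW_eq_of_word hn h1 h2, TW_eq_of_word (p := (k, l ++ [i])) hn, wordVal_append]
  · rw [wordPerm_append, ← h1]
  · rw [len_mul_simple hn w hw, ← h2]; simp

theorem TW_mul_T_of_gt (hn : 1 < n) {w : AffSym n} {i : ℤ} (hw : w.1 (i + 1) < w.1 i) :
    TW q t w * T q t i =
      ((t : K) - ((t⁻¹ : Kˣ) : K)) • TW q t w + TW q t (w * simple n i) := by
  have h : TW q t (w * simple n i) * T q t i = TW q t w := by
    rw [TW_mul_T hn, simple_mul_simple_cancel]
    change w.1 ((simple n i).1 i) < w.1 ((simple n i).1 (i + 1))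
    rwa [simple_self hn, simple_succ hn]
  rw [← h, mul_assoc, T_mul_T, mul_add, mul_smul_comm, mul_one]

theorem piU_zpow_mul_T (k i : ℤ) :
    ((piU q t ^ k : (DAHA n q t)ˣ) : DAHA n q t) * T q t i =
      T q t (i + k) * ((piU q t ^ k : (DAHA n q t)ˣ) : DAHA n q t) := by
  have hs : ∀ i : ℤ, ((piU q t)⁻¹ : (DAHA n q t)ˣ).val * T q t i =
      T q t (i - 1) * ((piU q t)⁻¹ : (DAHA n q t)ˣ).val := by
    intro i
    rw [Units.inv_mul_eq_iff_eq_mul, ← mul_assoc, Units.eq_mul_inv_iff_mul_eq, piU_mul_T,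
      sub_add_cancel]
  induction k using Int.induction_on generalizing i with
  | zero => simp
  | succ k ih =>
    rw [zpow_add_one, Units.val_mul, mul_assoc, piU_mul_T, ← mul_assoc, ih, mul_assoc]
    congr 2; ring
  | pred k ih =>
    rw [zpow_sub_one, Units.val_mul, mul_assoc, hs, ← mul_assoc, ih, mul_assoc]
    congr 2; ring

theorem TW_mul_piU_zpow (w : AffSym n) (m : ℤ) :
    TW q t w * ((piU q t ^ m : (DAHA n q t)ˣ) : DAHA n q t) = TW q t (w * rot n ^ m) := by
  rcases Nat.lt_or_ge 1 n with hn | hn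
  · obtain ⟨⟨k, l⟩, h1, h2⟩ := exists_word hn w
    have hcomm : ∀ l : List ℤ, (l.map (T (n := n) q t)).prod *
        ((piU q t ^ m : (DAHA n q t)ˣ) : DAHA n q t) =
        ((piU q t ^ m : (DAHA n q t)ˣ) : DAHA n q t) *
          ((l.map fun i => i - m).map (T q t)).prod := by
      intro l
      induction l with
      | nil => simp
      | cons i l ih =>
        simp only [List.map_cons, List.prod_cons]
        rw [mul_assoc, ih, ← mul_assoc, ← mul_assoc, piU_zpow_mul_T, sub_add_cancel]
    have hcomm' : ∀ l : List ℤ, (l.map (simple n)).prod * rot n ^ m =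
        rot n ^ m * ((l.map fun i => i - m).map (simple n)).prod := by
      intro l
      induction l with
      | nil => simp
      | cons i l ih =>
        simp only [List.map_cons, List.prod_cons]
        rw [mul_assoc, ih, ← mul_assoc, ← mul_assoc, rot_zpow_mul_simple, sub_add_cancel]
    rw [TW_eq_of_word hn h1 h2, TW_eq_of_word (p := (k + m, l.map fun i => i - m)) hn]
    · simp only [wordVal]
      rw [mul_assoc, hcomm, ← mul_assoc, zpow_add, Units.val_mul]
    · simp only [wordPerm] at h1 ⊢
      rw [h1, mul_assoc, hcomm', ← mul_assoc, zpow_add]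
    · rw [len_mul_rot_zpow hn, ← h2]; simp
  · obtain rfl : n = 1 := le_antisymm hn (NeZero.one_le)
    rw [eq_rot_zpow_of_one w, ← zpow_add, TW_rot_zpow, TW_rot_zpow, zpow_add, Units.val_mul]

theorem Y_mul_piU_zpow (k i : ℤ) :
    Y q t i * ((piU q t ^ k : (DAHA n q t)ˣ) : DAHA n q t) =
      ((piU q t ^ k : (DAHA n q t)ˣ) : DAHA n q t) * Y q t (i - k) := by
  have hs : ∀ i : ℤ, Y q t i * ((piU q t)⁻¹ : (DAHA n q t)ˣ).val =
      ((piU q t)⁻¹ : (DAHA n q t)ˣ).val * Y q t (i + 1) := by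
    intro i
    rw [Units.mul_inv_eq_iff_eq_mul, mul_assoc, Units.eq_inv_mul_iff_mul_eq, piU_mul_Y]
  have hs' : ∀ i : ℤ, Y q t i * (piU (n := n) q t).val = (piU q t).val * Y q t (i - 1) := by
    intro i
    rw [piU_mul_Y, sub_add_cancel]
  induction k using Int.induction_on generalizing i with
  | zero => simp
  | succ k ih =>
    rw [zpow_add_one, Units.val_mul, ← mul_assoc, ih, mul_assoc, hs', mul_assoc]
    congr 3; ring
  | pred k ih =>
    rw [zpow_sub_one, Units.val_mul, ← mul_assoc, ih, mul_assoc, hs, mul_assoc]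
    congr 3; ring

/-! ### Moving Laurent polynomials to the right -/

theorem incl_mul_piU_zpow (k : ℤ) (p : Laurent K n) :
    incl q t p * ((piU q t ^ k : (DAHA n q t)ˣ) : DAHA n q t) =
      ((piU q t ^ k : (DAHA n q t)ˣ) : DAHA n q t) * incl q t (act q (rot n ^ (-k)) p) := by
  set u : (DAHA n q t)ˣ := piU q t ^ k
  induction p using laurent_induction with
  | hc c => rw [AlgHom.commutes, AlgHom.commutes, AlgHom.commutes, Algebra.commutes]
  | hadd x y hx hy => rw [map_add, map_add, map_add, add_mul, mul_add, hx, hy]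
  | hmul x y hx hy =>
    rw [map_mul, map_mul, map_mul, mul_assoc, hy, ← mul_assoc, hx, mul_assoc]
  | hY r =>
    rw [← yL_rep (q := q), act_yL, incl_yL, incl_yL, Y_mul_piU_zpow, rot_zpow_apply]
    rfl
  | hinv x y hx hxy =>
    have h1 : incl q t x * incl q t y = 1 := by rw [← map_mul, hxy, map_one]
    have h2 : incl q t y * incl q t x = 1 := by rw [← map_mul, mul_comm, hxy, map_one]
    have h3 : incl q t (act q (rot n ^ (-k)) x) * incl q t (act q (rot n ^ (-k)) y) = 1 := by
      rw [← map_mul, ← map_mul, hxy, map_one, map_one]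
    calc incl q t y * u = incl q t y * (u * (incl q t (act q (rot n ^ (-k)) x) *
          incl q t (act q (rot n ^ (-k)) y))) := by rw [h3, mul_one]
      _ = incl q t y * incl q t x * u * incl q t (act q (rot n ^ (-k)) y) := by
          rw [← mul_assoc (u : DAHA n q t), ← hx]; simp only [mul_assoc]
      _ = _ := by rw [h2, one_mul]

variable (ht : ∀ m : ℕ, 0 < m → t ^ m ≠ 1) (hq : q = t ^ (-2 : ℤ))

include ht hq

/-- Bernstein relation, in existential form: `Y_j T_i` is `T_i s_i(Y_j)` up to a Laurent
polynomial. -/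
theorem exists_Y_mul_T (i j : ℤ) : ∃ p' : Laurent K n, Y q t j * T q t i =
    T q t i * Y q t ((simple n i).1 j) + incl q t p' := by
  rcases Nat.lt_or_ge 1 n with hn | hn
  · by_cases h1 : (n : ℤ) ∣ j - i
    · obtain ⟨m, hm⟩ := h1
      obtain rfl : j = i + m * n := by linarith
      refine ⟨((q ^ (-m) : Kˣ) : K) • (-((t : K) - ((t⁻¹ : Kˣ) : K)) • yL q (i + 1)), ?_⟩
      rw [apply_add_mul, simple_self hn, Y_add_mul, Y_add_mul, smul_mul_assoc, Y_mul_T, map_smul,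
        map_smul, incl_yL, mul_smul_comm, ← smul_add, neg_smul, sub_eq_add_neg]
    by_cases h2 : (n : ℤ) ∣ j - (i + 1)
    · obtain ⟨m, hm⟩ := h2
      obtain rfl : j = i + 1 + m * n := by linarith
      refine ⟨((q ^ (-m) : Kˣ) : K) • (((t : K) - ((t⁻¹ : Kˣ) : K)) • yL q (i + 1)), ?_⟩
      rw [apply_add_mul, simple_succ hn, Y_add_mul, Y_add_mul, smul_mul_assoc, Y_succ_mul_T,
        map_smul, map_smul, incl_yL, mul_smul_comm, ← smul_add]
    · refine ⟨0, ?_⟩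
      rw [simple_of_not_dvd h1 h2, T_mul_Y_of_not_dvd h1 h2, map_zero, add_zero]
  · obtain rfl : n = 1 := le_antisymm hn (NeZero.one_le)
    refine ⟨0, ?_⟩
    rw [simple_one_eq, T_eq_of_one ht hq, map_zero, add_zero]
    exact (Algebra.commutes _ _).symm

theorem exists_incl_mul_T (i : ℤ) (p : Laurent K n) : ∃ p' : Laurent K n,
    incl q t p * T q t i = T q t i * incl q t (act q (simple n i) p) + incl q t p' := by
  induction p using laurent_induction with
  | hc c =>
    refine ⟨0, ?_⟩
    rw [AlgHom.commutes, AlgHom.commutes, AlgHom.commutes, map_zero, add_zero, Algebra.commutes]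
  | hadd x y hx hy =>
    obtain ⟨x', hx⟩ := hx
    obtain ⟨y', hy⟩ := hy
    refine ⟨x' + y', ?_⟩
    simp only [map_add, add_mul, mul_add, hx, hy]
    abel
  | hmul x y hx hy =>
    obtain ⟨x', hx⟩ := hx
    obtain ⟨y', hy⟩ := hy
    refine ⟨x' * act q (simple n i) y + x * y', ?_⟩
    rw [map_mul, mul_assoc, hy, mul_add, ← mul_assoc, hx]
    simp only [map_add, map_mul, add_mul, mul_assoc, add_assoc]
  | hY r =>
    rw [← yL_rep (q := q), act_yL, incl_yL, incl_yL]
    exact exists_Y_mul_T ht hq i _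
  | hinv x y hx hxy =>
    obtain ⟨x', hx⟩ := hx
    refine ⟨-(y * x' * act q (simple n i) y), ?_⟩
    have h2 : incl q t y * incl q t x = 1 := by rw [← map_mul, mul_comm, hxy, map_one]
    have h3 : incl q t (act q (simple n i) x) * incl q t (act q (simple n i) y) = 1 := by
      rw [← map_mul, ← map_mul, hxy, map_one, map_one]
    have h4 := congrArg (fun z => incl q t y * z * incl q t (act q (simple n i) y)) hx
    simp only [mul_add, add_mul] at h4
    rw [← mul_assoc (incl q t y), h2, one_mul, mul_assoc (incl q t y), mul_assoc (T q t i), h3,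
      mul_one] at h4
    rw [h4, map_neg, map_mul, map_mul]
    abel

omit ht hq in
/-- The span of the `T_y p` with `y` of length less than `m`. -/
def filt (q t : Kˣ) (m : ℕ) : Submodule K (DAHA n q t) :=
  Submodule.span K {h | ∃ (y : AffSym n) (p : Laurent K n), len y < m ∧ h = TW q t y * incl q t p}

omit ht hq in
theorem TW_mul_incl_mem_filt {y : AffSym n} {m : ℕ} (h : len y < m) (p : Laurent K n) :
    TW q t y * incl q t p ∈ filt q t m :=
  Submodule.subset_span ⟨y, p, h, rfl⟩

omit ht hq in
theorem TW_mem_filt {y : AffSym n} {m : ℕ} (h : len y < m) : TW q t y ∈ filt q t m := by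
  simpa using TW_mul_incl_mem_filt h (1 : Laurent K n)

omit ht hq in
theorem filt_mono {m m' : ℕ} (h : m ≤ m') : filt (n := n) q t m ≤ filt q t m' := by
  refine Submodule.span_mono ?_
  rintro _ ⟨y, p, hy, rfl⟩
  exact ⟨y, p, hy.trans_le h, rfl⟩

omit ht hq in
theorem filt_mul_incl {m : ℕ} {h : DAHA n q t} (hh : h ∈ filt q t m) (p : Laurent K n) :
    h * incl q t p ∈ filt q t m := by
  induction hh using Submodule.span_induction with
  | mem x hx =>
    obtain ⟨y, p', hy, rfl⟩ := hx
    rw [mul_assoc, ← map_mul]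
    exact TW_mul_incl_mem_filt hy _
  | zero => rw [zero_mul]; exact zero_mem _
  | add x y _ _ hx hy => rw [add_mul]; exact add_mem hx hy
  | smul c x _ hx => rw [smul_mul_assoc]; exact Submodule.smul_mem _ _ hx

theorem TW_mul_T_mem_filt (y : AffSym n) (i : ℤ) :
    TW q t y * T q t i ∈ filt (n := n) q t (len y + 2) := by
  rcases Nat.lt_or_ge 1 n with hn | hn
  · rcases lt_trichotomy (y.1 i) (y.1 (i + 1)) with h | h | h
    · rw [TW_mul_T hn h]
      exact TW_mem_filt (by rw [len_mul_simple hn y h]; omega)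
    · exact absurd (y.1.injective h) (by omega)
    · rw [TW_mul_T_of_gt hn h]
      have := len_mul_simple_of_gt hn y h
      exact add_mem (Submodule.smul_mem _ _ (TW_mem_filt (by omega))) (TW_mem_filt (by omega))
  · obtain rfl : n = 1 := le_antisymm hn (NeZero.one_le)
    rw [T_eq_of_one ht hq, ← Algebra.commutes, ← Algebra.smul_def]
    exact Submodule.smul_mem _ _ (TW_mem_filt (by omega))

/-- Right multiplication by `T_i` raises the filtration by at most one: the Laurent polynomial is moved
past `T_i` by the Bernstein relation. -/
theorem filt_mul_T {m : ℕ} {h : DAHA n q t} (hh : h ∈ filt q t m) (i : ℤ) :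
    h * T q t i ∈ filt q t (m + 1) := by
  induction hh using Submodule.span_induction with
  | mem x hx =>
    obtain ⟨y, p', hy, rfl⟩ := hx
    obtain ⟨p'', hp⟩ := exists_incl_mul_T ht hq i p'
    rw [mul_assoc, hp, mul_add, ← mul_assoc]
    exact add_mem (filt_mul_incl (filt_mono (by omega) (TW_mul_T_mem_filt ht hq y i)) _)
      (TW_mul_incl_mem_filt (by omega) _)
  | zero => rw [zero_mul]; exact zero_mem _
  | add x y _ _ hx hy => rw [add_mul]; exact add_mem hx hy
  | smul c x _ hx => rw [smul_mul_assoc]; exact Submodule.smul_mem _ _ hx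

/-- The `Y_i` act triangularly on the `T_x`, with diagonal `Y_{x⁻¹ i}`. -/
theorem Y_mul_TW_sub_mem (x : AffSym n) (i : ℤ) :
    Y q t i * TW q t x - TW q t x * Y q t ((x⁻¹).1 i) ∈ filt q t (len x) := by
  have hrot : ∀ k : ℤ, Y q t i * TW q t (rot n ^ k) -
      TW q t (rot n ^ k) * Y q t (((rot n ^ k)⁻¹).1 i) = 0 := by
    intro k
    rw [TW_rot_zpow, Y_mul_piU_zpow, ← zpow_neg, rot_zpow_apply, sub_eq_zero]
    rfl
  rcases Nat.lt_or_ge 1 n with hn | hn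
  · induction hm : len x using Nat.strong_induction_on generalizing x with
    | _ m ih =>
    by_cases h0 : len x = 0
    · rw [eq_rot_zpow_of_forall (w := x), hrot]
      · exact zero_mem _
      · intro j
        by_contra hc
        have hne : x.1 j ≠ x.1 (j + 1) := fun e => by have := x.1.injective e; omega
        have := len_mul_simple_of_gt hn x (i := j) (lt_of_le_of_ne (not_lt.mp hc) hne.symm)
        omega
    · obtain ⟨j, hj⟩ := exists_descent h0
      have hl := len_mul_simple_of_gt hn x hj
      set y := x * simple n j with hy
      have hyj : y.1 j < y.1 (j + 1) := by
        change x.1 ((simple n j).1 j) < x.1 ((simple n j).1 (j + 1))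
        rwa [simple_self hn, simple_succ hn]
      have hx : x = y * simple n j := (simple_mul_simple_cancel x j).symm
      have h1 := filt_mul_T ht hq (ih (len y) (by omega) y rfl) j
      obtain ⟨p', hp⟩ := exists_Y_mul_T (n := n) ht hq j ((y⁻¹).1 i)
      have hxi : (x⁻¹).1 i = (simple n j).1 ((y⁻¹).1 i) := by
        rw [hx, mul_inv_rev, simple_inv]; rfl
      have hT : TW q t x = TW q t y * T q t j := by rw [TW_mul_T hn hyj, ← hx]
      have h2 : Y q t i * TW q t x - TW q t x * Y q t ((x⁻¹).1 i) =
          (Y q t i * TW q t y - TW q t y * Y q t ((y⁻¹).1 i)) * T q t j +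
            TW q t y * incl q t p' := by
        rw [hT, hxi, sub_mul, mul_assoc (TW q t y) (Y q t _), hp, mul_add]
        simp only [mul_assoc]
        abel
      rw [h2]
      exact add_mem (filt_mono (by omega) h1) (TW_mul_incl_mem_filt (by omega) _)
  · obtain rfl : n = 1 := le_antisymm hn (NeZero.one_le)
    rw [eq_rot_zpow_of_one x, hrot]
    exact zero_mem _

omit ht hq in
/-- A subspace of the double affine Hecke algebra which contains `1` and is stable under right
multiplication by the generators is everything. -/
theorem eq_top_of_right_stable (S : Submodule K (DAHA n q t)) (h1 : 1 ∈ S)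
    (hT : ∀ s ∈ S, ∀ i, s * T q t i ∈ S)
    (hpi : ∀ s ∈ S, ∀ k : ℤ, s * ((piU q t ^ k : (DAHA n q t)ˣ) : DAHA n q t) ∈ S)
    (hY : ∀ s ∈ S, ∀ p, s * incl q t p ∈ S) : S = ⊤ := by
  have key : ∀ z : FreeAlgebra K (Gen n), ∀ s ∈ S, s * ofFree q t z ∈ S := by
    intro z
    induction z using FreeAlgebra.induction with
    | grade0 c =>
      intro s hs
      rw [AlgHom.commutes, ← Algebra.commutes, ← Algebra.smul_def]
      exact S.smul_mem _ hs
    | grade1 g =>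
      intro s hs
      cases g with
      | T i =>
        have := hT s hs (i.cast : ℤ)
        unfold T freeT at this
        rwa [ZMod.intCast_zmod_cast] at this
      | pi =>
        have := hpi s hs 1
        rw [zpow_one] at this
        exact this
      | piInv =>
        have := hpi s hs (-1)
        rw [zpow_neg_one] at this
        exact this
      | Y r =>
        have := hY s hs (lY K r)
        rwa [incl, laurentLift_lY] at this
      | YInv r =>
        obtain ⟨u, hu⟩ := isUnit_lY (K := K) r
        have := hY s hs ((u⁻¹ : (Laurent K n)ˣ) : Laurent K n)
        have e : incl q t ((u⁻¹ : (Laurent K n)ˣ) : Laurent K n) =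
            (((YU q t r)⁻¹ : (DAHA n q t)ˣ) : DAHA n q t) := by
          apply Units.eq_inv_of_mul_eq_one_right
          have h2 : (YU q t r : DAHA n q t) = incl q t (lY K r) := by rw [incl, laurentLift_lY]
          rw [h2, ← map_mul, ← hu, Units.inv_mul, map_one]
        rw [e] at this
        exact this
    | mul x y hx hy =>
      intro s hs
      rw [map_mul, ← mul_assoc]
      exact hy _ (hx s hs)
    | add x y hx hy =>
      intro s hs
      rw [map_add, mul_add]
      exact add_mem (hx s hs) (hy s hs)
  rw [eq_top_iff]
  rintro h -
  obtain ⟨z, rfl⟩ := RingQuot.mkAlgHom_surjective K (Rel n q t) h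
  have := key z 1 h1
  rwa [one_mul] at this

/-- The elements `T_x p`, with `p` a Laurent polynomial, span the double affine Hecke algebra. -/
theorem span_TW_mul_incl : Submodule.span K
    (Set.range fun yp : AffSym n × Laurent K n => TW q t yp.1 * incl q t yp.2) = ⊤ := by
  set S := Submodule.span K
    (Set.range fun yp : AffSym n × Laurent K n => TW q t yp.1 * incl q t yp.2) with hS
  have hfilt : ∀ m, filt q t m ≤ S := by
    intro m
    refine Submodule.span_mono ?_
    rintro _ ⟨y, p, -, rfl⟩
    exact ⟨(y, p), rfl⟩
  have ind : ∀ a : DAHA n q t, (∀ y p, TW q t y * incl q t p * a ∈ S) → ∀ s ∈ S, s * a ∈ S := by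
    intro a ha s hs
    induction hs using Submodule.span_induction with
    | mem x hx =>
      obtain ⟨⟨y, p⟩, rfl⟩ := hx
      exact ha y p
    | zero => rw [zero_mul]; exact zero_mem _
    | add x y _ _ hx hy => rw [add_mul]; exact add_mem hx hy
    | smul c x _ hx => rw [smul_mul_assoc]; exact Submodule.smul_mem _ _ hx
  apply eq_top_of_right_stable
  · exact Submodule.subset_span ⟨(1, 1), by simp [TW_one]⟩
  · intro s hs i
    refine ind _ (fun y p => ?_) s hs
    exact hfilt _ (filt_mul_T ht hq (TW_mul_incl_mem_filt (Nat.lt_succ_self _) p) i)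
  · intro s hs k
    refine ind _ (fun y p => ?_) s hs
    rw [mul_assoc, incl_mul_piU_zpow, ← mul_assoc, TW_mul_piU_zpow]
    exact Submodule.subset_span ⟨(_, _), rfl⟩
  · intro s hs p'
    refine ind _ (fun y p => ?_) s hs
    rw [mul_assoc, ← map_mul]
    exact Submodule.subset_span ⟨(_, _), rfl⟩

end DahaSpan

/-! ### The field of rational functions in the `Y_i` -/

/-- The field of rational functions `K(Y_1, …, Y_n)`. -/
def RatFun (K : Type*) [Field K] (n : ℕ) : Type _ := FractionRing (Laurent K n)

instance : Field (RatFun K n) := inferInstanceAs (Field (FractionRing (Laurent K n)))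

instance : Algebra (Laurent K n) (RatFun K n) :=
  inferInstanceAs (Algebra (Laurent K n) (FractionRing (Laurent K n)))

instance : Algebra K (RatFun K n) := inferInstanceAs (Algebra K (FractionRing (Laurent K n)))

instance : IsScalarTower K (Laurent K n) (RatFun K n) :=
  inferInstanceAs (IsScalarTower K (Laurent K n) (FractionRing (Laurent K n)))

instance : IsFractionRing (Laurent K n) (RatFun K n) :=
  inferInstanceAs (IsFractionRing (Laurent K n) (FractionRing (Laurent K n)))

/-- Laurent polynomials as rational functions. -/
def toF : Laurent K n →ₐ[K] RatFun K n := IsScalarTower.toAlgHom K (Laurent K n) (RatFun K n)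

theorem toF_injective : Function.Injective (toF : Laurent K n → RatFun K n) :=
  IsFractionRing.injective (Laurent K n) (RatFun K n)

theorem exists_eq_toF_div (g : RatFun K n) :
    ∃ p s : Laurent K n, s ≠ 0 ∧ g = toF p / toF s := by
  obtain ⟨p, s, hs, h⟩ := IsFractionRing.div_surjective (Laurent K n) g
  exact ⟨p, s, nonZeroDivisors.ne_zero hs, h.symm⟩

theorem act_injective (w : AffSym n) :
    Function.Injective (act q w : Laurent K n → Laurent K n) := by
  refine Function.LeftInverse.injective (g := act q w⁻¹) fun p => ?_
  rw [← act_mul_apply, inv_mul_cancel, map_one]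
  rfl

/-- The action of an affine permutation on rational functions. -/
def actFHom (q : Kˣ) (w : AffSym n) : RatFun K n →ₐ[K] RatFun K n :=
  IsFractionRing.liftAlgHom (g := toF.comp (act q w)) (toF_injective.comp (act_injective w))

theorem actFHom_toF (w : AffSym n) (p : Laurent K n) :
    actFHom q w (toF p) = toF (act q w p) :=
  IsFractionRing.lift_algebraMap (K := RatFun K n) (g := (toF.comp (act q w)).toRingHom)
    (toF_injective.comp (act_injective w)) p

/-- The action of the extended affine symmetric group on rational functions. -/
def actF (q : Kˣ) : AffSym n →* (RatFun K n →ₐ[K] RatFun K n) where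
  toFun := actFHom q
  map_one' := by
    refine AlgHom.ext fun g => ?_
    obtain ⟨p, s, -, rfl⟩ := exists_eq_toF_div g
    rw [map_div₀, actFHom_toF, actFHom_toF, map_one]
    rfl
  map_mul' w w' := by
    refine AlgHom.ext fun g => ?_
    obtain ⟨p, s, -, rfl⟩ := exists_eq_toF_div g
    rw [AlgHom.mul_apply]
    simp only [map_div₀, actFHom_toF, act_mul_apply]

theorem actF_toF (w : AffSym n) (p : Laurent K n) : actF q w (toF p) = toF (act q w p) :=
  actFHom_toF w p

theorem actF_mul_apply (w w' : AffSym n) (g : RatFun K n) :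
    actF q (w * w') g = actF q w (actF q w' g) := by
  rw [map_mul]; rfl

theorem actF_one_apply (g : RatFun K n) : actF (n := n) q 1 g = g := by
  rw [map_one]; rfl

theorem actF_inv_apply (w : AffSym n) (g : RatFun K n) : actF q w⁻¹ (actF q w g) = g := by
  rw [← actF_mul_apply, inv_mul_cancel, actF_one_apply]

theorem actF_apply_inv (w : AffSym n) (g : RatFun K n) : actF q w (actF q w⁻¹ g) = g := by
  rw [← actF_mul_apply, mul_inv_cancel, actF_one_apply]

/-- `Y_i` as a rational function. -/
def yF (q : Kˣ) (i : ℤ) : RatFun K n := toF (yL q i)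

/-- `f_{i,j}` as a rational function. -/
def fF (q t : Kˣ) (i j : ℤ) : RatFun K n := toF (lf q t i j)

theorem fF_eq (i j : ℤ) : (fF q t i j : RatFun K n) =
    algebraMap K _ (t : K) * yF q i - (algebraMap K _ (t : K))⁻¹ * yF q j := by
  rw [fF, lf_eq, map_sub, map_smul, map_smul, Algebra.smul_def, Algebra.smul_def,
    Units.val_inv_eq_inv_val, map_inv₀]
  rfl

theorem actF_yF (w : AffSym n) (i : ℤ) : actF (K := K) q w (yF q i) = yF q (w.1 i) := by
  rw [yF, actF_toF, act_yL]; rfl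

theorem actF_fF (w : AffSym n) (i j : ℤ) :
    actF (K := K) q w (fF q t i j) = fF q t (w.1 i) (w.1 j) := by
  rw [fF, actF_toF, act_lf]; rfl

theorem yF_add_mul (i m : ℤ) :
    (yF q (i + m * n) : RatFun K n) = algebraMap K _ ((q ^ (-m) : Kˣ) : K) * yF q i := by
  rw [yF, yL_add_mul, map_smul, Algebra.smul_def]; rfl

theorem yF_ne_zero (i : ℤ) : (yF q i : RatFun K n) ≠ 0 :=
  ((isUnit_yL i).map (toF : Laurent K n →ₐ[K] RatFun K n)).ne_zero

theorem lY_ne_smul_lY {r r' : Fin n} (h : r ≠ r') (c : K) : lY K r ≠ c • lY K r' := by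
  intro e
  simp only [lY, MonoidAlgebra.of_apply, MonoidAlgebra.smul_single] at e
  have h1 := congrArg (fun p : Laurent K n => p.coeff (Pi.mulSingle r (Multiplicative.ofAdd 1))) e
  simp only [MonoidAlgebra.coeff_single, Finsupp.single_apply] at h1
  rw [if_pos trivial, if_neg] at h1
  · exact one_ne_zero h1
  · intro e'
    have := congrFun e' r
    rw [Pi.mulSingle_eq_same, Pi.mulSingle_eq_of_ne h] at this
    exact absurd (Multiplicative.ofAdd.injective this) (by norm_num)

theorem yF_ne_mul_yF {i j : ℤ} (h : residue n i ≠ residue n j) (c : K) :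
    (yF q i : RatFun K n) ≠ algebraMap K _ c * yF q j := by
  intro e
  rw [yF, yF, ← Algebra.smul_def, ← map_smul] at e
  have e' := toF_injective e
  rw [yL, yL, extend_eq, extend_eq, smul_smul] at e'
  set u : K := ((q ^ (-wind n i) : Kˣ) : K) with hu
  have hu0 : u ≠ 0 := Units.ne_zero _
  refine lY_ne_smul_lY h (u⁻¹ * (c * ((q ^ (-wind n j) : Kˣ) : K))) ?_
  rw [mul_smul, ← e', smul_smul, inv_mul_cancel₀ hu0, one_smul]

section Generic

variable (ht : ∀ m : ℕ, 0 < m → t ^ m ≠ 1) (hq : q = t ^ (-2 : ℤ))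

include ht hq

theorem q_zpow_eq_one_iff (m : ℤ) : q ^ m = 1 ↔ m = 0 := by
  constructor
  · intro h
    rw [hq, ← zpow_mul] at h
    by_contra hm
    have h1 : t ^ (2 * m.natAbs) = 1 := by
      rw [← zpow_natCast]
      push_cast
      rcases abs_cases m with ⟨e, -⟩ | ⟨e, -⟩
      · rw [e, ← inv_inv (t ^ (2 * m)), ← zpow_neg, show -(2 * m) = -2 * m by ring, h, inv_one]
      · rw [e, show 2 * -m = -2 * m by ring, h]
    exact ht _ (by omega) h1
  · rintro rfl; simp

theorem q_zpow_injective : Function.Injective fun m : ℤ => ((q ^ m : Kˣ) : K) := by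
  intro a b h
  have h1 : q ^ a = q ^ b := Units.ext h
  have h2 : q ^ (a - b) = 1 := by rw [zpow_sub, h1, mul_inv_cancel]
  have := (q_zpow_eq_one_iff ht hq _).mp h2
  omega

theorem yF_injective : Function.Injective (yF q : ℤ → RatFun K n) := by
  intro i j h
  by_cases hr : residue n i = residue n j
  · obtain ⟨m, hm⟩ := residue_eq_iff.mp hr
    obtain rfl : i = j + m * n := by linarith
    rw [yF_add_mul] at h
    have h1 : algebraMap K (RatFun K n) ((q ^ (-m) : Kˣ) : K) = algebraMap K _ 1 := by
      rw [map_one]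
      exact mul_right_cancel₀ (yF_ne_zero (q := q) j) (by rw [h, one_mul])
    have h2 := (algebraMap K (RatFun K n)).injective h1
    have h3 := (q_zpow_eq_one_iff ht hq (-m)).mp (Units.ext (by simpa using h2))
    obtain rfl : m = 0 := by omega
    simp
  · exact absurd (by simpa using h) (yF_ne_mul_yF (q := q) hr 1)

theorem yF_sub_ne_zero {i j : ℤ} (h : i ≠ j) : (yF q i - yF q j : RatFun K n) ≠ 0 :=
  sub_ne_zero.mpr fun e => h (yF_injective ht hq e)

omit ht in
theorem yF_add_n (i : ℤ) :
    (yF q (i + n) : RatFun K n) = (algebraMap K _ (t : K)) ^ 2 * yF q i := by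
  have h := yF_add_mul (K := K) (n := n) (q := q) i 1
  rw [one_mul] at h
  rw [h, zpow_neg_one, q_inv_eq hq, map_pow]

omit ht in
/-- As `q = t⁻²`, the differences of the `Y_i` are, up to the scalar `t`, among the `f_{i,j}`. -/
theorem fF_add_n (i j : ℤ) :
    (fF q t i (j + n) : RatFun K n) = algebraMap K _ (t : K) * (yF q i - yF q j) := by
  have ht0 : algebraMap K (RatFun K n) (t : K) ≠ 0 := by simp
  rw [fF_eq, yF_add_n hq]
  field_simp

theorem fF_ne_zero {i j : ℤ} (h : j ≠ i + n) : (fF q t i j : RatFun K n) ≠ 0 := by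
  rw [show j = j - n + n by ring, fF_add_n hq]
  exact mul_ne_zero (by simp) (yF_sub_ne_zero ht hq (by omega))

theorem actF_injective : Function.Injective (actF (K := K) (n := n) q) := by
  intro w w' h
  apply Subtype.ext
  ext i
  have h1 := congrArg (fun φ : RatFun K n →ₐ[K] RatFun K n => φ (yF q i)) h
  simp only [actF_yF] at h1
  exact yF_injective ht hq h1

end Generic

/-! ### The representation on rational functions -/

/-- Multiplication by a rational function. -/
def mulOp : RatFun K n →ₐ[K] Module.End K (RatFun K n) := Algebra.lmul K (RatFun K n)

/-- The operator on rational functions given by an affine permutation. -/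
def permOp (q : Kˣ) : AffSym n →* Module.End K (RatFun K n) where
  toFun w := (actF q w).toLinearMap
  map_one' := by ext g; exact actF_one_apply g
  map_mul' w w' := by ext g; exact actF_mul_apply w w' g

theorem mulOp_apply (g x : RatFun K n) : mulOp g x = g * x := rfl

theorem permOp_apply (w : AffSym n) (g : RatFun K n) : permOp q w g = actF q w g := rfl

theorem permOp_mul_mulOp (w : AffSym n) (g : RatFun K n) :
    permOp q w * mulOp g = mulOp (actF q w g) * permOp q w := by
  ext x
  simp only [Module.End.mul_apply, mulOp_apply, permOp_apply, map_mul]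

theorem mulOp_mul_permOp (w : AffSym n) (g : RatFun K n) :
    mulOp g * permOp q w = permOp q w * mulOp (actF q w⁻¹ g) := by
  rw [permOp_mul_mulOp, actF_apply_inv]

theorem permOp_mul_inv (w : AffSym n) : permOp (K := K) q w * permOp q w⁻¹ = 1 := by
  rw [← map_mul, mul_inv_cancel, map_one]

/-- The coefficient `f_{i,i+1} / (Y_i - Y_{i+1})`. -/
def eF (q t : Kˣ) (i : ℤ) : RatFun K n := fF q t i (i + 1) / (yF q i - yF q (i + 1))

/-- The Demazure–Lusztig operator `T_i = t + (s_i - 1) f_{i,i+1} / (Y_i - Y_{i+1})`. -/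
def opT (q t : Kˣ) (i : ℤ) : Module.End K (RatFun K n) :=
  algebraMap K _ (t : K) + (permOp q (simple n i) - 1) * mulOp (eF q t i)

theorem opT_apply (i : ℤ) (g : RatFun K n) : opT q t i g =
    algebraMap K _ (t : K) * g + actF q (simple n i) (eF q t i) * actF q (simple n i) g -
      eF q t i * g := by
  rw [opT, LinearMap.add_apply, Module.End.mul_apply, LinearMap.sub_apply, mulOp_apply,
    permOp_apply, map_mul, Module.algebraMap_end_apply, Algebra.smul_def, Module.End.one_apply]
  ring

theorem eF_congr {i j : ℤ} (h : (n : ℤ) ∣ i - j) : (eF q t i : RatFun K n) = eF q t j := by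
  obtain ⟨m, hm⟩ := h
  obtain rfl : i = j + m * n := by linarith
  have hu : algebraMap K (RatFun K n) ((q ^ (-m) : Kˣ) : K) ≠ 0 :=
    (map_ne_zero _).mpr (Units.ne_zero _)
  rw [eF, eF, fF_eq, fF_eq, show j + m * n + 1 = j + 1 + m * n by ring, yF_add_mul, yF_add_mul,
    ← mul_sub, mul_left_comm, mul_left_comm _ (algebraMap K (RatFun K n) ((q ^ (-m) : Kˣ) : K)),
    ← mul_sub, mul_div_mul_left _ _ hu]

theorem opT_congr {i j : ℤ} (h : (n : ℤ) ∣ i - j) :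
    (opT q t i : Module.End K (RatFun K n)) = opT q t j := by
  rw [opT, opT, eF_congr h, simple_eq_of_dvd h]

section Rep

variable (ht : ∀ m : ℕ, 0 < m → t ^ m ≠ 1) (hq : q = t ^ (-2 : ℤ))

include ht hq

theorem opT_apply_of_lt (hn : 1 < n) (i : ℤ) (g : RatFun K n) : opT q t i g =
    -((algebraMap K _ (t : K) - (algebraMap K _ (t : K))⁻¹) * yF q (i + 1) /
        (yF q i - yF q (i + 1))) * g +
      ((algebraMap K _ (t : K))⁻¹ * yF q i - algebraMap K _ (t : K) * yF q (i + 1)) /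
        (yF q i - yF q (i + 1)) * actF q (simple n i) g := by
  have ht0 : algebraMap K (RatFun K n) (t : K) ≠ 0 := by simp
  have h1 : (yF q i - yF q (i + 1) : RatFun K n) ≠ 0 := yF_sub_ne_zero ht hq (by omega)
  have h2 : (yF q (i + 1) - yF q i : RatFun K n) ≠ 0 := yF_sub_ne_zero ht hq (by omega)
  rw [opT_apply, eF, map_div₀, map_sub, actF_fF, actF_yF, actF_yF, simple_self hn, simple_succ hn,
    fF_eq, fF_eq, show (yF q (i + 1) - yF q i : RatFun K n) = -(yF q i - yF q (i + 1)) by ring]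
  field_simp
  ring

theorem opT_of_one (i : ℤ) :
    (opT q t i : Module.End K (RatFun K 1)) = algebraMap K _ (t : K) := by
  rw [opT, simple_one_eq, map_one, sub_self, zero_mul, add_zero]

theorem opT_quadratic (i : ℤ) : (opT q t i - algebraMap K _ (t : K)) *
    (opT q t i + algebraMap K _ ((t⁻¹ : Kˣ) : K)) = (0 : Module.End K (RatFun K n)) := by
  rcases Nat.lt_or_ge 1 n with hn | hn
  · have ht0 : algebraMap K (RatFun K n) (t : K) ≠ 0 := by simp
    have h1 : (yF q i - yF q (i + 1) : RatFun K n) ≠ 0 := yF_sub_ne_zero ht hq (by omega)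
    have h2 : ∀ g : RatFun K n, actF q (simple n i) (actF q (simple n i) g) = g := fun g => by
      rw [← actF_mul_apply, simple_mul_self, actF_one_apply]
    ext g
    simp only [Module.End.mul_apply, LinearMap.sub_apply, LinearMap.add_apply,
      Module.algebraMap_end_apply, opT_apply_of_lt ht hq hn, Algebra.smul_def, map_add, map_mul,
      map_neg, map_div₀, map_sub, actF_yF, simple_self hn, simple_succ hn, h2, AlgHom.commutes,
      map_inv₀, Units.val_inv_eq_inv_val, LinearMap.zero_apply]
    rw [show (yF q (i + 1) - yF q i : RatFun K n) = -(yF q i - yF q (i + 1)) by ring]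
    generalize actF q (simple n i) g = g1
    field_simp
    ring
  · obtain rfl : n = 1 := le_antisymm hn (NeZero.one_le)
    rw [opT_of_one ht hq, sub_self, zero_mul]

theorem opT_braid (hn : 3 ≤ n) (i : ℤ) :
    (opT q t i * opT q t (i + 1) * opT q t i : Module.End K (RatFun K n)) =
      opT q t (i + 1) * opT q t i * opT q t (i + 1) := by
  have hn' : 1 < n := by omega
  have ht0 : algebraMap K (RatFun K n) (t : K) ≠ 0 := by simp
  have h1 : (yF q i - yF q (i + 1) : RatFun K n) ≠ 0 := yF_sub_ne_zero ht hq (by omega)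
  have h2 : (yF q (i + 1) - yF q (i + 1 + 1) : RatFun K n) ≠ 0 := yF_sub_ne_zero ht hq (by omega)
  have h3 : (yF q i - yF q (i + 1 + 1) : RatFun K n) ≠ 0 := yF_sub_ne_zero ht hq (by omega)
  have hs : ∀ (j : ℤ) (g : RatFun K n), actF q (simple n j) (actF q (simple n j) g) = g :=
    fun j g => by rw [← actF_mul_apply, simple_mul_self, actF_one_apply]
  have hb : ∀ g : RatFun K n,
      actF q (simple n (i + 1)) (actF q (simple n i) (actF q (simple n (i + 1)) g)) =
        actF q (simple n i) (actF q (simple n (i + 1)) (actF q (simple n i) g)) := fun g => by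
    simp only [← actF_mul_apply, ← mul_assoc]
    rw [simple_braid hn]
  have ne_dvd : ∀ c : ℤ, 0 < c → c < n → ¬ (n : ℤ) ∣ c := fun c h0 h1 h2 => by
    have := Int.le_of_dvd h0 h2; omega
  have f1 : (simple n i).1 (i + 1 + 1) = i + 1 + 1 := simple_of_not_dvd
    (by rw [show i + 1 + 1 - i = 2 by ring]; exact ne_dvd 2 (by omega) (by omega))
    (by rw [show i + 1 + 1 - (i + 1) = 1 by ring]; exact ne_dvd 1 (by omega) (by omega))
  have f2 : (simple n (i + 1)).1 i = i := simple_of_not_dvd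
    (by rw [show i - (i + 1) = -1 by ring, dvd_neg]; exact ne_dvd 1 (by omega) (by omega))
    (by rw [show i - (i + 1 + 1) = -2 by ring, dvd_neg]; exact ne_dvd 2 (by omega) (by omega))
  ext g
  simp only [Module.End.mul_apply, opT_apply_of_lt ht hq hn', map_add, map_mul,
    map_neg, map_div₀, map_sub, actF_yF, simple_self hn', simple_succ hn', hs, AlgHom.commutes,
    map_inv₀, f1, f2, hb]
  rw [show (yF q (i + 1) - yF q i : RatFun K n) = -(yF q i - yF q (i + 1)) by ring,
    show (yF q (i + 1 + 1) - yF q (i + 1) : RatFun K n) =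
      -(yF q (i + 1) - yF q (i + 1 + 1)) by ring]
  generalize actF q (simple n i) (actF q (simple n (i + 1)) (actF q (simple n i) g)) = g121
  generalize actF q (simple n i) (actF q (simple n (i + 1)) g) = g12
  generalize actF q (simple n (i + 1)) (actF q (simple n i) g) = g21
  generalize actF q (simple n i) g = g1
  generalize actF q (simple n (i + 1)) g = g2
  field_simp
  ring

theorem opT_comm (hn : 3 ≤ n) (i j : ℤ) (h1 : ¬ (n : ℤ) ∣ j - (i + 1))
    (h2 : ¬ (n : ℤ) ∣ j - (i - 1)) :
    (opT q t i * opT q t j : Module.End K (RatFun K n)) = opT q t j * opT q t i := by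
  have hn' : 1 < n := by omega
  by_cases h : (n : ℤ) ∣ j - i
  · rw [opT_congr h]
  have fj : (simple n i).1 j = j := simple_of_not_dvd h h1
  have fj' : (simple n i).1 (j + 1) = j + 1 := simple_of_not_dvd
    (by rwa [show j + 1 - i = j - (i - 1) by ring]) (by rwa [show j + 1 - (i + 1) = j - i by ring])
  have fi : (simple n j).1 i = i := simple_of_not_dvd
    (by rwa [← dvd_neg, neg_sub]) (by rwa [← dvd_neg, show -(i - (j + 1)) = j - (i - 1) by ring])
  have fi' : (simple n j).1 (i + 1) = i + 1 := simple_of_not_dvd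
    (by rwa [← dvd_neg, neg_sub]) (by rwa [← dvd_neg, show -(i + 1 - (j + 1)) = j - i by ring])
  have hb : ∀ g : RatFun K n, actF q (simple n j) (actF q (simple n i) g) =
        actF q (simple n i) (actF q (simple n j) g) := fun g => by
    simp only [← actF_mul_apply]
    rw [simple_comm hn h1 h2]
  ext g
  simp only [Module.End.mul_apply, opT_apply_of_lt ht hq hn', map_add, map_mul,
    map_neg, map_div₀, map_sub, actF_yF, fi, fi', fj, fj', AlgHom.commutes, map_inv₀, hb]
  ring

omit ht hq in
theorem rot_mul_opT (i : ℤ) :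
    (permOp q (rot n) * opT q t i : Module.End K (RatFun K n)) =
      opT q t (i + 1) * permOp q (rot n) := by
  have h1 : actF q (rot n) (eF q t i : RatFun K n) = eF q t (i + 1) := by
    rw [eF, map_div₀, map_sub, actF_fF, actF_yF, actF_yF]
    rfl
  have h2 : rot n * simple n i = simple n (i + 1) * rot n := by
    simpa using rot_zpow_mul_simple (n := n) 1 i
  rw [opT, opT, mul_add, add_mul, ← Algebra.commutes, ← mul_assoc, mul_sub, ← map_mul, h2, map_mul,
    mul_one, mul_assoc (_ - 1), ← h1, ← permOp_mul_mulOp]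
  simp only [sub_mul, mul_assoc, one_mul]

theorem opT_mul_Y_mul_opT (i : ℤ) :
    (opT q t i * mulOp (yF q i) * opT q t i : Module.End K (RatFun K n)) =
      mulOp (yF q (i + 1)) := by
  rcases Nat.lt_or_ge 1 n with hn | hn
  · have ht0 : algebraMap K (RatFun K n) (t : K) ≠ 0 := by simp
    have h1 : (yF q i - yF q (i + 1) : RatFun K n) ≠ 0 := yF_sub_ne_zero ht hq (by omega)
    have h2 : ∀ g : RatFun K n, actF q (simple n i) (actF q (simple n i) g) = g := fun g => by
      rw [← actF_mul_apply, simple_mul_self, actF_one_apply]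
    ext g
    simp only [Module.End.mul_apply, mulOp_apply, opT_apply_of_lt ht hq hn, map_add, map_mul,
      map_neg, map_div₀, map_sub, actF_yF, simple_self hn, simple_succ hn, h2, AlgHom.commutes,
      map_inv₀]
    rw [show (yF q (i + 1) - yF q i : RatFun K n) = -(yF q i - yF q (i + 1)) by ring]
    generalize actF q (simple n i) g = g1
    field_simp
    ring
  · obtain rfl : n = 1 := le_antisymm hn (NeZero.one_le)
    have h := yF_add_n (n := 1) hq i
    rw [Nat.cast_one] at h
    ext g
    rw [opT_of_one ht hq, h]
    simp only [Module.End.mul_apply, mulOp_apply, Module.algebraMap_end_apply, Algebra.smul_def]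
    ring

omit ht hq in
theorem opT_mul_Y_of_not_dvd {i j : ℤ} (h1 : ¬ (n : ℤ) ∣ j - i) (h2 : ¬ (n : ℤ) ∣ j - (i + 1)) :
    (opT q t i * mulOp (yF q j) : Module.End K (RatFun K n)) = mulOp (yF q j) * opT q t i := by
  ext g
  simp only [Module.End.mul_apply, mulOp_apply, opT_apply, map_mul, actF_yF,
    simple_of_not_dvd h1 h2]
  ring

/-- The images of the generators under the representation on rational functions. -/
def repGen (n : ℕ) [NeZero n] (q t : Kˣ) : Gen n → Module.End K (RatFun K n)
  | Gen.T i => opT q t (i.cast : ℤ)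
  | Gen.pi => permOp q (rot n)
  | Gen.piInv => permOp q (rot n)⁻¹
  | Gen.Y r => mulOp (yF q (rep r))
  | Gen.YInv r => mulOp (yF q (rep r))⁻¹

omit ht hq in
theorem lift_freeT (i : ℤ) : FreeAlgebra.lift K (repGen n q t) (freeT K n i) = opT q t i := by
  rw [freeT, FreeAlgebra.lift_ι_apply]
  apply opT_congr
  rw [← ZMod.intCast_eq_intCast_iff_dvd_sub, ZMod.intCast_zmod_cast]

omit ht hq in
theorem lift_freeY (i : ℤ) :
    FreeAlgebra.lift K (repGen n q t) (freeY q i) = mulOp (yF q i) := by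
  rw [freeY, extend_eq, map_smul, FreeAlgebra.lift_ι_apply, repGen, yF, yF, yL_rep, yL, extend_eq,
    map_smul, map_smul]

theorem repGen_rel {x y : FreeAlgebra K (Gen n)} (h : Rel n q t x y) :
    FreeAlgebra.lift K (repGen n q t) x = FreeAlgebra.lift K (repGen n q t) y := by
  have hy : ∀ r : Fin n, (yF q (rep r) : RatFun K n) ≠ 0 := fun r => yF_ne_zero _
  induction h with
  | quadratic i =>
    rw [map_mul, map_sub, map_add, lift_freeT, AlgHom.commutes, AlgHom.commutes, map_zero]
    exact opT_quadratic ht hq i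
  | braid i hn => simp only [map_mul, lift_freeT]; exact opT_braid ht hq hn i
  | comm i j hn h₁ h₂ =>
    simp only [map_mul, lift_freeT]
    exact opT_comm ht hq hn i j (by rwa [Int.modEq_comm, Int.modEq_iff_dvd] at h₁)
      (by rwa [Int.modEq_comm, Int.modEq_iff_dvd] at h₂)
  | pi_mul_piInv =>
    simp only [map_mul, FreeAlgebra.lift_ι_apply, repGen, map_one]
    exact permOp_mul_inv _
  | piInv_mul_pi =>
    simp only [map_mul, FreeAlgebra.lift_ι_apply, repGen, map_one]
    simpa using permOp_mul_inv (K := K) (q := q) (rot n)⁻¹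
  | pi_T i =>
    simp only [map_mul, FreeAlgebra.lift_ι_apply, repGen, lift_freeT]
    exact rot_mul_opT i
  | Y_mul_YInv i =>
    simp only [map_mul, FreeAlgebra.lift_ι_apply, repGen, map_one]
    rw [← map_mul, mul_inv_cancel₀ (hy i), map_one]
  | YInv_mul_Y i =>
    simp only [map_mul, FreeAlgebra.lift_ι_apply, repGen, map_one]
    rw [← map_mul, inv_mul_cancel₀ (hy i), map_one]
  | Y_comm i j =>
    simp only [map_mul, FreeAlgebra.lift_ι_apply, repGen]
    rw [← map_mul, ← map_mul, mul_comm]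
  | T_Y_T i => simp only [map_mul, lift_freeT, lift_freeY]; exact opT_mul_Y_mul_opT ht hq i
  | T_Y i j h₁ h₂ =>
    simp only [map_mul, lift_freeT, lift_freeY]
    exact opT_mul_Y_of_not_dvd (by rwa [Int.modEq_comm, Int.modEq_iff_dvd] at h₁)
      (by rwa [Int.modEq_comm, Int.modEq_iff_dvd] at h₂)
  | pi_Y i =>
    simp only [map_mul, FreeAlgebra.lift_ι_apply, repGen, lift_freeY]
    rw [permOp_mul_mulOp, actF_yF]
    rfl

/-- The representation of the double affine Hecke algebra on rational functions. -/
def rho (n : ℕ) [NeZero n] : DAHA n q t →ₐ[K] Module.End K (RatFun K n) :=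
  RingQuot.liftAlgHom K ⟨FreeAlgebra.lift K (repGen n q t), fun _ _ h => repGen_rel ht hq h⟩

theorem rho_ofFree (x : FreeAlgebra K (Gen n)) :
    rho ht hq n (ofFree q t x) = FreeAlgebra.lift K (repGen n q t) x :=
  RingQuot.liftAlgHom_mkAlgHom_apply K _ _ _

theorem rho_T (i : ℤ) : rho ht hq n (T q t i) = opT q t i := by
  rw [T, rho_ofFree, lift_freeT]

theorem rho_piU_zpow (k : ℤ) :
    rho ht hq n ((piU q t ^ k : (DAHA n q t)ˣ) : DAHA n q t) = permOp q (rot n ^ k) := by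
  have h1 : rho ht hq n (piU q t).val = permOp q (rot n) := by
    change rho ht hq n (ofFree q t _) = _
    rw [rho_ofFree, FreeAlgebra.lift_ι_apply]; rfl
  have h2 : rho ht hq n ((piU q t)⁻¹ : (DAHA n q t)ˣ).val = permOp q (rot n)⁻¹ := by
    change rho ht hq n (ofFree q t _) = _
    rw [rho_ofFree, FreeAlgebra.lift_ι_apply]; rfl
  induction k using Int.induction_on with
  | zero => simp
  | succ k ih => rw [zpow_add_one, zpow_add_one, Units.val_mul, map_mul, ih, h1, map_mul]
  | pred k ih => rw [zpow_sub_one, zpow_sub_one, Units.val_mul, map_mul, ih, h2, map_mul]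

theorem rho_incl (p : Laurent K n) : rho ht hq n (incl q t p) = mulOp (toF p) := by
  have : (rho ht hq n).comp (incl q t) = mulOp.comp toF := by
    refine laurent_algHom_ext fun r => ?_
    change rho ht hq n (incl q t (lY K r)) = mulOp (toF (lY K r))
    rw [← yL_rep (q := q), incl_yL, ← ofFree_freeY, rho_ofFree, lift_freeY]
    rfl
  exact congrArg (fun φ : Laurent K n →ₐ[K] Module.End K (RatFun K n) => φ p) this

theorem rho_f (i j : ℤ) : rho ht hq n (f q t i j) = mulOp (fF q t i j) := by
  rw [← incl_lf, rho_incl]; rfl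

theorem rho_Y (i : ℤ) : rho ht hq n (Y q t i) = mulOp (yF q i) := by
  rw [← incl_yL, rho_incl]; rfl

end Rep

/-! ### Leading coefficients -/

/-- The rational function `(Y_a - Y_b) / f_{a,b}`. -/
def invFactor (q t : Kˣ) (a b : ℤ) : RatFun K n := (yF q a - yF q b) / fF q t a b

theorem invFactor_shift (a b m : ℤ) :
    (invFactor q t (a + m * n) (b + m * n) : RatFun K n) = invFactor q t a b := by
  have hu : algebraMap K (RatFun K n) ((q ^ (-m) : Kˣ) : K) ≠ 0 :=
    (map_ne_zero _).mpr (Units.ne_zero _)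
  rw [invFactor, invFactor, fF_eq, fF_eq, yF_add_mul, yF_add_mul,
    ← mul_sub, mul_left_comm, mul_left_comm _ (algebraMap K (RatFun K n) ((q ^ (-m) : Kˣ) : K)),
    ← mul_sub, mul_div_mul_left _ _ hu]

/-- The coefficient of `T_w` in the normal ordering of `ν_w`: the product of
`(Y_a - Y_b) / f_{a,b}` over the inversions of `w`. -/
def lam (q t : Kˣ) (w : AffSym n) : RatFun K n := invProd (invFactor q t) w

theorem lam_mul_simple (hn : 1 < n) (w : AffSym n) {i : ℤ} (hw : w.1 i < w.1 (i + 1)) :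
    (lam q t (w * simple n i) : RatFun K n) =
      actF q (simple n i) (lam q t w) * invFactor q t i (i + 1) := by
  rw [lam, invProd_mul_simple hn invFactor_shift w hw, lam, invProd, invProd, map_prod]
  congr 1
  refine Finset.prod_congr rfl fun r _ => ?_
  rw [map_prod]
  refine Finset.prod_congr rfl fun b _ => ?_
  rw [invFactor, invFactor, map_div₀, map_sub, actF_fF, actF_yF, actF_yF]

theorem not_dvd_of_mem_invAt {w : AffSym n} {a b : ℤ} (h : b ∈ invAt w a) :
    ¬ (n : ℤ) ∣ b - a := by
  rw [mem_invAt] at h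
  rintro ⟨m, hm⟩
  obtain rfl : b = a + m * n := by linarith
  rw [apply_add_mul] at h
  linarith [h.1, h.2]

/-- Composition of affine permutations with multiplication operators,
`∑_x x ∘ g_x`. -/
def permSum (q : Kˣ) : (AffSym n →₀ RatFun K n) →ₗ[K] Module.End K (RatFun K n) :=
  Finsupp.lsum K fun x => (LinearMap.mulLeft K (permOp q x)).comp mulOp.toLinearMap

theorem permSum_single (x : AffSym n) (g : RatFun K n) :
    permSum q (Finsupp.single x g) = permOp q x * mulOp g := by
  simp [permSum]

theorem permSum_apply (g : AffSym n →₀ RatFun K n) :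
    permSum q g = ∑ x ∈ g.support, permOp q x * mulOp (g x) := by
  simp [permSum, Finsupp.sum]

/-- The span of the operators `y ∘ g` with `y` of length less than `m`. -/
def low (q : Kˣ) (m : ℕ) : Submodule K (Module.End K (RatFun K n)) :=
  Submodule.span K {X | ∃ (y : AffSym n) (g : RatFun K n),
    len y < m ∧ X = permOp q y * mulOp g}

theorem permOp_mul_mulOp_mem_low {y : AffSym n} {m : ℕ} (h : len y < m) (g : RatFun K n) :
    permOp q y * mulOp g ∈ low q m :=
  Submodule.subset_span ⟨y, g, h, rfl⟩

theorem low_mono {m m' : ℕ} (h : m ≤ m') : low (K := K) (n := n) q m ≤ low q m' := by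
  refine Submodule.span_mono ?_
  rintro _ ⟨y, p, hy, rfl⟩
  exact ⟨y, p, hy.trans_le h, rfl⟩

theorem low_mul_mulOp {m : ℕ} {X : Module.End K (RatFun K n)} (h : X ∈ low q m)
    (g : RatFun K n) : X * mulOp g ∈ low q m := by
  induction h using Submodule.span_induction with
  | mem x hx =>
    obtain ⟨y, p', hy, rfl⟩ := hx
    rw [mul_assoc, ← map_mul]
    exact permOp_mul_mulOp_mem_low hy _
  | zero => rw [zero_mul]; exact zero_mem _
  | add x y _ _ hx hy => rw [add_mul]; exact add_mem hx hy
  | smul c x _ hx => rw [smul_mul_assoc]; exact Submodule.smul_mem _ _ hx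

theorem opT_eq (i : ℤ) : (opT q t i : Module.End K (RatFun K n)) =
    permOp q (simple n i) * mulOp (eF q t i) +
      mulOp (algebraMap K _ (t : K) - eF q t i) := by
  rw [opT, map_sub, AlgHom.commutes, sub_mul, one_mul]
  abel

theorem permOp_mul_opT (y : AffSym n) (g : RatFun K n) (i : ℤ) :
    permOp q y * mulOp g * opT q t i =
      permOp q (y * simple n i) * mulOp (actF q (simple n i) g * eF q t i) +
        permOp q y * mulOp (g * (algebraMap K _ (t : K) - eF q t i)) := by
  rw [opT_eq, mul_add, mul_assoc, ← mul_assoc (mulOp g), mulOp_mul_permOp, simple_inv, map_mul,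
    map_mul, map_mul]
  simp only [mul_assoc]

theorem low_mul_opT (hn : 1 < n) {m : ℕ} {X : Module.End K (RatFun K n)} (h : X ∈ low q m)
    (i : ℤ) : X * opT q t i ∈ low q (m + 1) := by
  induction h using Submodule.span_induction with
  | mem x hx =>
    obtain ⟨y, p', hy, rfl⟩ := hx
    rw [permOp_mul_opT]
    have := len_mul_simple_le hn y i
    exact add_mem (permOp_mul_mulOp_mem_low (by omega) _) (permOp_mul_mulOp_mem_low (by omega) _)
  | zero => rw [zero_mul]; exact zero_mem _
  | add x y _ _ hx hy => rw [add_mul]; exact add_mem hx hy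
  | smul c x _ hx => rw [smul_mul_assoc]; exact Submodule.smul_mem _ _ hx

theorem exists_of_mem_low {m : ℕ} {X : Module.End K (RatFun K n)} (h : X ∈ low q m) :
    ∃ g : AffSym n →₀ RatFun K n, (∀ x, m ≤ len x → g x = 0) ∧ X = permSum q g := by
  classical
  induction h using Submodule.span_induction with
  | mem x hx =>
    obtain ⟨y, g, hy, rfl⟩ := hx
    refine ⟨Finsupp.single y g, fun x hx => ?_, (permSum_single y g).symm⟩
    rw [Finsupp.single_apply, if_neg]
    rintro rfl
    omega
  | zero => exact ⟨0, by simp, by simp⟩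
  | add x y _ _ hx hy =>
    obtain ⟨g, hg, rfl⟩ := hx
    obtain ⟨g', hg', rfl⟩ := hy
    refine ⟨g + g', fun x hx => ?_, (map_add _ _ _).symm⟩
    rw [Finsupp.add_apply, hg x hx, hg' x hx, add_zero]
  | smul c x _ hx =>
    obtain ⟨g, hg, rfl⟩ := hx
    refine ⟨c • g, fun x hx => ?_, (map_smul _ _ _).symm⟩
    rw [Finsupp.smul_apply, hg x hx, smul_zero]

section Indep

variable (ht : ∀ m : ℕ, 0 < m → t ^ m ≠ 1) (hq : q = t ^ (-2 : ℤ))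

include ht hq

/-- The affine permutations are independent over the rational functions, by Dedekind's theorem
on the independence of characters. -/
theorem permSum_injective : Function.Injective (permSum (K := K) (n := n) q) := by
  rw [injective_iff_map_eq_zero]
  intro g hg
  have hli := linearIndependent_monoidHom (RatFun K n) (RatFun K n)
  have hinj : Function.Injective fun x : AffSym n =>
      ((actF q x : RatFun K n →ₐ[K] RatFun K n) : RatFun K n →* RatFun K n) := by
    intro x y h
    apply actF_injective ht hq
    refine AlgHom.ext fun z => ?_
    exact DFunLike.congr_fun h z
  have h2 := linearIndependent_iff'.mp (hli.comp _ hinj) g.support (fun x => actF q x (g x)) (by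
    funext z
    have h3 := LinearMap.congr_fun hg z
    rw [permSum_apply] at h3
    simp only [LinearMap.sum_apply, Module.End.mul_apply, mulOp_apply, permOp_apply, map_mul] at h3
    simpa [Finset.sum_apply] using h3)
  ext x
  by_cases hx : x ∈ g.support
  · have h4 := h2 x hx
    rw [← actF_inv_apply (q := q) x (g x)]
    rw [h4]; simp
  · simpa using hx

theorem lam_ne_zero (w : AffSym n) : (lam q t w : RatFun K n) ≠ 0 := by
  rw [lam, invProd, Finset.prod_ne_zero_iff]
  intro r _
  rw [Finset.prod_ne_zero_iff]
  intro b hb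
  have h1 := not_dvd_of_mem_invAt hb
  refine div_ne_zero (yF_sub_ne_zero ht hq ?_) (fF_ne_zero ht hq ?_)
  · rintro h; rw [h] at h1; simp at h1
  · rintro h; rw [h] at h1; simp at h1

/-- The operators `T_x` are triangular with respect to the affine permutations. -/
theorem rho_TW_sub_mem_low (x : AffSym n) :
    rho ht hq n (TW q t x) - permOp q x * mulOp (lam q t x)⁻¹ ∈ low q (len x) := by
  have hrot : ∀ k : ℤ, len (rot n ^ k) = 0 →
      rho ht hq n (TW q t (rot n ^ k)) -
        permOp q (rot n ^ k) * mulOp (lam q t (rot n ^ k))⁻¹ = 0 := by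
    intro k hk
    have h1 : (lam q t (rot n ^ k) : RatFun K n) = 1 := by
      unfold lam invProd
      refine Finset.prod_eq_one fun r _ => Finset.prod_eq_one fun b hb => ?_
      rw [mem_invAt, rot_zpow_apply, rot_zpow_apply] at hb
      omega
    rw [TW_rot_zpow, rho_piU_zpow, h1, inv_one, map_one, mul_one, sub_self]
  rcases Nat.lt_or_ge 1 n with hn | hn
  · induction hm : len x using Nat.strong_induction_on generalizing x with
    | _ m ih =>
    by_cases h0 : len x = 0
    · have hx : x = rot n ^ (x.1 0) := by
        refine eq_rot_zpow_of_forall fun j => ?_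
        by_contra hc
        have hne : x.1 j ≠ x.1 (j + 1) := fun e => by have := x.1.injective e; omega
        have := len_mul_simple_of_gt hn x (i := j) (lt_of_le_of_ne (not_lt.mp hc) hne.symm)
        omega
      rw [hx] at h0 ⊢
      rw [hrot _ h0]
      exact zero_mem _
    · obtain ⟨j, hj⟩ := exists_descent h0
      have hl := len_mul_simple_of_gt hn x hj
      set y := x * simple n j with hy
      have hyj : y.1 j < y.1 (j + 1) := by
        change x.1 ((simple n j).1 j) < x.1 ((simple n j).1 (j + 1))
        rwa [simple_self hn, simple_succ hn]
      have hx : x = y * simple n j := (simple_mul_simple_cancel x j).symm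
      have h1 := low_mul_opT (t := t) hn (ih (len y) (by omega) y rfl) j
      have hT : TW q t x = TW q t y * T q t j := by rw [TW_mul_T hn hyj, ← hx]
      have hlam : (lam q t x : RatFun K n)⁻¹ =
          actF q (simple n j) (lam q t y)⁻¹ * eF q t j := by
        conv_lhs => rw [hx, lam_mul_simple hn y hyj]
        rw [mul_inv, map_inv₀, invFactor, eF, inv_div]
      have h2 : rho ht hq n (TW q t x) - permOp q x * mulOp (lam q t x)⁻¹ =
          (rho ht hq n (TW q t y) - permOp q y * mulOp (lam q t y)⁻¹) * opT q t j +
            permOp q y * mulOp ((lam q t y)⁻¹ * (algebraMap K _ (t : K) - eF q t j)) := by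
        rw [hT, sub_mul, permOp_mul_opT, ← hx, ← hlam, map_mul, rho_T]
        abel
      rw [h2]
      exact add_mem (low_mono (by omega) h1) (permOp_mul_mulOp_mem_low (by omega) _)
  · obtain rfl : n = 1 := le_antisymm hn (NeZero.one_le)
    rw [eq_rot_zpow_of_one x, hrot _ (len_rot_zpow _)]
    exact zero_mem _

/-- The operator `∑_x T_x g_x`. -/
def opSum (n : ℕ) [NeZero n] : (AffSym n →₀ RatFun K n) →ₗ[K] Module.End K (RatFun K n) :=
  Finsupp.lsum K fun x => (LinearMap.mulLeft K (rho ht hq n (TW q t x))).comp mulOp.toLinearMap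

theorem opSum_single (x : AffSym n) (g : RatFun K n) :
    opSum ht hq n (Finsupp.single x g) = rho ht hq n (TW q t x) * mulOp g := by
  simp [opSum]

theorem opSum_apply (g : AffSym n →₀ RatFun K n) :
    opSum ht hq n g = ∑ x ∈ g.support, rho ht hq n (TW q t x) * mulOp (g x) := by
  simp [opSum, Finsupp.sum]

/-- In top length, the coefficients with respect to the `T_x` and with respect to the affine
permutations differ by the factors `lam`. -/
theorem coeff_of_opSum_eq {g h : AffSym n →₀ RatFun K n} (e : opSum ht hq n g = permSum q h)
    (x : AffSym n) (hx : ∀ y, g y ≠ 0 → len y ≤ len x) : h x = (lam q t x)⁻¹ * g x := by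
  classical
  set g' : AffSym n →₀ RatFun K n := Finsupp.onFinset g.support
    (fun y => (lam q t y)⁻¹ * g y) (by
      intro y hy
      rw [Finsupp.mem_support_iff]
      exact right_ne_zero_of_mul hy) with hg'
  have hg'x : ∀ y, g' y = (lam q t y)⁻¹ * g y := fun y => rfl
  have h1 : opSum ht hq n g - permSum q g' ∈ low q (len x) := by
    have h2 : permSum q g' = ∑ y ∈ g.support, permOp q y * mulOp ((lam q t y)⁻¹ * g y) := by
      rw [permSum_apply]
      refine Finset.sum_subset Finsupp.support_onFinset_subset fun y _ hy => ?_
      rw [Finsupp.notMem_support_iff] at hy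
      rw [hy, map_zero, mul_zero]
    rw [opSum_apply, h2, ← Finset.sum_sub_distrib]
    refine Submodule.sum_mem _ fun y hy => ?_
    have h3 := low_mul_mulOp (rho_TW_sub_mem_low ht hq y) (g y)
    rw [sub_mul, mul_assoc (permOp q y), ← map_mul] at h3
    exact low_mono (hx y (by simpa using hy)) h3
  rw [e, ← map_sub] at h1
  obtain ⟨k, hk, hk'⟩ := exists_of_mem_low h1
  have h4 := DFunLike.congr_fun (permSum_injective ht hq hk') x
  rw [hk x le_rfl, Finsupp.sub_apply, sub_eq_zero] at h4
  rw [h4, hg'x]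

theorem exists_max_len {g : AffSym n →₀ RatFun K n} (hg : g ≠ 0) :
    ∃ x, g x ≠ 0 ∧ ∀ y, g y ≠ 0 → len y ≤ len x := by
  have hne : g.support.Nonempty := by rwa [Finsupp.support_nonempty_iff]
  obtain ⟨x, hx, hmax⟩ := Finset.exists_max_image g.support len hne
  exact ⟨x, by simpa using hx, fun y hy => hmax y (by simpa using hy)⟩

theorem opSum_injective : Function.Injective (opSum (K := K) ht hq n) := by
  rw [injective_iff_map_eq_zero]
  intro g hg
  by_contra hne
  obtain ⟨x, hx, hmax⟩ := exists_max_len ht hq hne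
  have h := coeff_of_opSum_eq ht hq (h := 0) (by rw [hg, map_zero]) x hmax
  rw [Finsupp.zero_apply, eq_comm, mul_eq_zero, inv_eq_zero] at h
  exact h.elim (lam_ne_zero ht hq x) hx

/-- If `w = ∑_x T_x g_x`, the coefficient of `T_w` is `lam w` and the other coefficients belong
to shorter affine permutations. -/
theorem coeff_of_opSum_eq_permOp {g : AffSym n →₀ RatFun K n} {w : AffSym n}
    (e : opSum ht hq n g = permOp q w) :
    g w = lam q t w ∧ ∀ x, x ≠ w → len w ≤ len x → g x = 0 := by
  classical
  have e' : opSum ht hq n g = permSum q (Finsupp.single w 1) := by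
    rw [e, permSum_single, map_one, mul_one]
  have hg : g ≠ 0 := by
    rintro rfl
    rw [map_zero, ← map_zero (permSum q)] at e'
    have := DFunLike.congr_fun (permSum_injective ht hq e') w
    simp at this
  obtain ⟨x₀, hx₀, hmax⟩ := exists_max_len ht hq hg
  have h0 := coeff_of_opSum_eq ht hq e' x₀ hmax
  have hwx : w = x₀ := by
    by_contra hne
    rw [Finsupp.single_eq_of_ne (Ne.symm hne), eq_comm, mul_eq_zero, inv_eq_zero] at h0
    exact h0.elim (lam_ne_zero ht hq _) hx₀
  subst hwx
  refine ⟨?_, fun x hxw hlen => ?_⟩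
  · rw [Finsupp.single_eq_same, eq_inv_mul_iff_mul_eq₀ (lam_ne_zero ht hq _), mul_one] at h0
    exact h0.symm
  · by_contra hx
    have h1 := coeff_of_opSum_eq ht hq e' x fun y hy => (hmax y hy).trans hlen
    rw [Finsupp.single_eq_of_ne hxw, eq_comm, mul_eq_zero, inv_eq_zero] at h1
    exact h1.elim (lam_ne_zero ht hq _) hx

/-! ### The localized algebra -/

theorem fF_pair_ne_zero (p : Pair n) : (fF q t p.1.1 p.1.2 : RatFun K n) ≠ 0 := by
  refine fF_ne_zero ht hq fun h => p.2 ?_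
  rw [h, Int.modEq_iff_dvd]
  simp

theorem toF_ne_zero_of_mem {s : Laurent K n} (hs : s ∈ fMonoid n q t) : toF s ≠ 0 := by
  induction hs using Submonoid.closure_induction with
  | mem x hx =>
    obtain ⟨p, rfl⟩ := hx
    exact fF_pair_ne_zero ht hq p
  | one => rw [map_one]; exact one_ne_zero
  | mul x y _ _ hx hy => rw [map_mul]; exact mul_ne_zero hx hy

/-- The localized Laurent polynomials as rational functions. -/
def locToF (n : ℕ) [NeZero n] : LaurentLoc n q t →+* RatFun K n :=
  IsLocalization.lift (M := fMonoid n q t) (g := (toF (K := K) (n := n)).toRingHom)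
    fun s => (toF_ne_zero_of_mem ht hq s.2).isUnit

theorem locToF_algebraMap (p : Laurent K n) :
    locToF ht hq n (algebraMap _ (LaurentLoc n q t) p) = toF p :=
  IsLocalization.lift_eq _ p

theorem locToF_mk (p : Laurent K n) (s : fMonoid n q t) :
    locToF ht hq n (Localization.mk p s) = toF p / toF s := by
  rw [eq_div_iff (toF_ne_zero_of_mem ht hq s.2), ← locToF_algebraMap ht hq p,
    ← locToF_algebraMap ht hq (s : Laurent K n), ← map_mul, Localization.mk_eq_mk',
    IsLocalization.mk'_spec]

theorem locToF_injective : Function.Injective (locToF (K := K) ht hq n) := by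
  rw [injective_iff_map_eq_zero]
  intro z hz
  induction z using Localization.induction_on with
  | H z =>
  obtain ⟨p, s⟩ := z
  rw [locToF_mk, div_eq_zero_iff] at hz
  have hp : p = 0 := toF_injective (by
    rw [map_zero]; exact hz.resolve_right (toF_ne_zero_of_mem ht hq s.2))
  rw [hp, Localization.mk_zero]

/-- The extension of the representation on rational functions to the localized algebra. -/
def rhoLoc (n : ℕ) [NeZero n] : DAHALoc n q t →ₐ[K] Module.End K (RatFun K n) :=
  RingQuot.liftAlgHom K ⟨FreeAlgebra.lift K
    (Sum.elim (rho ht hq n) fun p : Pair n => mulOp (fF q t p.1.1 p.1.2)⁻¹), by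
    intro x y h
    induction h with
    | add x y => simp only [map_add, FreeAlgebra.lift_ι_apply, Sum.elim_inl]
    | mul x y => simp only [map_mul, FreeAlgebra.lift_ι_apply, Sum.elim_inl]
    | scalar c =>
      simp only [FreeAlgebra.lift_ι_apply, Sum.elim_inl, AlgHom.commutes]
    | mul_inv p =>
      simp only [map_mul, FreeAlgebra.lift_ι_apply, Sum.elim_inl, Sum.elim_inr, rho_f, map_one]
      rw [← map_mul, mul_inv_cancel₀ (fF_pair_ne_zero ht hq p), map_one]
    | inv_mul p =>
      simp only [map_mul, FreeAlgebra.lift_ι_apply, Sum.elim_inl, Sum.elim_inr, rho_f, map_one]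
      rw [← map_mul, inv_mul_cancel₀ (fF_pair_ne_zero ht hq p), map_one]⟩

theorem rhoLoc_toLoc (h : DAHA n q t) : rhoLoc ht hq n (toLoc q t h) = rho ht hq n h := by
  change rhoLoc ht hq n (ofFreeLoc q t _) = _
  refine (RingQuot.liftAlgHom_mkAlgHom_apply K _ _ _).trans ?_
  rw [FreeAlgebra.lift_ι_apply, Sum.elim_inl]

omit ht hq in
theorem inclLoc_algebraMap (p : Laurent K n) :
    inclLoc n q t (algebraMap _ _ p) = toLoc q t (incl q t p) :=
  OreLocalization.universalHom_commutes _ _ _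

theorem rhoLoc_inclLoc (g : LaurentLoc n q t) :
    rhoLoc ht hq n (inclLoc n q t g) = mulOp (locToF ht hq n g) := by
  have : ((rhoLoc ht hq n).toRingHom.comp (inclLoc n q t)) =
      (mulOp (K := K) (n := n)).toRingHom.comp (locToF ht hq n) := by
    apply IsLocalization.ringHom_ext (fMonoid n q t)
    refine RingHom.ext fun p => ?_
    change rhoLoc ht hq n (inclLoc n q t (algebraMap _ _ p)) =
      mulOp (locToF ht hq n (algebraMap _ _ p))
    rw [inclLoc_algebraMap, rhoLoc_toLoc, rho_incl, locToF_algebraMap]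
  exact congrArg (fun φ : LaurentLoc n q t →+* Module.End K (RatFun K n) => φ g) this

omit ht hq in
/-- The element `∑_x T_x g_x` of the localized algebra. -/
def locSum (n : ℕ) [NeZero n] (q t : Kˣ) : (AffSym n →₀ LaurentLoc n q t) →+ DAHALoc n q t :=
  Finsupp.liftAddHom fun x => (AddMonoidHom.mulLeft (toLoc q t (TW q t x))).comp
    (inclLoc n q t : LaurentLoc n q t →+ DAHALoc n q t)

omit ht hq in
theorem locSum_single (x : AffSym n) (g : LaurentLoc n q t) :
    locSum n q t (Finsupp.single x g) = toLoc q t (TW q t x) * inclLoc n q t g := by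
  simp [locSum]

omit ht hq in
theorem isNormalOrdering_iff (h : DAHALoc n q t) (g : AffSym n →₀ LaurentLoc n q t) :
    IsNormalOrdering h g ↔ h = locSum n q t g := by
  rw [IsNormalOrdering]
  simp [locSum, Finsupp.sum]

theorem rhoLoc_locSum (g : AffSym n →₀ LaurentLoc n q t) :
    rhoLoc ht hq n (locSum n q t g) =
      opSum ht hq n (g.mapRange (locToF ht hq n) (map_zero _)) := by
  induction g using Finsupp.induction_linear with
  | zero => simp
  | add g g' hg hg' =>
    rw [map_add, map_add, hg, hg', Finsupp.mapRange_add (map_add _), map_add]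
  | single x a =>
    rw [locSum_single, Finsupp.mapRange_single, opSum_single, map_mul, rhoLoc_toLoc,
      rhoLoc_inclLoc]

theorem rhoLoc_locSum_injective :
    Function.Injective fun g => rhoLoc (K := K) ht hq n (locSum n q t g) := by
  intro g g' h
  simp only [rhoLoc_locSum] at h
  have h1 := opSum_injective ht hq h
  ext x
  have h2 := DFunLike.congr_fun h1 x
  exact locToF_injective ht hq h2

theorem exists_inclLoc_mul_T (g : LaurentLoc n q t) (i : ℤ) : ∃ g₁ g₂ : LaurentLoc n q t,
    inclLoc n q t g * toLoc q t (T q t i) =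
      toLoc q t (T q t i) * inclLoc n q t g₁ + inclLoc n q t g₂ := by
  induction g using Localization.induction_on with
  | H z =>
  obtain ⟨p, s⟩ := z
  obtain ⟨p', hp⟩ := exists_incl_mul_T ht hq i p
  obtain ⟨s', hs⟩ := exists_incl_mul_T ht hq i (s : Laurent K n)
  set τ := toLoc q t (T (n := n) q t i)
  set j := inclLoc n q t with hj
  set a := algebraMap (Laurent K n) (LaurentLoc n q t) with ha
  have hp' : j (a p) * τ = τ * j (a (act q (simple n i) p)) + j (a p') := by
    have := congrArg (toLoc q t) hp
    simpa only [map_mul, map_add, ← inclLoc_algebraMap] using this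
  have hs' : j (a s) * τ = τ * j (a (act q (simple n i) s)) + j (a s') := by
    have := congrArg (toLoc q t) hs
    simpa only [map_mul, map_add, ← inclLoc_algebraMap] using this
  set u : LaurentLoc n q t := Localization.mk 1 s with hu
  set u' : LaurentLoc n q t := Localization.mk 1 ⟨_, act_fMonoid (simple n i) s.2⟩ with hu'
  have e1 : j u * j (a s) = 1 := by
    rw [← map_mul, hu, Localization.mk_eq_mk', IsLocalization.mk'_spec, map_one, map_one]
  have e2 : j (a (act q (simple n i) s)) * j u' = 1 := by
    rw [← map_mul, mul_comm, hu', Localization.mk_eq_mk']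
    erw [IsLocalization.mk'_spec (LaurentLoc n q t) 1
      (⟨_, act_fMonoid (simple n i) s.2⟩ : fMonoid n q t)]
    rw [map_one, map_one]
  have e3 : (Localization.mk p s : LaurentLoc n q t) = a p * u := by
    rw [hu, Localization.mk_eq_mk']
    exact IsLocalization.mk'_eq_mul_mk'_one p s
  have hu2 : j u * τ = τ * j u' - j (u * a s' * u') := by
    have h1 := congrArg (fun z => j u * z * j u') hs'
    simp only [mul_add, add_mul] at h1
    rw [← mul_assoc (j u), e1, one_mul, mul_assoc (j u), mul_assoc τ, e2, mul_one] at h1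
    rw [h1, map_mul, map_mul]
    abel
  refine ⟨a (act q (simple n i) p) * u', a p' * u' - a p * (u * a s' * u'), ?_⟩
  rw [e3, map_mul, mul_assoc, hu2, mul_sub, ← mul_assoc, hp', add_mul]
  simp only [map_sub, map_mul, mul_assoc]
  abel

/-- Every element of the localized algebra has a normal ordering. -/
theorem locSum_surjective : Function.Surjective (locSum (K := K) n q t) := by
  set S : Submodule K (DAHALoc n q t) := Submodule.span K
    (Set.range fun y : AffSym n × LaurentLoc n q t =>
      toLoc q t (TW q t y.1) * inclLoc n q t y.2) with hS
  have hmem : ∀ x g, toLoc q t (TW q t x) * inclLoc n q t g ∈ S := fun x g =>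
    Submodule.subset_span ⟨(x, g), rfl⟩
  have ind : ∀ a : DAHALoc n q t,
      (∀ y g, toLoc q t (TW q t y) * inclLoc n q t g * a ∈ S) → ∀ s ∈ S, s * a ∈ S := by
    intro a ha s hs
    induction hs using Submodule.span_induction with
    | mem x hx =>
      obtain ⟨⟨y, p⟩, rfl⟩ := hx
      exact ha y p
    | zero => rw [zero_mul]; exact zero_mem _
    | add x y _ _ hx hy => rw [add_mul]; exact add_mem hx hy
    | smul c x _ hx => rw [smul_mul_assoc]; exact Submodule.smul_mem _ _ hx
  have hincl : ∀ s ∈ S, ∀ g, s * inclLoc n q t g ∈ S := by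
    intro s hs g
    refine ind _ (fun y g' => ?_) s hs
    rw [mul_assoc, ← map_mul]
    exact hmem _ _
  have hfilt : ∀ m, ∀ h ∈ filt q t m, toLoc q t h ∈ S := by
    intro m h hh
    induction hh using Submodule.span_induction with
    | mem x hx =>
      obtain ⟨y, p, -, rfl⟩ := hx
      rw [map_mul, ← inclLoc_algebraMap]
      exact hmem _ _
    | zero => rw [map_zero]; exact zero_mem _
    | add x y _ _ hx hy => rw [map_add]; exact add_mem hx hy
    | smul c x _ hx => rw [map_smul]; exact Submodule.smul_mem _ _ hx
  have hT : ∀ s ∈ S, ∀ i, s * toLoc q t (T q t i) ∈ S := by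
    intro s hs i
    refine ind _ (fun y g => ?_) s hs
    obtain ⟨g₁, g₂, hg⟩ := exists_inclLoc_mul_T ht hq g i
    rw [mul_assoc, hg, mul_add, ← mul_assoc, ← map_mul]
    exact add_mem (hincl _ (hfilt _ _ (TW_mul_T_mem_filt ht hq y i)) _) (hmem _ _)
  have hpi : ∀ s ∈ S, ∀ k : ℤ,
      s * toLoc q t ((piU q t ^ k : (DAHA n q t)ˣ) : DAHA n q t) ∈ S := by
    intro s hs k
    refine ind _ (fun y g => ?_) s hs
    induction g using Localization.induction_on with
    | H z =>
    obtain ⟨p, s⟩ := z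
    set P := toLoc q t ((piU q t ^ k : (DAHA n q t)ˣ) : DAHA n q t) with hP
    have hp : ∀ p : Laurent K n, inclLoc n q t (algebraMap _ _ p) * P =
        P * inclLoc n q t (algebraMap _ _ (act q (rot n ^ (-k)) p)) := by
      intro p
      rw [inclLoc_algebraMap, inclLoc_algebraMap, hP, ← map_mul, ← map_mul, incl_mul_piU_zpow]
    have e1 : inclLoc n q t (Localization.mk p s) * inclLoc n q t (algebraMap _ _ (s : Laurent K n)) =
        inclLoc n q t (algebraMap _ _ p) := by
      rw [← map_mul, Localization.mk_eq_mk', IsLocalization.mk'_spec]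
    set s' : fMonoid n q t := ⟨_, act_fMonoid (rot n ^ (-k)) s.2⟩ with hs'
    have e2 : inclLoc n q t (algebraMap _ _ (act q (rot n ^ (-k)) (s : Laurent K n))) *
        inclLoc n q t (Localization.mk 1 s') = 1 := by
      rw [← map_mul, mul_comm, Localization.mk_eq_mk']
      erw [IsLocalization.mk'_spec (LaurentLoc n q t) 1 s']
      rw [map_one, map_one]
    have e3 : inclLoc n q t (Localization.mk p s) * P =
        P * (inclLoc n q t (algebraMap _ _ (act q (rot n ^ (-k)) p)) *
          inclLoc n q t (Localization.mk 1 s')) := by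
      rw [← mul_assoc, ← hp, ← e1, mul_assoc (inclLoc n q t _) _ P, hp, mul_assoc, mul_assoc, e2,
        mul_one]
    rw [mul_assoc, e3, ← mul_assoc, hP, ← map_mul, TW_mul_piU_zpow, ← map_mul]
    exact hmem _ _
  have hH : ∀ h : DAHA n q t, ∀ s ∈ S, s * toLoc q t h ∈ S := by
    set S' : Submodule K (DAHA n q t) :=
      { carrier := {h | ∀ s ∈ S, s * toLoc q t h ∈ S}
        add_mem' := fun ha hb s hs => by rw [map_add, mul_add]; exact add_mem (ha s hs) (hb s hs)
        zero_mem' := fun s _ => by rw [map_zero, mul_zero]; exact zero_mem _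
        smul_mem' := fun c x hx s hs => by
          rw [map_smul, mul_smul_comm]; exact S.smul_mem _ (hx s hs) } with hS'
    have : S' = ⊤ := by
      apply eq_top_of_right_stable
      · intro s hs
        rwa [map_one, mul_one]
      · intro h hh i s hs
        rw [map_mul, ← mul_assoc]
        exact hT _ (hh s hs) i
      · intro h hh k s hs
        rw [map_mul, ← mul_assoc]
        exact hpi _ (hh s hs) k
      · intro h hh p s hs
        rw [map_mul, ← mul_assoc, ← inclLoc_algebraMap]
        exact hincl _ (hh s hs) _
    intro h
    have hmem : h ∈ S' := by rw [this]; trivial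
    exact hmem
  have hinv : ∀ p : Pair n, ∀ s ∈ S, s * ofFreeLoc q t (FreeAlgebra.ι K (Sum.inr p)) ∈ S := by
    intro p s hs
    have e : ofFreeLoc q t (FreeAlgebra.ι K (Sum.inr p)) = inclLoc n q t (Localization.mk 1
        ⟨lf q t p.1.1 p.1.2, Submonoid.subset_closure ⟨p, rfl⟩⟩) := by
      have h1 : ofFreeLoc q t (FreeAlgebra.ι K (Sum.inr p)) * toLoc q t (f q t p.1.1 p.1.2) = 1 := by
        change _ * ofFreeLoc q t (FreeAlgebra.ι K (Sum.inl (f q t p.1.1 p.1.2))) = 1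
        rw [← map_mul, ofFreeLoc_rel (LocRel.inv_mul p), map_one]
      refine left_inv_eq_right_inv h1 ?_
      rw [← incl_lf, ← inclLoc_algebraMap, ← map_mul, mul_comm, Localization.mk_eq_mk']
      erw [IsLocalization.mk'_spec (LaurentLoc n q t) 1
        (⟨lf q t p.1.1 p.1.2, Submonoid.subset_closure ⟨p, rfl⟩⟩ : fMonoid n q t)]
      rw [map_one, map_one]
    rw [e]
    exact hincl s hs _
  have htop : ∀ z : FreeAlgebra K (DAHA n q t ⊕ Pair n), ∀ s ∈ S, s * ofFreeLoc q t z ∈ S := by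
    intro z
    induction z using FreeAlgebra.induction with
    | grade0 c =>
      intro s hs
      rw [AlgHom.commutes, ← Algebra.commutes, ← Algebra.smul_def]
      exact S.smul_mem _ hs
    | grade1 g =>
      cases g with
      | inl h => exact hH h
      | inr p => exact hinv p
    | mul x y hx hy =>
      intro s hs
      rw [map_mul, ← mul_assoc]
      exact hy _ (hx s hs)
    | add x y hx hy =>
      intro s hs
      rw [map_add, mul_add]
      exact add_mem (hx s hs) (hy s hs)
  intro h
  have hh : h ∈ S := by
    obtain ⟨z, rfl⟩ := RingQuot.mkAlgHom_surjective K (LocRel n q t) h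
    have h1 : (1 : DAHALoc n q t) ∈ S := by
      have := hmem 1 1
      rwa [TW_one, map_one, map_one, mul_one] at this
    have := htop z 1 h1
    rwa [one_mul] at this
  induction hh using Submodule.span_induction with
  | mem x hx =>
    obtain ⟨⟨y, g⟩, rfl⟩ := hx
    exact ⟨Finsupp.single y g, locSum_single y g⟩
  | zero => exact ⟨0, map_zero _⟩
  | add x y _ _ hx hy =>
    obtain ⟨g, rfl⟩ := hx
    obtain ⟨g', rfl⟩ := hy
    exact ⟨g + g', map_add _ _ _⟩
  | smul c x hx' hx =>
    obtain ⟨g, rfl⟩ := hx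
    clear hx'
    refine ⟨algebraMap (Laurent K n) (LaurentLoc n q t) (algebraMap K _ c) • g, ?_⟩
    induction g using Finsupp.induction_linear with
    | zero => simp
    | add g g' hg hg' => rw [smul_add, map_add, map_add, smul_add, hg, hg']
    | single x a =>
      rw [Finsupp.smul_single, locSum_single, locSum_single, smul_eq_mul, map_mul,
        inclLoc_algebraMap, AlgHom.commutes, AlgHom.commutes, ← mul_assoc, ← Algebra.commutes,
        Algebra.smul_def, mul_assoc]

theorem rho_phi (i : ℤ) : rho ht hq n (phi q t i) =
    permOp q (simple n i) * mulOp (fF q t i (i + 1)) := by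
  have h1 : (yF q i - yF q (i + 1) : RatFun K n) ≠ 0 := yF_sub_ne_zero ht hq (by omega)
  have h2 : (algebraMap K _ (t : K) - eF q t i) * (yF q i - yF q (i + 1)) +
      ((t : K) - ((t⁻¹ : Kˣ) : K)) • yF q (i + 1) = (0 : RatFun K n) := by
    rw [sub_mul, eF, div_mul_cancel₀ _ h1, Algebra.smul_def, fF_eq, map_sub,
      Units.val_inv_eq_inv_val, map_inv₀]
    ring
  rw [phi_eq, map_add, map_mul, map_sub, map_smul, rho_T, rho_Y, rho_Y, ← map_sub, ← map_smul,
    opT_eq, add_mul, mul_assoc, ← map_mul, ← map_mul, add_assoc, ← map_add, h2, map_zero, add_zero,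
    eF, div_mul_cancel₀ _ h1]

theorem rhoLoc_nuW (w : AffSym n) : rhoLoc ht hq n (nuW q t w) = permOp q w := by
  rcases Nat.lt_or_ge 1 n with hn | hn
  · have hnu : ∀ i, rhoLoc ht hq n (nu q t i) = permOp q (simple n i) := by
      intro i
      have hp : ¬ i ≡ i + 1 [ZMOD n] := by
        rw [Int.modEq_iff_dvd, show i + 1 - i = 1 by ring]
        intro h
        have := Int.le_of_dvd one_pos h
        omega
      obtain ⟨u, hu⟩ := isUnit_f (q := q) (t := t) ⟨(i, i + 1), hp⟩
      simp only at hu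
      have h1 : rhoLoc ht hq n (u : DAHALoc n q t) = mulOp (fF q t i (i + 1)) := by
        rw [hu, rhoLoc_toLoc, rho_f]
      have h2 : mulOp (fF q t i (i + 1)) * rhoLoc ht hq n ((u⁻¹ : (DAHALoc n q t)ˣ) : DAHALoc n q t)
          = 1 := by
        rw [← h1, ← map_mul, Units.mul_inv, map_one]
      rw [nu, ← hu, Ring.inverse_unit, map_mul, rhoLoc_toLoc, rho_phi, mul_assoc, h2, mul_one]
    obtain ⟨h1, h2⟩ := reducedExpr_spec hn w
    conv_rhs => rw [h1]
    rw [nuW, map_mul, rhoLoc_toLoc, rho_piU_zpow, wordPerm, map_mul, map_list_prod, map_list_prod,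
      List.map_map, List.map_map]
    congr 3
    funext i
    exact hnu i
  · obtain rfl : n = 1 := le_antisymm hn (NeZero.one_le)
    rw [nuW, reducedExpr_one, map_mul, rhoLoc_toLoc, rho_piU_zpow]
    simp only [List.map_nil, List.prod_nil, map_one, mul_one]
    rw [← eq_rot_zpow_of_one]

end Indep

/-! ### Levels -/

/-- The exponent of `q` in the value of `Y_i` at `q ^ ρ`. -/
def level (n : ℕ) [NeZero n] (i : ℤ) : ℤ := ((residue n i : ℕ) : ℤ) - wind n i

theorem level_rep_add (r : Fin n) (m : ℤ) : level n (rep r + m * n) = ((r : ℕ) : ℤ) - m := by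
  obtain ⟨h1, h2⟩ := residue_wind_of_eq (n := n) (i := rep r + m * n) rfl
  rw [level, h1, h2]

theorem level_add_mul (i m : ℤ) : level n (i + m * n) = level n i - m := by
  obtain ⟨h1, h2⟩ := residue_wind_add_mul (n := n) i m
  rw [level, level, h1, h2]
  ring

theorem gam_apply (i : ℤ) : (gam n).1 i = rep (residue n i) + -level n i * n := by
  have h : (gam n).1 i = i + n * -((residue n i : ℕ) : ℤ) := rfl
  have h1 := eq_rep_add (n := n) i
  rw [h, level]
  linear_combination h1

theorem gam_inv_apply (r : Fin n) (m : ℤ) :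
    ((gam n)⁻¹).1 (rep r + m * n) = rep r + (((r : ℕ) : ℤ) + m) * n := by
  have h : (gam n).1 (rep r + (((r : ℕ) : ℤ) + m) * n) = rep r + m * n := by
    rw [gam_apply, level_rep_add, (residue_wind_of_eq rfl).1]
    ring
  rw [← h]
  exact (gam n).1.symm_apply_apply _

/-- The stabilizer of the levels, which is the stabilizer of `q ^ ρ`. -/
def levelStab (n : ℕ) [NeZero n] : Subgroup (AffSym n) where
  carrier := {w | ∀ i, level n (w.1 i) = level n i}
  mul_mem' := fun {a b} ha hb i => (ha _).trans (hb i)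
  one_mem' := fun _ => rfl
  inv_mem' := fun {a} ha i => by
    have h := ha ((a⁻¹).1 i)
    rw [← h]
    exact congrArg _ (a.1.apply_symm_apply i)

theorem finiteSym_rep_add (σ : Equiv.Perm (Fin n)) (r : Fin n) (m : ℤ) :
    (finiteSym σ).1 (rep r + m * n) = rep (σ r) + m * n := by
  have h : ∀ i, (finiteSym σ).1 i =
    (Int.divModEquiv n).symm (wind n i, σ (residue n i)) + 1 := fun _ => rfl
  obtain ⟨h1, h2⟩ := residue_wind_of_eq (n := n) (i := rep r + m * n) rfl
  rw [h, h1, h2, Int.divModEquiv_symm_apply, rep]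
  ring

theorem finiteSym_rep (σ : Equiv.Perm (Fin n)) (r : Fin n) :
    (finiteSym σ).1 (rep r) = rep (σ r) := by
  simpa using finiteSym_rep_add σ r 0

/-- The embedding `σ ↦ γ⁻¹ σ γ` of the finite symmetric group. -/
def conjSym (n : ℕ) [NeZero n] : Equiv.Perm (Fin n) →* AffSym n where
  toFun σ := (gam n)⁻¹ * finiteSym σ * gam n
  map_one' := by
    have h : finiteSym (1 : Equiv.Perm (Fin n)) = 1 := ext_rep fun r => finiteSym_rep 1 r
    rw [h]; group
  map_mul' σ τ := by
    have h : finiteSym (σ * τ) = finiteSym σ * finiteSym τ := ext_rep fun r => by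
      rw [finiteSym_rep]
      change _ = (finiteSym σ).1 ((finiteSym τ).1 (rep r))
      rw [finiteSym_rep, finiteSym_rep]
      rfl
    rw [h]; group

theorem conjSym_eq (σ : Equiv.Perm (Fin n)) :
    conjSym n σ = (gam n)⁻¹ * finiteSym σ * gam n := rfl

theorem conjSym_apply (σ : Equiv.Perm (Fin n)) (r : Fin n) (m : ℤ) :
    (conjSym n σ).1 (rep r + (((r : ℕ) : ℤ) + m) * n) =
      rep (σ r) + (((σ r : ℕ) : ℤ) + m) * n := by
  have h : (conjSym n σ).1 (rep r + (((r : ℕ) : ℤ) + m) * n) =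
    ((gam n)⁻¹).1 ((finiteSym σ).1 ((gam n).1 (rep r + (((r : ℕ) : ℤ) + m) * n))) := rfl
  rw [h, gam_apply, level_rep_add, (residue_wind_of_eq rfl).1,
    show -(((r : ℕ) : ℤ) - (((r : ℕ) : ℤ) + m)) = m by ring, finiteSym_rep_add, gam_inv_apply]

theorem eq_rep_add_level (i : ℤ) :
    i = rep (residue n i) + (((residue n i : ℕ) : ℤ) + -level n i) * n := by
  nth_rewrite 1 [eq_rep_add (n := n) i]
  rw [level]
  ring

theorem conjSym_injective : Function.Injective (conjSym n) := by
  intro σ τ h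
  ext r
  have h1 : (conjSym n σ).1 _ = (conjSym n τ).1 _ :=
    congrArg (fun w : AffSym n => w.1 (rep r + (((r : ℕ) : ℤ) + 0) * n)) h
  rw [conjSym_apply, conjSym_apply] at h1
  have h2 := congrArg (residue n) h1
  rw [(residue_wind_of_eq rfl).1, (residue_wind_of_eq rfl).1] at h2
  rw [h2]

/-- The stabilizer of `q ^ ρ` is the conjugate by `γ` of the finite symmetric group. -/
theorem mem_levelStab_iff {w : AffSym n} : w ∈ levelStab n ↔ ∃ σ, conjSym n σ = w := by
  constructor
  · intro hw
    refine ⟨residuePerm w, Subtype.ext (Equiv.ext fun i => ?_)⟩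
    have h1 : residue n (w.1 i) = residuePerm w (residue n i) := by
      conv_lhs => rw [eq_rep_add (n := n) i, apply_add_mul]
      exact (residue_wind_add_mul _ _).1
    conv_lhs => rw [eq_rep_add_level (n := n) i, conjSym_apply, ← h1, ← hw i]
    exact (eq_rep_add_level (w.1 i)).symm
  · rintro ⟨σ, rfl⟩ i
    conv_lhs => rw [eq_rep_add_level (n := n) i, conjSym_apply, level_rep_add]
    ring

theorem conjSym_mem (σ : Equiv.Perm (Fin n)) : conjSym n σ ∈ levelStab n :=
  mem_levelStab_iff.mpr ⟨σ, rfl⟩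

/-! ### Rational functions without a pole at `q ^ ρ` -/

/-- Evaluation at `q ^ ρ`. -/
def evalRho (q : Kˣ) : Laurent K n →ₐ[K] K := evalAt (qRho n q)

theorem evalRho_yL (i : ℤ) : evalRho q (yL q i : Laurent K n) = ((q ^ level n i : Kˣ) : K) := by
  rw [yL, extend_eq, map_smul, evalRho, evalAt, laurentLift_lY, qRho, smul_eq_mul, ← Units.val_mul,
    ← zpow_natCast, ← zpow_add, level]
  congr 2
  ring

theorem evalRho_act {w : AffSym n} (hw : w ∈ levelStab n) (p : Laurent K n) :
    evalRho q (act q w p) = evalRho q p := by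
  have : (evalRho q).comp (act q w) = (evalRho q : Laurent K n →ₐ[K] K) := by
    refine laurent_algHom_ext fun r => ?_
    rw [AlgHom.comp_apply, ← yL_rep (q := q), act_yL, evalRho_yL, evalRho_yL, hw]
  exact DFunLike.congr_fun this p

/-- `g` has a denominator that does not vanish at `q ^ ρ`, and its value there is `c`. -/
def Germ (q t : Kˣ) (g : RatFun K n) (c : K) : Prop :=
  ∃ p s : Laurent K n, s ∈ fMonoid n q t ∧ evalRho q s ≠ 0 ∧ g = toF p / toF s ∧
    c = evalRho q p / evalRho q s

theorem toF_ne_zero {s : Laurent K n} (h : evalRho q s ≠ 0) : toF s ≠ 0 := by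
  intro e
  rw [toF_injective (e.trans (map_zero _).symm), map_zero] at h
  exact h rfl

namespace Germ

variable {g g' : RatFun K n} {c c' : K}

theorem toF (p : Laurent K n) : Germ q t (GLDaha.toF p) (evalRho q p) :=
  ⟨p, 1, one_mem _, by simp, by simp, by simp⟩

theorem algebraMap (c : K) : Germ q t (algebraMap K (RatFun K n) c) c := by
  have := Germ.toF (q := q) (t := t) (n := n) (Algebra.algebraMap K _ c)
  rwa [AlgHom.commutes, AlgHom.commutes] at this

theorem one : Germ q t (1 : RatFun K n) 1 := by simpa using Germ.algebraMap (n := n) (q := q) (t := t) (1 : K)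

theorem zero : Germ q t (0 : RatFun K n) 0 := by simpa using Germ.algebraMap (n := n) (q := q) (t := t) (0 : K)

theorem mul (h : Germ q t g c) (h' : Germ q t g' c') : Germ q t (g * g') (c * c') := by
  obtain ⟨p, s, hs, hs0, rfl, rfl⟩ := h
  obtain ⟨p', s', hs', hs0', rfl, rfl⟩ := h'
  refine ⟨p * p', s * s', mul_mem hs hs', ?_, ?_, ?_⟩
  · rw [map_mul]; exact mul_ne_zero hs0 hs0'
  · rw [map_mul, map_mul, div_mul_div_comm]
  · rw [map_mul, map_mul, div_mul_div_comm]

theorem add (h : Germ q t g c) (h' : Germ q t g' c') : Germ q t (g + g') (c + c') := by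
  obtain ⟨p, s, hs, hs0, rfl, rfl⟩ := h
  obtain ⟨p', s', hs', hs0', rfl, rfl⟩ := h'
  refine ⟨p * s' + s * p', s * s', mul_mem hs hs', ?_, ?_, ?_⟩
  · rw [map_mul]; exact mul_ne_zero hs0 hs0'
  · simp only [map_mul, map_add]
    exact div_add_div _ _ (toF_ne_zero hs0) (toF_ne_zero hs0')
  · simp only [map_mul, map_add]
    exact div_add_div _ _ hs0 hs0'

theorem smul (a : K) (h : Germ q t g c) : Germ q t (a • g) (a * c) := by
  rw [Algebra.smul_def]
  exact (Germ.algebraMap a).mul h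

theorem unique (h : Germ q t g c) (h' : Germ q t g c') : c = c' := by
  obtain ⟨p, s, hs, hs0, rfl, rfl⟩ := h
  obtain ⟨p', s', hs', hs0', e, rfl⟩ := h'
  rw [div_eq_div_iff (toF_ne_zero hs0) (toF_ne_zero hs0'), ← map_mul, ← map_mul] at e
  rw [div_eq_div_iff hs0 hs0', ← map_mul, ← map_mul, toF_injective e]

theorem actF {w : AffSym n} (hw : w ∈ levelStab n) (h : Germ q t g c) :
    Germ q t (actF q w g) c := by
  obtain ⟨p, s, hs, hs0, rfl, rfl⟩ := h
  refine ⟨act q w p, act q w s, act_fMonoid w hs, ?_, ?_, ?_⟩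
  · rwa [evalRho_act hw]
  · rw [map_div₀, actF_toF, actF_toF]
  · rw [evalRho_act hw, evalRho_act hw]

end Germ

/-- `g` has no pole at `q ^ ρ`. -/
def IsReg (q t : Kˣ) (g : RatFun K n) : Prop := ∃ c, Germ q t g c

namespace IsReg

variable {g g' : RatFun K n}

theorem toF (p : Laurent K n) : IsReg q t (GLDaha.toF p) := ⟨_, .toF p⟩

theorem algebraMap (c : K) : IsReg q t (algebraMap K (RatFun K n) c) := ⟨_, .algebraMap c⟩

theorem mul (h : IsReg q t g) (h' : IsReg q t g') : IsReg q t (g * g') :=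
  ⟨_, h.choose_spec.mul h'.choose_spec⟩

theorem actF {w : AffSym n} (hw : w ∈ levelStab n) (h : IsReg q t g) :
    IsReg q t (actF q w g) := ⟨_, h.choose_spec.actF hw⟩

theorem prod {ι : Type*} (s : Finset ι) (g : ι → RatFun K n) (h : ∀ i ∈ s, IsReg q t (g i)) :
    IsReg q t (∏ i ∈ s, g i) :=
  Finset.prod_induction _ (IsReg q t) (fun _ _ => mul) ⟨1, .one⟩ h

/-- A divided difference for a reflection that fixes `q ^ ρ` creates no pole there. -/
theorem divided_difference {v : AffSym n} (hv : v ∈ levelStab n) {A B : ℤ} (hAB : v.1 A = B)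
    (hBA : v.1 B = A) (hfix : ∀ z, ¬ (n : ℤ) ∣ z - A → ¬ (n : ℤ) ∣ z - B → v.1 z = z)
    (hne : (yF q A - yF q B : RatFun K n) ≠ 0) (hg : IsReg q t g) :
    IsReg q t ((g - GLDaha.actF q v g) / (yF q A - yF q B)) := by
  have key : ∀ p : Laurent K n, ∃ p', p - act q v p = (yL q A - yL q B) * p' := by
    intro p
    induction p using laurent_induction with
    | hc c => exact ⟨0, by rw [AlgHom.commutes, sub_self, mul_zero]⟩
    | hadd x y hx hy =>
      obtain ⟨x', hx⟩ := hx
      obtain ⟨y', hy⟩ := hy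
      refine ⟨x' + y', ?_⟩
      rw [map_add, mul_add, ← hx, ← hy]
      ring
    | hmul x y hx hy =>
      obtain ⟨x', hx⟩ := hx
      obtain ⟨y', hy⟩ := hy
      refine ⟨x' * y + act q v x * y', ?_⟩
      rw [map_mul]
      linear_combination y * hx + act q v x * hy
    | hY r =>
      rw [← yL_rep (q := q), act_yL]
      by_cases h1 : (n : ℤ) ∣ rep r - A
      · obtain ⟨m, hm⟩ := h1
        refine ⟨Algebra.algebraMap K _ ((q ^ (-m) : Kˣ) : K), ?_⟩
        rw [show rep r = A + m * n by linarith, apply_add_mul, hAB, yL_add_mul, yL_add_mul,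
          Algebra.smul_def, Algebra.smul_def]
        ring
      · by_cases h2 : (n : ℤ) ∣ rep r - B
        · obtain ⟨m, hm⟩ := h2
          refine ⟨-Algebra.algebraMap K _ ((q ^ (-m) : Kˣ) : K), ?_⟩
          rw [show rep r = B + m * n by linarith, apply_add_mul, hBA, yL_add_mul, yL_add_mul,
            Algebra.smul_def, Algebra.smul_def]
          ring
        · exact ⟨0, by rw [hfix _ h1 h2, sub_self, mul_zero]⟩
    | hinv x y hx hxy =>
      obtain ⟨x', hx⟩ := hx
      refine ⟨-(y * act q v y * x'), ?_⟩
      have h1 : act q v x * act q v y = 1 := by rw [← map_mul, hxy, map_one]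
      linear_combination -(y * act q v y) * hx + act q v y * hxy - y * h1
  have hvv : ∀ i, v.1 (v.1 i) = i := by
    intro i
    by_cases h1 : (n : ℤ) ∣ i - A
    · obtain ⟨m, hm⟩ := h1
      rw [show i = A + m * n by linarith, apply_add_mul, hAB, apply_add_mul, hBA]
    · by_cases h2 : (n : ℤ) ∣ i - B
      · obtain ⟨m, hm⟩ := h2
        rw [show i = B + m * n by linarith, apply_add_mul, hBA, apply_add_mul, hAB]
      · rw [hfix _ h1 h2, hfix _ h1 h2]
  have hact : ∀ p : Laurent K n, act q v (act q v p) = p := by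
    intro p
    have : v * v = 1 := Subtype.ext (Equiv.ext hvv)
    rw [← act_mul_apply, this, map_one]
    rfl
  obtain ⟨c, p, s, hs, hs0, rfl, rfl⟩ := hg
  obtain ⟨p', hp'⟩ := key (p * act q v s)
  have hs1 : evalRho q (act q v s) ≠ 0 := by rwa [evalRho_act hv]
  -- clearing denominators with the invariant element `s * v s`
  refine ⟨_, p', s * act q v s, mul_mem hs (act_fMonoid v hs), ?_, ?_, rfl⟩
  · rw [map_mul]; exact mul_ne_zero hs0 hs1
  · have h0 := toF_ne_zero hs0
    have h1 := toF_ne_zero hs1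
    have h2 := congrArg GLDaha.toF hp'
    simp only [map_mul, map_sub, hact] at h2
    rw [map_div₀, actF_toF, actF_toF, map_mul, div_eq_div_iff hne (mul_ne_zero h0 h1),
      div_sub_div _ _ h0 h1, div_mul_cancel₀ _ (mul_ne_zero h0 h1)]
    change _ = _ * (GLDaha.toF (yL q A) - GLDaha.toF (yL q B))
    linear_combination h2

end IsReg

section Generic

variable (ht : ∀ m : ℕ, 0 < m → t ^ m ≠ 1) (hq : q = t ^ (-2 : ℤ))

include ht hq

theorem evalRho_lf_ne_zero {i j : ℤ} (h : level n j ≠ level n i - 1) :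
    evalRho q (lf q t i j : Laurent K n) ≠ 0 := by
  rw [lf_eq, map_sub, map_smul, map_smul, evalRho_yL, evalRho_yL, smul_eq_mul, smul_eq_mul,
    ← Units.val_mul, ← Units.val_mul, sub_ne_zero]
  intro e
  apply h
  have h1 : t * q ^ level n i = t⁻¹ * q ^ level n j := Units.ext e
  have h2 : q ^ (level n j) = q ^ (level n i - 1) := by
    have h3 : q⁻¹ = t * t := by rw [hq, zpow_neg, inv_inv, zpow_two]
    rw [zpow_sub_one, h3, mul_comm, mul_assoc, h1, mul_inv_cancel_left]
  exact q_zpow_injective ht hq (congrArg Units.val h2)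

theorem isReg_inv_fF {i j : ℤ} (h : ¬ (n : ℤ) ∣ j - i) (hl : level n j ≠ level n i - 1) :
    IsReg q t (fF q t i j : RatFun K n)⁻¹ := by
  refine ⟨_, 1, lf q t i j, Submonoid.subset_closure ⟨⟨(i, j), ?_⟩, rfl⟩,
    evalRho_lf_ne_zero ht hq hl, ?_, rfl⟩
  · rwa [Int.modEq_iff_dvd]
  · rw [map_one, one_div]; rfl

end Generic

/-! ### The induced module -/

/-- The module induced from `q ^ ρ`. -/
abbrev IndRho (n : ℕ) [NeZero n] (q t : Kˣ) : Type _ := Ind q t (qRho n q)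

/-- The element `1 ⊗ v`. -/
def indV (n : ℕ) [NeZero n] (q t : Kˣ) : IndRho n q t := 1 ⊗ₜ basisVec (qRho n q)

theorem tmul_basisVec (h : DAHA n q t) :
    (h ⊗ₜ basisVec (qRho n q) : IndRho n q t) = h • indV n q t := by
  rw [indV, TensorProduct.smul_tmul', smul_eq_mul, mul_one]

/-- The coordinate of an element of the one-dimensional module. -/
def charCoord (a : Fin n → Kˣ) : CharLine a →+ K := AddMonoidHom.id K

theorem charCoord_smul (a : Fin n → Kˣ) (p : Laurent K n) (c : CharLine a) :
    charCoord a (p • c) = evalAt a p * charCoord a c := rfl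

theorem charCoord_basisVec (a : Fin n → Kˣ) : charCoord a (basisVec a) = 1 := rfl

theorem charCoord_injective (a : Fin n → Kˣ) : Function.Injective (charCoord a) :=
  fun _ _ h => h

theorem tmul_charLine (h : DAHA n q t) (c : CharLine (qRho n q)) :
    (h ⊗ₜ c : IndRho n q t) = charCoord _ c • (h • indV n q t) := by
  have h1 : c = algebraMap K (Laurent K n) (charCoord _ c) • basisVec (qRho n q) := by
    apply charCoord_injective
    rw [charCoord_smul, charCoord_basisVec, mul_one, AlgHom.commutes]
    rfl
  have h2 : algebraMap K (Laurent K n) (charCoord _ c) • h = charCoord _ c • h := by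
    change h * incl q t _ = _
    rw [AlgHom.commutes, ← Algebra.commutes, Algebra.smul_def]
  conv_lhs => rw [h1]
  rw [← TensorProduct.smul_tmul, h2, ← TensorProduct.smul_tmul', tmul_basisVec]

theorem smul_indV_surjective (u : IndRho n q t) : ∃ h : DAHA n q t, u = h • indV n q t := by
  induction u using TensorProduct.induction_on with
  | zero => exact ⟨0, (zero_smul _ _).symm⟩
  | tmul h c => exact ⟨charCoord _ c • h, by rw [tmul_charLine, smul_assoc]⟩
  | add u u' hu hu' =>
    obtain ⟨h, rfl⟩ := hu
    obtain ⟨h', rfl⟩ := hu'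
    exact ⟨h + h', (add_smul _ _ _).symm⟩

theorem incl_smul_indV (p : Laurent K n) :
    incl q t p • indV n q t = evalRho q p • indV n q t := by
  have h1 : incl (n := n) q t p = p • (1 : DAHA n q t) := (one_mul _).symm
  rw [← tmul_basisVec, h1, TensorProduct.smul_tmul, tmul_charLine, charCoord_smul,
    charCoord_basisVec, mul_one, one_smul]
  rfl

/-- A weight vector of weight `q ^ ρ`. -/
def IsWeight (u : IndRho n q t) : Prop := ∀ p : Laurent K n, incl q t p • u = evalRho q p • u

/-- The universal property of the induced module: the endomorphism that sends `1 ⊗ v` to a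
given weight vector. -/
def indLift (e : IndRho n q t) (he : IsWeight e) : Module.End (DAHA n q t) (IndRho n q t) where
  toFun := TensorProduct.liftAddHom (R := Laurent K n) (M := DAHA n q t)
    (N := CharLine (qRho n q)) (P := IndRho n q t)
    { toFun := fun h =>
        { toFun := fun c => charCoord _ c • (h • e)
          map_zero' := by rw [map_zero, zero_smul]
          map_add' := fun c c' => by rw [map_add, add_smul] }
      map_zero' := by
        ext c; change charCoord _ c • ((0 : DAHA n q t) • e) = 0; rw [zero_smul, smul_zero]
      map_add' := fun h h' => by
        ext c
        change charCoord _ c • ((h + h') • e) =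
          charCoord _ c • (h • e) + charCoord _ c • (h' • e)
        rw [add_smul, smul_add] }
    (by
      intro p h c
      change charCoord _ c • ((h * incl q t p) • e) = (evalRho q p * charCoord _ c) • (h • e)
      rw [mul_smul, he p, smul_comm h, smul_smul, mul_comm])
  map_add' := map_add _
  map_smul' h u := by
    induction u using TensorProduct.induction_on with
    | zero => rw [smul_zero, map_zero, smul_zero]
    | tmul h' c =>
      change charCoord _ c • ((h * h') • e) = h • (charCoord _ c • (h' • e))
      rw [smul_comm h, mul_smul]
    | add u u' hu hu' => rw [smul_add, map_add, map_add, smul_add, hu, hu']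

theorem indLift_indV (e : IndRho n q t) (he : IsWeight e) : indLift e he (indV n q t) = e := by
  change (1 : K) • ((1 : DAHA n q t) • e) = e
  rw [one_smul, one_smul]

theorem indLift_smul (e : IndRho n q t) (he : IsWeight e) (h : DAHA n q t) :
    indLift e he (h • indV n q t) = h • e := by
  rw [map_smul, indLift_indV]

theorem isWeight_apply (Φ : Module.End (DAHA n q t) (IndRho n q t)) :
    IsWeight (Φ (indV n q t)) := by
  intro p
  rw [← map_smul, incl_smul_indV, LinearMap.map_smul_of_tower]

theorem end_ext {Φ Ψ : Module.End (DAHA n q t) (IndRho n q t)}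
    (h : Φ (indV n q t) = Ψ (indV n q t)) : Φ = Ψ := by
  refine LinearMap.ext fun u => ?_
  obtain ⟨a, rfl⟩ := smul_indV_surjective u
  rw [map_smul, map_smul, h]

/-- The element `∑_x c_x T_x ⊗ v`. -/
def indSum (n : ℕ) [NeZero n] (q t : Kˣ) : (AffSym n →₀ K) →ₗ[K] IndRho n q t :=
  Finsupp.lsum K fun x => LinearMap.toSpanSingleton K _ (TW q t x • indV n q t)

theorem indSum_single (x : AffSym n) (c : K) :
    indSum n q t (Finsupp.single x c) = c • TW q t x • indV n q t := by
  simp [indSum]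

theorem indSum_apply (c : AffSym n →₀ K) :
    indSum n q t c = ∑ x ∈ c.support, c x • TW q t x • indV n q t := by
  simp [indSum, Finsupp.sum]

section Generic

variable (ht : ∀ m : ℕ, 0 < m → t ^ m ≠ 1) (hq : q = t ^ (-2 : ℤ))

include ht hq

/-! ### Specialization at `q ^ ρ` -/

/-- The relation between operators `∑ h g`, with `h` in the Hecke algebra and `g` without pole at
`q ^ ρ`, and their specializations `∑ g(q ^ ρ) h ⊗ v` in the induced module. -/
def specRel (n : ℕ) [NeZero n] : Submodule K (Module.End K (RatFun K n) × IndRho n q t) :=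
  Submodule.span K {z | ∃ (h : DAHA n q t) (g : RatFun K n) (c : K), Germ q t g c ∧
    z = (rho ht hq n h * mulOp g, c • h • indV n q t)}

theorem rho_mul_mulOp_mem_specRel (h : DAHA n q t) {g : RatFun K n} {c : K} (hg : Germ q t g c) :
    (rho ht hq n h * mulOp g, c • h • indV n q t) ∈ specRel ht hq n :=
  Submodule.subset_span ⟨h, g, c, hg, rfl⟩

theorem specRel_mul_mulOp {z : Module.End K (RatFun K n) × IndRho n q t}
    (hz : z ∈ specRel ht hq n) {g : RatFun K n} {c : K} (hg : Germ q t g c) :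
    (z.1 * mulOp g, c • z.2) ∈ specRel ht hq n := by
  induction hz using Submodule.span_induction with
  | mem x hx =>
    obtain ⟨h, g', c', hg', rfl⟩ := hx
    have := rho_mul_mulOp_mem_specRel ht hq h (hg'.mul hg)
    rwa [map_mul, ← mul_assoc, mul_comm c', mul_smul] at this
  | zero =>
    simp only [Prod.fst_zero, Prod.snd_zero, zero_mul, smul_zero]
    exact zero_mem _
  | add x y _ _ hx hy =>
    have := add_mem hx hy
    rwa [Prod.mk_add_mk, ← add_mul, ← smul_add] at this
  | smul a x _ hx =>
    have := Submodule.smul_mem _ a hx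
    rwa [Prod.smul_mk, ← smul_mul_assoc, smul_comm a c] at this

theorem rho_mul_specRel (h : DAHA n q t) {z : Module.End K (RatFun K n) × IndRho n q t}
    (hz : z ∈ specRel ht hq n) : (rho ht hq n h * z.1, h • z.2) ∈ specRel ht hq n := by
  induction hz using Submodule.span_induction with
  | mem x hx =>
    obtain ⟨h', g', c', hg', rfl⟩ := hx
    have := rho_mul_mulOp_mem_specRel ht hq (h * h') hg'
    rwa [map_mul, mul_assoc, mul_smul, smul_comm c'] at this
  | zero =>
    simp only [Prod.fst_zero, Prod.snd_zero, mul_zero, smul_zero]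
    exact zero_mem _
  | add x y _ _ hx hy =>
    have := add_mem hx hy
    rwa [Prod.mk_add_mk, ← mul_add, ← smul_add] at this
  | smul a x _ hx =>
    have := Submodule.smul_mem _ a hx
    rwa [Prod.smul_mk, ← mul_smul_comm, smul_comm a h] at this

/-- A pair in relation comes from one normal ordering `∑_x T_x g_x` with coefficients that have no
pole at `q ^ ρ`. -/
theorem specRel_normal_form {z : Module.End K (RatFun K n) × IndRho n q t}
    (hz : z ∈ specRel ht hq n) : ∃ (g : AffSym n →₀ RatFun K n) (c : AffSym n →₀ K),
      (∀ x, Germ q t (g x) (c x)) ∧ z.1 = opSum ht hq n g ∧ z.2 = indSum n q t c := by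
  classical
  have hzero : ∃ (g : AffSym n →₀ RatFun K n) (c : AffSym n →₀ K),
      (∀ x, Germ q t (g x) (c x)) ∧ (0 : Module.End K (RatFun K n)) = opSum ht hq n g ∧
        (0 : IndRho n q t) = indSum n q t c := ⟨0, 0, fun _ => .zero, by simp, by simp⟩
  have hadd : ∀ (X Y : Module.End K (RatFun K n)) (u w : IndRho n q t),
      (∃ (g : AffSym n →₀ RatFun K n) (c : AffSym n →₀ K),
        (∀ x, Germ q t (g x) (c x)) ∧ X = opSum ht hq n g ∧ u = indSum n q t c) →
      (∃ (g : AffSym n →₀ RatFun K n) (c : AffSym n →₀ K),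
        (∀ x, Germ q t (g x) (c x)) ∧ Y = opSum ht hq n g ∧ w = indSum n q t c) →
      ∃ (g : AffSym n →₀ RatFun K n) (c : AffSym n →₀ K),
        (∀ x, Germ q t (g x) (c x)) ∧ X + Y = opSum ht hq n g ∧ u + w = indSum n q t c := by
    rintro _ _ _ _ ⟨g, c, h, rfl, rfl⟩ ⟨g', c', h', rfl, rfl⟩
    exact ⟨g + g', c + c', fun x => (h x).add (h' x), (map_add _ _ _).symm, (map_add _ _ _).symm⟩
  have hsmul : ∀ (a : K) (X : Module.End K (RatFun K n)) (u : IndRho n q t),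
      (∃ (g : AffSym n →₀ RatFun K n) (c : AffSym n →₀ K),
        (∀ x, Germ q t (g x) (c x)) ∧ X = opSum ht hq n g ∧ u = indSum n q t c) →
      ∃ (g : AffSym n →₀ RatFun K n) (c : AffSym n →₀ K),
        (∀ x, Germ q t (g x) (c x)) ∧ a • X = opSum ht hq n g ∧ a • u = indSum n q t c := by
    rintro a _ _ ⟨g, c, h, rfl, rfl⟩
    exact ⟨a • g, a • c, fun x => (h x).smul a, (map_smul _ _ _).symm, (map_smul _ _ _).symm⟩
  induction hz using Submodule.span_induction with
  | mem x hx =>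
    obtain ⟨h, g, c, hg, rfl⟩ := hx
    have hh : h ∈ Submodule.span K
        (Set.range fun yp : AffSym n × Laurent K n => TW q t yp.1 * incl q t yp.2) := by
      rw [span_TW_mul_incl ht hq]; trivial
    induction hh using Submodule.span_induction with
    | mem x hx =>
      obtain ⟨⟨y, p⟩, rfl⟩ := hx
      refine ⟨Finsupp.single y (toF p * g), Finsupp.single y (evalRho q p * c), fun x => ?_, ?_, ?_⟩
      · rw [Finsupp.single_apply, Finsupp.single_apply]
        split_ifs
        · exact (Germ.toF p).mul hg
        · exact .zero
      · rw [opSum_single]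
        simp only [map_mul, rho_incl, mul_assoc]
      · rw [indSum_single, mul_smul, incl_smul_indV, mul_smul, smul_comm (evalRho q p) c,
          smul_comm (TW q t y)]
    | zero => simpa using hzero
    | add x y _ _ hx hy =>
      have := hadd _ _ _ _ hx hy
      simpa only [map_add, add_mul, add_smul, smul_add] using this
    | smul a x _ hx =>
      have := hsmul a _ _ hx
      simpa only [map_smul, smul_mul_assoc, smul_assoc, smul_comm a c] using this
  | zero => exact hzero
  | add x y _ _ hx hy => exact hadd _ _ _ _ hx hy
  | smul a x _ hx => exact hsmul a _ _ hx

/-- The specialization of an operator is unique. -/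
theorem specRel_unique {X : Module.End K (RatFun K n)} {u u' : IndRho n q t}
    (h : (X, u) ∈ specRel ht hq n) (h' : (X, u') ∈ specRel ht hq n) : u = u' := by
  have h0 := sub_mem h h'
  rw [Prod.mk_sub_mk, sub_self] at h0
  obtain ⟨g, c, hgc, h1, h2⟩ := specRel_normal_form ht hq h0
  have h3 : g = 0 := opSum_injective ht hq (by rw [← h1, map_zero])
  have h4 : c = 0 := Finsupp.ext fun x => by
    have := hgc x
    rw [h3] at this
    exact this.unique .zero
  rw [← sub_eq_zero]
  refine h2.trans ?_
  rw [h4, map_zero]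

/-- The specialization of an element of the stabilizer is a weight vector, since moving a Laurent
polynomial past this element does not change its value at `q ^ ρ`. -/
theorem isWeight_of_mem_specRel {w : AffSym n} (hw : w ∈ levelStab n) {e : IndRho n q t}
    (he : (permOp q w, e) ∈ specRel ht hq n) : IsWeight e := by
  intro p
  have h1 := rho_mul_specRel ht hq (incl q t p) he
  have h2 := specRel_mul_mulOp ht hq he (Germ.toF (t := t) (act q w⁻¹ p))
  rw [evalRho_act ((levelStab n).inv_mem hw)] at h2
  rw [rho_incl, mulOp_mul_permOp, actF_toF] at h1
  exact specRel_unique ht hq h1 h2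

theorem specRel_mul_permOp {w : AffSym n} (hw : w ∈ levelStab n) {e : IndRho n q t}
    (he : (permOp q w, e) ∈ specRel ht hq n) {z : Module.End K (RatFun K n) × IndRho n q t}
    (hz : z ∈ specRel ht hq n) :
    (z.1 * permOp q w, indLift e (isWeight_of_mem_specRel ht hq hw he) z.2) ∈
      specRel ht hq n := by
  induction hz using Submodule.span_induction with
  | mem x hx =>
    obtain ⟨h, g, c, hg, rfl⟩ := hx
    have h1 := rho_mul_specRel ht hq h
      (specRel_mul_mulOp ht hq he (hg.actF ((levelStab n).inv_mem hw)))
    rw [LinearMap.map_smul_of_tower, indLift_smul, mul_assoc, mulOp_mul_permOp, ← smul_comm h]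
    exact h1
  | zero =>
    simp only [Prod.fst_zero, Prod.snd_zero, zero_mul, map_zero]
    exact zero_mem _
  | add x y _ _ hx hy =>
    have := add_mem hx hy
    rwa [Prod.mk_add_mk, ← add_mul, ← map_add] at this
  | smul a x _ hx =>
    have := Submodule.smul_mem _ a hx
    rwa [Prod.smul_mk, ← smul_mul_assoc, ← LinearMap.map_smul_of_tower] at this

/-- The operators that can be specialized at `q ^ ρ`. -/
def regOp (n : ℕ) [NeZero n] : Submodule K (Module.End K (RatFun K n)) :=
  (specRel ht hq n).map (LinearMap.fst K _ _)

theorem mem_regOp {X : Module.End K (RatFun K n)} :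
    X ∈ regOp ht hq n ↔ ∃ u, (X, u) ∈ specRel ht hq n := by
  simp [regOp]

theorem one_mem_regOp : (1 : Module.End K (RatFun K n)) ∈ regOp ht hq n := by
  have := rho_mul_mulOp_mem_specRel ht hq (1 : DAHA n q t) Germ.one
  rw [map_one, map_one, mul_one] at this
  exact (mem_regOp ht hq).mpr ⟨_, this⟩

theorem regOp_mul_mulOp {X : Module.End K (RatFun K n)} (hX : X ∈ regOp ht hq n)
    {g : RatFun K n} (hg : IsReg q t g) : X * mulOp g ∈ regOp ht hq n := by
  obtain ⟨u, hu⟩ := (mem_regOp ht hq).mp hX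
  obtain ⟨c, hc⟩ := hg
  exact (mem_regOp ht hq).mpr ⟨_, specRel_mul_mulOp ht hq hu hc⟩

theorem rho_mul_regOp (h : DAHA n q t) {X : Module.End K (RatFun K n)} (hX : X ∈ regOp ht hq n) :
    rho ht hq n h * X ∈ regOp ht hq n := by
  obtain ⟨u, hu⟩ := (mem_regOp ht hq).mp hX
  exact (mem_regOp ht hq).mpr ⟨_, rho_mul_specRel ht hq h hu⟩

theorem opT_mul_regOp (i : ℤ) {X : Module.End K (RatFun K n)} (hX : X ∈ regOp ht hq n) :
    opT q t i * X ∈ regOp ht hq n := by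
  rw [← rho_T ht hq]
  exact rho_mul_regOp ht hq _ hX

theorem regOp_mul_permOp {X : Module.End K (RatFun K n)} (hX : X ∈ regOp ht hq n) {w : AffSym n}
    (hw : w ∈ levelStab n) (h : permOp q w ∈ regOp ht hq n) : X * permOp q w ∈ regOp ht hq n := by
  obtain ⟨u, hu⟩ := (mem_regOp ht hq).mp hX
  obtain ⟨e, he⟩ := (mem_regOp ht hq).mp h
  exact (mem_regOp ht hq).mpr ⟨_, specRel_mul_permOp ht hq hw he hu⟩

end Generic

/-! ### Specialization of the elements of the stabilizer -/

/-- The product `s_A s_{A+1} ⋯ s_{A+k-1}`. -/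
def cyc (n : ℕ) (A : ℤ) : ℕ → AffSym n
  | 0 => 1
  | k + 1 => cyc n A k * simple n (A + k)

omit [NeZero n] in
theorem not_dvd_of_pos_of_lt {c : ℤ} (h0 : 0 < c) (h1 : c < n) : ¬ (n : ℤ) ∣ c := fun h => by
  have := Int.le_of_dvd h0 h
  omega

theorem simple_apply_of_lt {A : ℤ} {i k : ℕ} (h1 : i < k) (h2 : k + 1 < n + i) :
    (simple n (A + k)).1 (A + i) = A + i := by
  apply simple_of_not_dvd
  · rw [← dvd_neg]
    exact not_dvd_of_pos_of_lt (by omega) (by omega)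
  · rw [← dvd_neg]
    exact not_dvd_of_pos_of_lt (by omega) (by omega)

theorem simple_apply_of_gt {A : ℤ} {i k : ℕ} (h1 : k + 1 < i) (h2 : i < n + k) :
    (simple n (A + k)).1 (A + i) = A + i := by
  apply simple_of_not_dvd <;> exact not_dvd_of_pos_of_lt (by omega) (by omega)

theorem cyc_apply (A : ℤ) {k : ℕ} (hk : k + 1 ≤ n) :
    (cyc n A k).1 (A + k) = A ∧ (∀ i : ℕ, i < k → (cyc n A k).1 (A + i) = A + i + 1) ∧
      ∀ i : ℕ, k < i → i < n → (cyc n A k).1 (A + i) = A + i := by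
  induction k with
  | zero => exact ⟨by simp [cyc], by simp, fun i _ _ => rfl⟩
  | succ k ih =>
    obtain ⟨h1, h2, h3⟩ := ih (by omega)
    have hn : 1 < n := by omega
    have hmul : ∀ i, (cyc n A (k + 1)).1 i = (cyc n A k).1 ((simple n (A + k)).1 i) := fun _ => rfl
    refine ⟨?_, fun i hi => ?_, fun i hi hin => ?_⟩
    · push_cast
      rw [hmul, ← add_assoc, simple_succ hn, h1]
    · rw [hmul]
      rcases Nat.lt_succ_iff_lt_or_eq.mp hi with h | rfl
      · rw [simple_apply_of_lt h (by omega), h2 i h]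
      · rw [simple_self hn]
        have := h3 (i + 1) (by omega) (by omega)
        push_cast at this
        rwa [← add_assoc] at this
    · rw [hmul, simple_apply_of_gt hi (by omega), h3 i (by omega) hin]

section Generic

variable (ht : ∀ m : ℕ, 0 < m → t ^ m ≠ 1) (hq : q = t ^ (-2 : ℤ))

include ht hq

/-- The relation `ν_i = 1 + (T_i - t) (Y_i - Y_{i+1}) / f_{i,i+1}`. -/
theorem permOp_simple_eq (i : ℤ) : permOp q (simple n i) =
    (1 : Module.End K (RatFun K n)) +
      (opT q t i - algebraMap K _ (t : K)) * mulOp (invFactor q t i (i + 1)) := by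
  rcases Nat.lt_or_ge 1 n with hn | hn
  · have h1 : (yF q i - yF q (i + 1) : RatFun K n) ≠ 0 := yF_sub_ne_zero ht hq (by omega)
    have h2 : (fF q t i (i + 1) : RatFun K n) ≠ 0 := fF_ne_zero ht hq (by omega)
    have h3 : eF q t i * invFactor q t i (i + 1) = (1 : RatFun K n) := by
      rw [eF, invFactor]; field_simp
    rw [opT, add_sub_cancel_left, mul_assoc, ← map_mul, h3, map_one, mul_one]
    abel
  · obtain rfl : n = 1 := le_antisymm hn NeZero.one_le
    rw [opT_of_one ht hq, sub_self, zero_mul, add_zero, simple_one_eq, map_one]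

/-- Up to a product of the `f_{i,j}`, the operator of `s_A ⋯ s_{A+k-1}` is a product of
intertwiners. -/
theorem exists_rho_eq_permOp_cyc (A : ℤ) {k : ℕ} (hk : k + 1 ≤ n) : ∃ h : DAHA n q t,
    rho ht hq n h =
      permOp q (cyc n A k) * mulOp (∏ i ∈ Finset.range k, fF q t (A + i) (A + k)) := by
  induction k with
  | zero => exact ⟨1, by simp [cyc]⟩
  | succ k ih =>
    obtain ⟨h, hh⟩ := ih (by omega)
    refine ⟨h * phi q t (A + k), ?_⟩
    have h1 : actF q (simple n (A + k)) (∏ i ∈ Finset.range k, fF q t (A + i) (A + k)) =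
        (∏ i ∈ Finset.range k, fF q t (A + i) (A + ((k + 1 : ℕ) : ℤ)) : RatFun K n) := by
      rw [map_prod]
      refine Finset.prod_congr rfl fun i hi => ?_
      rw [actF_fF, simple_apply_of_lt (Finset.mem_range.mp hi) (by omega), simple_self (by omega)]
      push_cast
      rw [add_assoc]
    rw [map_mul, hh, rho_phi, mul_assoc, ← mul_assoc (mulOp _), mulOp_mul_permOp, simple_inv, h1,
      Finset.prod_range_succ, map_mul, cyc, map_mul]
    simp only [mul_assoc]
    push_cast
    rw [add_assoc]

/-- The inverse of `s_A ⋯ s_{A+k-1}` only needs the denominators `f_{A,A+i}` with `0 < i ≤ k`. -/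
theorem permOp_cyc_inv_mem_regOp {A : ℤ}
    (hA : ∀ i : ℕ, 0 < i → i < n → level n (A + i) ≠ level n A - 1) {k : ℕ} (hk : k + 1 ≤ n) :
    permOp q (cyc n A k)⁻¹ ∈ regOp (K := K) ht hq n := by
  induction k with
  | zero =>
    rw [cyc, inv_one, map_one]
    exact one_mem_regOp ht hq
  | succ k ih =>
    have hR := ih (by omega)
    obtain ⟨h1, -, h3⟩ := cyc_apply (n := n) A (k := k) (by omega)
    have h4 : (cyc n A k).1 (A + k + 1) = A + k + 1 := by
      have := h3 (k + 1) (by omega) (by omega)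
      push_cast at this
      rwa [← add_assoc] at this
    have hI : IsReg q t (invFactor q t A (A + k + 1) : RatFun K n) := by
      rw [invFactor, div_eq_mul_inv]
      refine IsReg.mul ?_ (isReg_inv_fF ht hq ?_ ?_)
      · have := IsReg.toF (q := q) (t := t) (yL q A - yL q (A + k + 1) : Laurent K n)
        rwa [map_sub] at this
      · rw [show A + k + 1 - A = (k : ℤ) + 1 by ring]
        exact not_dvd_of_pos_of_lt (by omega) (by omega)
      · have := hA (k + 1) (by omega) (by omega)
        push_cast at this
        rwa [← add_assoc] at this
    have h5 : mulOp (invFactor q t (A + k) (A + k + 1)) * permOp q (cyc n A k)⁻¹ =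
        permOp q (cyc n A k)⁻¹ * mulOp (invFactor q t A (A + k + 1) : RatFun K n) := by
      rw [mulOp_mul_permOp, inv_inv, invFactor, map_div₀, map_sub, actF_fF, actF_yF, actF_yF, h1, h4,
        invFactor]
    rw [cyc, mul_inv_rev, simple_inv, map_mul, permOp_simple_eq ht hq, add_mul, one_mul, mul_assoc,
      h5, sub_mul]
    refine add_mem hR (sub_mem (opT_mul_regOp ht hq _ (regOp_mul_mulOp ht hq hR hI)) ?_)
    rw [← Algebra.smul_def]
    exact Submodule.smul_mem _ _ (regOp_mul_mulOp ht hq hR hI)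

/-- The reflection that exchanges `A` and `B = A + n + 1` is the conjugate of `s_j` by
`x = s_A ⋯ s_{j-1}`, where `j = A + n - 1`. Since `f_{A,j}` is proportional to `Y_j - Y_{j+1}`,
replacing `x` by a product of intertwiners cancels the pole of the conjugate. -/
theorem permOp_reflection_mem_regOp (hn : 1 < n) {A : ℤ}
    (hA : ∀ i : ℕ, 0 < i → i < n → level n (A + i) ≠ level n A - 1)
    (hA' : ∀ i : ℕ, 1 < i → i < n → level n A ≠ level n (A + i) - 1)
    {v : AffSym n} (hv : v ∈ levelStab n) {B : ℤ} (hB : B = A + n + 1) (hAB : v.1 A = B)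
    (hBA : v.1 B = A) (hfix : ∀ z, ¬ (n : ℤ) ∣ z - A → ¬ (n : ℤ) ∣ z - B → v.1 z = z) :
    permOp q v ∈ regOp (K := K) ht hq n := by
  obtain ⟨k, rfl⟩ : ∃ k, n = k + 2 := ⟨n - 2, by omega⟩
  have ht0 : algebraMap K (RatFun K (k + 2)) (t : K) ≠ 0 := by simp
  have hR := permOp_cyc_inv_mem_regOp (K := K) (t := t) ht hq hA (k := k + 1) le_rfl
  obtain ⟨Ψ, hΨ⟩ := exists_rho_eq_permOp_cyc (K := K) (t := t) ht hq A (n := k + 2) (k := k + 1)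
    le_rfl
  obtain ⟨hx1, hx2, -⟩ := cyc_apply (n := k + 2) A (k := k + 1) le_rfl
  set x := cyc (k + 2) A (k + 1) with hx
  obtain ⟨j, hj⟩ : ∃ j : ℤ, j = A + ((k + 1 : ℕ) : ℤ) := ⟨_, rfl⟩
  rw [← hj] at hx1 hΨ
  have hxB : x.1 (j + 1) = B := by
    have h1 := hx2 0 (by omega)
    have h2 := apply_add_mul x A 1
    rw [hj, hB]
    push_cast at h1 h2 ⊢
    rw [add_zero] at h1
    rw [show A + (k + 1) + 1 = A + 1 * (k + 2) by ring, h2, h1]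
    ring
  have hvx : v = x * simple (k + 2) j * x⁻¹ := by
    refine eq_conj_simple hn ?_ ?_ fun z h1 h2 => hfix _ ?_ ?_
    · rw [hx1, hxB, hAB]
    · rw [hx1, hxB, hBA]
    · rw [← hx1, dvd_apply_sub_iff]; exact h1
    · rw [← hxB, dvd_apply_sub_iff]; exact h2
  set s := simple (k + 2) j with hs
  have hd : (yF q j - yF q (j + 1) : RatFun K (k + 2)) ≠ 0 := yF_sub_ne_zero ht hq (by omega)
  have hABne : (yF q A - yF q B : RatFun K (k + 2)) ≠ 0 := yF_sub_ne_zero ht hq (by omega)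
  have hfj : (fF q t j (j + 1) : RatFun K (k + 2)) ≠ 0 := fF_ne_zero ht hq (by push_cast; omega)
  have hfAj : (fF q t A j : RatFun K (k + 2)) =
      -((algebraMap K _ (t : K))⁻¹ * (yF q j - yF q (j + 1))) := by
    have h1 : j + 1 = A + ((k + 2 : ℕ) : ℤ) := by rw [hj]; push_cast; ring
    rw [h1, yF_add_n hq, fF_eq]
    field_simp
    ring
  -- the product of the `f_{A+i,j}` without the factor that becomes singular
  set D : RatFun K (k + 2) := ∏ i ∈ Finset.range k, fF q t (A + (i + 1 : ℕ)) j with hD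
  have hDne : D ≠ 0 := by
    rw [hD, Finset.prod_ne_zero_iff]
    intro i hi
    refine fF_ne_zero ht hq ?_
    rw [hj]; push_cast; omega
  have hG : IsReg q t (actF q x D⁻¹) := by
    rw [hD, map_inv₀, map_prod, ← Finset.prod_inv_distrib]
    refine IsReg.prod _ _ fun i hi => ?_
    have hi' := Finset.mem_range.mp hi
    rw [actF_fF, hx2 (i + 1) (by omega), hx1]
    refine isReg_inv_fF ht hq ?_ ?_
    · rw [← dvd_neg]
      exact not_dvd_of_pos_of_lt (by push_cast; omega) (by push_cast; omega)
    · have := hA' (i + 2) (by omega) (by omega)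
      push_cast at this ⊢
      rwa [show A + (i + 1) + 1 = A + (i + 2 : ℤ) by ring]
  set G := actF q x D⁻¹ with hGdef
  have hDiff := IsReg.divided_difference hv hAB hBA hfix hABne hG
  have hxs : ∀ g : RatFun K (k + 2), actF q x (actF q s g) = actF q v (actF q x g) := by
    intro g
    rw [← actF_mul_apply, ← actF_mul_apply, hvx, inv_mul_cancel_right]
  have hE : actF q x ((algebraMap K _ (t : K) - eF q t j) * (D⁻¹ - actF q s D⁻¹)) =
      -((algebraMap K _ (t : K) - (algebraMap K _ (t : K))⁻¹) * yF q B) *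
        ((G - actF q v G) / (yF q A - yF q B)) := by
    have h1 : algebraMap K _ (t : K) - eF q t j = -((algebraMap K (RatFun K (k + 2)) (t : K) -
        (algebraMap K _ (t : K))⁻¹) * yF q (j + 1)) / (yF q j - yF q (j + 1)) := by
      rw [eF, fF_eq]
      field_simp
      ring
    rw [h1, map_mul, map_sub, hxs, map_div₀, map_neg, map_mul, map_sub, map_sub, map_inv₀,
      AlgHom.commutes, actF_yF, actF_yF, hx1, hxB, ← hGdef]
    ring
  have hreg : mulOp D⁻¹ * (opT q t j - algebraMap K _ (t : K)) * permOp q x⁻¹ ∈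
      regOp (K := K) ht hq (k + 2) := by
    have h1 : mulOp D⁻¹ * opT q t j = opT q t j * mulOp (actF q s D⁻¹) +
        mulOp ((algebraMap K _ (t : K) - eF q t j) * (D⁻¹ - actF q s D⁻¹)) := by
      rw [opT_eq, mul_add, add_mul, ← mul_assoc, mulOp_mul_permOp, ← hs, hs, simple_inv, ← hs,
        mul_assoc, mul_assoc, ← map_mul, ← map_mul, ← map_mul, ← map_mul, add_assoc, ← map_add]
      congr 2
      · rw [mul_comm]
      · ring
    have h2 : mulOp D⁻¹ * (opT q t j - algebraMap K _ (t : K)) * permOp q x⁻¹ =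
        opT q t j * (permOp q x⁻¹ * mulOp (actF q v G)) +
          permOp q x⁻¹ * mulOp (-((algebraMap K _ (t : K) - (algebraMap K _ (t : K))⁻¹) * yF q B) *
            ((G - actF q v G) / (yF q A - yF q B))) -
          (t : K) • (permOp q x⁻¹ * mulOp G) := by
      have h3 : ∀ g : RatFun K (k + 2),
          mulOp g * permOp q x⁻¹ = permOp q x⁻¹ * mulOp (actF q x g) := fun g => by
        rw [mulOp_mul_permOp, inv_inv]
      rw [mul_sub, h1, sub_mul, add_mul, mul_assoc, h3, h3, hE, hxs, ← hGdef, ← Algebra.commutes,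
        mul_assoc, h3, ← hGdef, Algebra.smul_def]
    rw [h2]
    refine sub_mem (add_mem (opT_mul_regOp ht hq _ (regOp_mul_mulOp ht hq hR (hG.actF hv)))
      (regOp_mul_mulOp ht hq hR (IsReg.mul ?_ hDiff)))
      (Submodule.smul_mem _ _ (regOp_mul_mulOp ht hq hR hG))
    have := IsReg.toF (q := q) (t := t) (-((algebraMap K _ (t : K) - algebraMap K _ ((t : K)⁻¹)) *
      yL q B) : Laurent K (k + 2))
    rwa [map_neg, map_mul, map_sub, AlgHom.commutes, AlgHom.commutes, map_inv₀] at this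
  have hfAB : IsReg q t (fF q t A B : RatFun K (k + 2))⁻¹ := by
    refine isReg_inv_fF ht hq ?_ ?_
    · rw [hB, show A + ((k + 2 : ℕ) : ℤ) + 1 - A = ((k + 2 : ℕ) : ℤ) + 1 by ring,
        dvd_add_right (dvd_refl _)]
      exact not_dvd_of_pos_of_lt one_pos (by omega)
    · rw [← hAB, hv]
      omega
  -- as `x = Ψ D⁻¹ f_{A,j}⁻¹`, conjugation by `x` turns `(T_j - t) f_{j,j+1}⁻¹`, which is
  -- `(s_j - 1) (Y_j - Y_{j+1})⁻¹`, into a multiple of `v + 1`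
  have hfinal : permOp q v = -1 + (t : K) • (rho ht hq (k + 2) Ψ *
      (mulOp D⁻¹ * (opT q t j - algebraMap K _ (t : K)) * permOp q x⁻¹ *
        mulOp (fF q t A B)⁻¹)) := by
    set d : RatFun K (k + 2) := yF q j - yF q (j + 1) with hddef
    have h1 : permOp q x⁻¹ * mulOp (fF q t A B)⁻¹ =
        mulOp (fF q t j (j + 1) : RatFun K (k + 2))⁻¹ * permOp q x⁻¹ := by
      rw [mulOp_mul_permOp, inv_inv, map_inv₀ (actF q x), actF_fF, hx1, hxB]
    have h2 : (opT q t j - algebraMap K _ (t : K)) * mulOp (fF q t j (j + 1))⁻¹ =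
        (permOp q s - 1) * mulOp d⁻¹ := by
      have : eF q t j * (fF q t j (j + 1))⁻¹ = d⁻¹ := by
        rw [eF, ← hddef]; field_simp
      rw [opT, add_sub_cancel_left, mul_assoc, ← map_mul, this]
    have h3 : mulOp (-d) * ((permOp q s - 1) * mulOp d⁻¹) = permOp q s + 1 := by
      have : actF q s⁻¹ (-d) = d := by
        rw [hs, simple_inv, hddef, map_neg, map_sub, actF_yF, actF_yF, simple_self hn,
          simple_succ hn]
        ring
      rw [← mul_assoc, mul_sub, mul_one, sub_mul, mulOp_mul_permOp, this, mul_assoc, ← map_mul,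
        ← map_mul, mul_inv_cancel₀ hd, neg_mul, mul_inv_cancel₀ hd, map_neg, map_one, mul_one]
      abel
    have h4 : (t : K) • rho ht hq (k + 2) Ψ = permOp q x * (mulOp (-d) * mulOp D) := by
      rw [hΨ, Finset.prod_range_succ', ← hD, Nat.cast_zero, add_zero, hfAj, ← mul_smul_comm,
        ← map_smul, Algebra.smul_def, ← map_mul]
      congr 2
      field_simp
    have h5 : mulOp D * mulOp D⁻¹ = (1 : Module.End K (RatFun K (k + 2))) := by
      rw [← map_mul, mul_inv_cancel₀ hDne, map_one]
    rw [← smul_mul_assoc, h4, mul_assoc (mulOp D⁻¹ * _), h1]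
    simp only [mul_assoc]
    rw [← mul_assoc (mulOp D) (mulOp D⁻¹), h5, one_mul, ← mul_assoc (opT q t j - _), h2,
      ← mul_assoc (mulOp (-d)), h3, add_mul, mul_add, one_mul, permOp_mul_inv, ← map_mul, ← map_mul,
      ← mul_assoc, ← hvx]
    abel
  rw [hfinal]
  exact add_mem (Submodule.neg_mem _ (one_mem_regOp ht hq)) (Submodule.smul_mem _ _
    (rho_mul_regOp ht hq _ (regOp_mul_mulOp ht hq hreg hfAB)))

theorem permOp_conjSym_swap_mem_regOp {m : ℕ} (i : Fin m) :
    permOp q (conjSym (m + 1) (Equiv.swap i.castSucc i.succ)) ∈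
      regOp (K := K) ht hq (m + 1) := by
  have hi := i.2
  set v := conjSym (m + 1) (Equiv.swap i.castSucc i.succ) with hv
  obtain ⟨A, hA⟩ : ∃ A : ℤ, A = rep i.castSucc +
      ((((i.castSucc : Fin (m + 1)) : ℕ) : ℤ) + 0) * ((m + 1 : ℕ) : ℤ) := ⟨_, rfl⟩
  obtain ⟨B, hB⟩ : ∃ B : ℤ, B = rep i.succ +
      ((((i.succ : Fin (m + 1)) : ℕ) : ℤ) + 0) * ((m + 1 : ℕ) : ℤ) := ⟨_, rfl⟩
  have hvA : v.1 A = B := by rw [hA, hv, conjSym_apply, Equiv.swap_apply_left, hB]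
  have hvB : v.1 B = A := by rw [hB, hv, conjSym_apply, Equiv.swap_apply_right, hA]
  have hlA : level (m + 1) A = 0 := by rw [hA, level_rep_add]; ring
  have hlev : ∀ k : ℕ, k < m + 1 → level (m + 1) (A + k) = k ∨
      level (m + 1) (A + k) = k - (m + 1) - 1 := by
    intro k hk
    by_cases h : (i : ℕ) + k < m + 1
    · left
      have : A + k = rep (⟨i + k, h⟩ : Fin (m + 1)) + (i : ℕ) * ((m + 1 : ℕ) : ℤ) := by
        rw [hA, rep, rep]; push_cast [Fin.val_castSucc]; ring
      rw [this, level_rep_add]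
      push_cast
      ring
    · right
      have h' : (i : ℕ) + k - (m + 1) < m + 1 := by omega
      have : A + k = rep (⟨i + k - (m + 1), h'⟩ : Fin (m + 1)) +
          ((i : ℕ) + 1) * ((m + 1 : ℕ) : ℤ) := by
        rw [hA, rep, rep]; push_cast [Fin.val_castSucc, Nat.cast_sub (not_lt.mp h)]; ring
      rw [this, level_rep_add]
      push_cast [Nat.cast_sub (not_lt.mp h)]
      ring
  refine permOp_reflection_mem_regOp ht hq (by omega) (A := A) (B := B) (fun k h0 hk => ?_)
    (fun k h1 hk => ?_) (conjSym_mem _) ?_ hvA hvB fun z h1 h2 => ?_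
  · rcases hlev k hk with h | h <;> rw [h, hlA] <;> omega
  · rcases hlev k hk with h | h <;> rw [h, hlA] <;> omega
  · rw [hA, hB, rep, rep]; push_cast [Fin.val_castSucc, Fin.val_succ]; ring
  · have e1 : residue (m + 1) A = i.castSucc := by rw [hA, (residue_wind_of_eq rfl).1]
    have e2 : residue (m + 1) B = i.succ := by rw [hB, (residue_wind_of_eq rfl).1]
    rw [← residue_eq_iff, e1] at h1
    rw [← residue_eq_iff, e2] at h2
    conv_lhs => rw [eq_rep_add_level (n := m + 1) z]
    rw [hv, conjSym_apply, Equiv.swap_apply_of_ne_of_ne h1 h2, ← eq_rep_add_level]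

/-- The elements of the stabilizer of `q ^ ρ` act by operators that can be specialized there. -/
theorem permOp_conjSym_mem_regOp (σ : Equiv.Perm (Fin n)) :
    permOp q (conjSym n σ) ∈ regOp (K := K) ht hq n := by
  obtain ⟨m, rfl⟩ : ∃ m, n = m + 1 := ⟨n - 1, (Nat.succ_pred_eq_of_pos (NeZero.pos n)).symm⟩
  have hσ : σ ∈ Submonoid.closure
      (Set.range fun i : Fin m => Equiv.swap i.castSucc i.succ) := by
    rw [Equiv.Perm.mclosure_swap_castSucc_succ]
    trivial
  induction hσ using Submonoid.closure_induction with
  | mem x hx =>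
    obtain ⟨i, rfl⟩ := hx
    exact permOp_conjSym_swap_mem_regOp ht hq i
  | one => rw [map_one, map_one]; exact one_mem_regOp ht hq
  | mul x y _ _ hx hy =>
    rw [map_mul, map_mul]
    exact regOp_mul_permOp ht hq hx (conjSym_mem y) hy

end Generic

theorem laurent_smul_def (p : Laurent K n) (h : DAHA n q t) : p • h = h * incl q t p := rfl

section Generic

variable (ht : ∀ m : ℕ, 0 < m → t ^ m ≠ 1) (hq : q = t ^ (-2 : ℤ))

include ht hq

/-! ### Coordinates in the induced module -/

theorem linearIndependent_TW :
    LinearIndependent (Laurent K n) (fun x : AffSym n => TW (K := K) q t x) := by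
  rw [LinearIndependent, injective_iff_map_eq_zero]
  intro g hg
  have h1 : opSum ht hq n (g.mapRange toF (map_zero _)) = 0 := by
    have h2 := congrArg (rho ht hq n) hg
    rw [Finsupp.linearCombination_apply, Finsupp.sum, map_sum, map_zero] at h2
    rw [opSum_apply]
    refine Eq.trans ?_ h2
    refine (Finset.sum_subset Finsupp.support_mapRange fun x _ hx => ?_).trans
      (Finset.sum_congr rfl fun x _ => ?_)
    · rw [Finsupp.notMem_support_iff] at hx
      rw [hx, map_zero, mul_zero]
    · rw [laurent_smul_def, map_mul, rho_incl, Finsupp.mapRange_apply]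
  have h3 := opSum_injective ht hq (h1.trans (map_zero _).symm)
  ext1 x
  exact toF_injective ((DFunLike.congr_fun h3 x).trans (map_zero _).symm)

/-- The basis `T_x` of the double affine Hecke algebra as a right module over the Laurent
polynomials. -/
def basisTW (n : ℕ) [NeZero n] : Module.Basis (AffSym n) (Laurent K n) (DAHA n q t) :=
  Module.Basis.mk (linearIndependent_TW ht hq) (by
    intro h _
    have hh : h ∈ Submodule.span K
        (Set.range fun yp : AffSym n × Laurent K n => TW q t yp.1 * incl q t yp.2) := by
      rw [span_TW_mul_incl ht hq]; trivial
    induction hh using Submodule.span_induction with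
    | mem x hx =>
      obtain ⟨⟨y, p⟩, rfl⟩ := hx
      exact Submodule.smul_mem _ p (Submodule.subset_span ⟨y, rfl⟩)
    | zero => exact zero_mem _
    | add x y _ _ hx hy => exact add_mem (hx trivial) (hy trivial)
    | smul c x _ hx =>
      have h1 : c • x = algebraMap K (Laurent K n) c • x := by
        rw [laurent_smul_def, AlgHom.commutes, ← Algebra.commutes, Algebra.smul_def]
      rw [h1]
      exact Submodule.smul_mem _ _ (hx trivial))

theorem basisTW_repr_TW (x y : AffSym n) :
    (basisTW ht hq n).repr (TW (K := K) q t x) y = Finsupp.single x 1 y := by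
  have h : TW (K := K) q t x = basisTW ht hq n x := (Module.Basis.mk_apply _ _ _).symm
  rw [h, Module.Basis.repr_self]

/-- The coefficient of `T_x ⊗ v` in an element of the induced module. -/
def indCoord (x : AffSym n) : IndRho n q t →+ K :=
  TensorProduct.liftAddHom (R := Laurent K n) (M := DAHA n q t)
    (N := CharLine (qRho n q)) (P := K)
    ((AddMonoidHom.mul.comp ((evalRho q : Laurent K n →ₐ[K] K) : Laurent K n →+ K)).comp
      (((Finsupp.applyAddHom x).comp ((basisTW ht hq n).repr : DAHA n q t →+ _))) |>.compr₂
        (AddMonoidHom.id K) |>.compl₂ (charCoord _))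
    (by
      intro p h c
      change evalRho q ((basisTW ht hq n).repr (p • h) x) * charCoord _ c =
        evalRho q ((basisTW ht hq n).repr h x) * charCoord _ (p • c)
      rw [map_smul, Finsupp.smul_apply, smul_eq_mul, map_mul, charCoord_smul, evalRho]
      ring)

theorem indCoord_smul_indV (x : AffSym n) (h : DAHA n q t) :
    indCoord ht hq x (h • indV n q t) = evalRho q ((basisTW ht hq n).repr h x) := by
  rw [← tmul_basisVec]
  change evalRho q ((basisTW ht hq n).repr h x) * charCoord _ (basisVec _) = _
  rw [charCoord_basisVec, mul_one]

theorem indCoord_smul (x : AffSym n) (c : K) (u : IndRho n q t) :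
    indCoord ht hq x (c • u) = c * indCoord ht hq x u := by
  obtain ⟨h, rfl⟩ := smul_indV_surjective u
  have h1 : c • h = algebraMap K (Laurent K n) c • h := by
    rw [laurent_smul_def, AlgHom.commutes, ← Algebra.commutes, Algebra.smul_def]
  rw [← smul_assoc, indCoord_smul_indV, indCoord_smul_indV, h1, map_smul, Finsupp.smul_apply,
    smul_eq_mul, map_mul, AlgHom.commutes]
  rfl

theorem indCoord_TW (x y : AffSym n) :
    indCoord ht hq x (TW q t y • indV n q t) = Finsupp.single y 1 x := by
  classical
  rw [indCoord_smul_indV, basisTW_repr_TW, Finsupp.single_apply, Finsupp.single_apply]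
  split_ifs <;> simp

theorem indCoord_indSum (x : AffSym n) (c : AffSym n →₀ K) :
    indCoord ht hq x (indSum n q t c) = c x := by
  classical
  induction c using Finsupp.induction_linear with
  | zero => simp
  | add c c' hc hc' => rw [map_add, map_add, hc, hc', Finsupp.add_apply]
  | single y a =>
    rw [indSum_single, indCoord_smul, indCoord_TW, Finsupp.single_apply, Finsupp.single_apply]
    split_ifs <;> simp

theorem indSum_surjective (u : IndRho n q t) : ∃ c, u = indSum n q t c := by
  obtain ⟨h, rfl⟩ := smul_indV_surjective u
  obtain ⟨g, c, -, -, hc⟩ := specRel_normal_form ht hq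
    (rho_mul_mulOp_mem_specRel ht hq h Germ.one)
  refine ⟨c, ?_⟩
  rw [← hc, one_smul]

theorem indCoord_of_mem_filt {m : ℕ} {h : DAHA n q t} (hh : h ∈ filt q t m) {x : AffSym n}
    (hx : m ≤ len x) : indCoord ht hq x (h • indV n q t) = 0 := by
  induction hh using Submodule.span_induction with
  | mem z hz =>
    obtain ⟨y, p, hy, rfl⟩ := hz
    rw [mul_smul, incl_smul_indV, smul_comm, indCoord_smul, indCoord_TW,
      Finsupp.single_eq_of_ne, mul_zero]
    rintro rfl
    omega
  | zero => rw [zero_smul, map_zero]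
  | add z z' _ _ hz hz' => rw [add_smul, map_add, hz, hz', add_zero]
  | smul c z _ hz => rw [smul_assoc, indCoord_smul, hz, mul_zero]

theorem indCoord_Y_mul_TW {x y : AffSym n} (h : len y ≤ len x) (i : ℤ) :
    indCoord ht hq x (Y (n := n) q t i • TW q t y • indV n q t) =
      Finsupp.single y ((q ^ level n ((y⁻¹).1 i) : Kˣ) : K) x := by
  classical
  have h1 := indCoord_of_mem_filt ht hq (Y_mul_TW_sub_mem ht hq y i) h
  have h2 : Y (n := n) q t i • TW q t y • indV n q t =
      (TW q t y * Y q t ((y⁻¹).1 i)) • indV n q t +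
        (Y q t i * TW q t y - TW q t y * Y q t ((y⁻¹).1 i)) • indV n q t := by
    rw [← add_smul, add_sub_cancel, mul_smul]
  rw [h2, map_add, h1, add_zero, mul_smul, ← incl_yL, incl_smul_indV, evalRho_yL, smul_comm, indCoord_smul, indCoord_TW,
    Finsupp.single_apply, Finsupp.single_apply]
  split_ifs <;> simp

/-- The longest terms of a weight vector belong to the stabilizer of `q ^ ρ`. Hence a weight vector
is determined by its coefficients there. -/
theorem eq_zero_of_isWeight {u : IndRho n q t} (hu : IsWeight u)
    (h0 : ∀ σ, indCoord ht hq (conjSym n σ) u = 0) : u = 0 := by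
  classical
  obtain ⟨c, rfl⟩ := indSum_surjective ht hq u
  by_contra hne
  have hc : c.support.Nonempty := by
    rw [Finsupp.support_nonempty_iff]
    rintro rfl
    exact hne (map_zero _)
  obtain ⟨x, hx, hmax⟩ := Finset.exists_max_image c.support len hc
  rw [Finsupp.mem_support_iff] at hx
  have h1 : ∀ i, level n ((x⁻¹).1 i) = level n i := by
    intro i
    have h2 := congrArg (indCoord ht hq x) (hu (yL q i))
    rw [incl_yL, evalRho_yL, indCoord_smul, indCoord_indSum, indSum_apply, Finset.smul_sum,
      map_sum, Finset.sum_eq_single x] at h2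
    · rw [smul_comm, indCoord_smul, indCoord_Y_mul_TW ht hq le_rfl, Finsupp.single_eq_same,
        mul_comm] at h2
      exact q_zpow_injective ht hq (mul_right_cancel₀ hx h2)
    · intro y hy hyx
      rw [smul_comm, indCoord_smul, indCoord_Y_mul_TW ht hq (hmax y hy),
        Finsupp.single_eq_of_ne (Ne.symm hyx), mul_zero]
    · intro h3
      rw [Finsupp.notMem_support_iff] at h3
      exact absurd h3 hx
  have hx' : x⁻¹ ∈ levelStab n := h1
  obtain ⟨σ, rfl⟩ := mem_levelStab_iff.mp (inv_mem_iff.mp hx')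
  exact hx (by rw [← indCoord_indSum ht hq, h0])

/-! ### The leading coefficients at `q ^ ρ` -/

omit ht hq in
/-- Distinct entries of the same level differ by multiples of `n + 1`. -/
theorem add_lt_of_level_eq {x y : ℤ} (h : x < y) (hl : level n x = level n y) :
    x + n < y := by
  have hn := NeZero.pos n
  have hx := eq_rep_add (n := n) x
  have hy := eq_rep_add (n := n) y
  rw [rep] at hx hy
  rw [level, level] at hl
  obtain ⟨d, hd⟩ : ∃ d : ℤ, d = wind n y - wind n x := ⟨_, rfl⟩
  have h1 : y - x = d * (n + 1) := by
    rw [hd]; linear_combination hy - hx - hl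
  have h2 : 0 < d := by
    by_contra hc
    have : d * ((n : ℤ) + 1) ≤ 0 := mul_nonpos_of_nonpos_of_nonneg (not_lt.mp hc) (by omega)
    omega
  have h3 : 1 * ((n : ℤ) + 1) ≤ d * (n + 1) := by gcongr; omega
  omega

/-- The leading coefficient at an element of the stabilizer of `q ^ ρ` does not vanish at
`q ^ ρ`: a factor `Y_a - Y_b = t⁻¹ f_{a,b+n}` that vanishes there belongs to an inversion `(a, b)`
with `b` of the level of `a`. Then `(a, b + n)` is an inversion as well, and contributes the
denominator `f_{a,b+n}`. -/
theorem isReg_inv_lam {w : AffSym n} (hw : w ∈ levelStab n) :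
    IsReg q t (lam q t w : RatFun K n)⁻¹ := by
  classical
  rw [lam, invProd, ← Finset.prod_inv_distrib]
  refine IsReg.prod _ _ fun r _ => ?_
  set a := rep r with ha
  set S := invAt w a with hS
  set S₀ := S.filter fun b => level n b = level n a with hS₀
  have hsub : S₀.image (fun b : ℤ => b + (n : ℤ)) ⊆ S := by
    intro b' hb'
    obtain ⟨b, hb, rfl⟩ := Finset.mem_image.mp hb'
    rw [hS₀, Finset.mem_filter, hS, mem_invAt] at hb
    obtain ⟨⟨h1, h2⟩, h3⟩ := hb
    rw [hS, mem_invAt]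
    have h4 := add_lt_of_level_eq (n := n) h2 (by rw [hw, hw, h3])
    rw [w.2]
    exact ⟨by omega, h4⟩
  have hinj : Set.InjOn (fun b : ℤ => b + (n : ℤ)) S₀ := fun b _ b' _ h => by simpa using h
  have hne : ∀ b ∈ S, (fF q t a (b + n) : RatFun K n) ≠ 0 := by
    intro b hb
    rw [fF_add_n hq]
    refine mul_ne_zero (by simp) (yF_sub_ne_zero ht hq ?_)
    have h1 := not_dvd_of_mem_invAt hb
    rintro rfl
    simp at h1
  have h1 : (∏ b ∈ S, invFactor q t a b : RatFun K n)⁻¹ =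
      algebraMap K _ ((t : K) ^ S.card) *
        ((∏ b ∈ S \ S₀.image (fun b : ℤ => b + (n : ℤ)), fF q t a b) *
          ∏ b ∈ S \ S₀, (fF q t a (b + n))⁻¹) := by
    have h2 : ∀ b ∈ S, (invFactor q t a b : RatFun K n)⁻¹ =
        algebraMap K _ (t : K) * (fF q t a b * (fF q t a (b + n))⁻¹) := by
      intro b hb
      have h3 := hne b hb
      have h4 : (yF q a - yF q b : RatFun K n) ≠ 0 := by
        rw [fF_add_n hq] at h3
        exact right_ne_zero_of_mul h3
      have ht0 : algebraMap K (RatFun K n) (t : K) ≠ 0 := by simp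
      rw [invFactor, fF_add_n hq]
      field_simp
    have h5 : (∏ b ∈ S₀, fF q t a (b + n) : RatFun K n) ≠ 0 :=
      Finset.prod_ne_zero_iff.mpr fun b hb => hne b (Finset.filter_subset _ _ hb)
    rw [← Finset.prod_inv_distrib, Finset.prod_congr rfl h2, Finset.prod_mul_distrib,
      Finset.prod_const, Finset.prod_mul_distrib, ← Finset.prod_sdiff hsub,
      ← Finset.prod_sdiff (Finset.filter_subset _ S : S₀ ⊆ S), Finset.prod_image hinj,
      Finset.prod_inv_distrib (s := S₀), map_pow, mul_mul_mul_comm, mul_inv_cancel₀ h5, mul_one]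
  rw [h1]
  refine (IsReg.algebraMap _).mul ((IsReg.prod _ _ fun b _ => IsReg.toF _).mul
    (IsReg.prod _ _ fun b hb => ?_))
  rw [Finset.mem_sdiff, hS₀, Finset.mem_filter, not_and] at hb
  refine isReg_inv_fF ht hq ?_ ?_
  · rw [show b + n - a = b - a + n by ring, dvd_add_self_right]
    exact not_dvd_of_mem_invAt hb.1
  · have h2 := level_add_mul (n := n) b 1
    rw [one_mul] at h2
    rw [h2]
    have := hb.2 hb.1
    omega

theorem germ_lam_ne_zero {w : AffSym n} (hw : w ∈ levelStab n) {c : K}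
    (h : Germ q t (lam q t w) c) : c ≠ 0 := by
  obtain ⟨c', h'⟩ := isReg_inv_lam (K := K) ht hq hw
  have h1 := h.mul h'
  rw [mul_inv_cancel₀ (lam_ne_zero ht hq w)] at h1
  intro h0
  rw [h0, zero_mul] at h1
  exact one_ne_zero (Germ.one.unique h1)

end Generic

section Generic

variable (ht : ∀ m : ℕ, 0 < m → t ^ m ≠ 1) (hq : q = t ^ (-2 : ℤ))

include ht hq

/-! ### The endomorphisms of the induced module -/

/-- The specialization `:ν_{γ⁻¹σγ}: ⊗ v` of the normal ordering. -/
def weightVec (σ : Equiv.Perm (Fin n)) : IndRho n q t :=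
  ((mem_regOp ht hq).mp (permOp_conjSym_mem_regOp ht hq σ)).choose

theorem weightVec_mem (σ : Equiv.Perm (Fin n)) :
    (permOp q (conjSym n σ), weightVec ht hq σ) ∈ specRel ht hq n :=
  ((mem_regOp ht hq).mp (permOp_conjSym_mem_regOp ht hq σ)).choose_spec

theorem isWeight_weightVec (σ : Equiv.Perm (Fin n)) :
    IsWeight (weightVec (K := K) ht hq σ) :=
  isWeight_of_mem_specRel ht hq (conjSym_mem σ) (weightVec_mem ht hq σ)

/-- The endomorphism `h ⊗ v ↦ h :ν_{γ⁻¹σγ}: ⊗ v`. -/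
def endPhi (σ : Equiv.Perm (Fin n)) : Module.End (DAHA n q t) (IndRho n q t) :=
  indLift (weightVec ht hq σ) (isWeight_weightVec ht hq σ)

theorem weightVec_one : weightVec (K := K) ht hq (1 : Equiv.Perm (Fin n)) = indV n q t := by
  have h1 := weightVec_mem (K := K) ht hq (1 : Equiv.Perm (Fin n))
  have h2 := rho_mul_mulOp_mem_specRel (K := K) ht hq (1 : DAHA n q t) Germ.one
  rw [map_one, map_one] at h1
  rw [map_one, map_one, mul_one, one_smul, one_smul] at h2
  exact specRel_unique ht hq h1 h2

/-- The order of the factors is reversed by `endPhi`, because it acts from the right on `h ⊗ v`. -/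
theorem weightVec_mul (σ τ : Equiv.Perm (Fin n)) :
    weightVec (K := K) ht hq (σ * τ) = endPhi ht hq τ (weightVec ht hq σ) := by
  have h1 := weightVec_mem (K := K) ht hq (σ * τ)
  have h2 := specRel_mul_permOp (K := K) ht hq (conjSym_mem τ) (weightVec_mem ht hq τ)
    (weightVec_mem ht hq σ)
  rw [map_mul, map_mul] at h1
  exact specRel_unique ht hq h1 h2

/-- The weight vectors are triangular with respect to the `T_x ⊗ v` with `x` in the stabilizer of
`q ^ ρ`, ordered by length. -/
theorem indCoord_weightVec (σ τ : Equiv.Perm (Fin n)) :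
    (σ = τ → indCoord (K := K) ht hq (conjSym n σ) (weightVec ht hq τ) ≠ 0) ∧
      (σ ≠ τ → len (conjSym n τ) ≤ len (conjSym n σ) →
        indCoord (K := K) ht hq (conjSym n σ) (weightVec ht hq τ) = 0) := by
  obtain ⟨g, c, hgc, h1, h2⟩ := specRel_normal_form ht hq (weightVec_mem (K := K) ht hq τ)
  obtain ⟨h3, h4⟩ := coeff_of_opSum_eq_permOp ht hq h1.symm
  have h5 : ∀ x, indCoord ht hq x (weightVec ht hq τ) = c x := fun x => by
    rw [← indCoord_indSum ht hq x c, ← h2]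
  refine ⟨?_, fun hne hlen => ?_⟩
  · rintro rfl
    rw [h5]
    have h6 := hgc (conjSym n σ)
    rw [h3] at h6
    exact germ_lam_ne_zero ht hq (conjSym_mem σ) h6
  · rw [h5]
    have h6 := hgc (conjSym n σ)
    rw [h4 _ (fun e => hne (conjSym_injective e)) hlen] at h6
    exact h6.unique .zero

/-- The vector `∑_σ a_σ :ν_{γ⁻¹σγ}: ⊗ v`. -/
def weightSum (n : ℕ) [NeZero n] : (Equiv.Perm (Fin n) → K) →ₗ[K] IndRho n q t :=
  Fintype.linearCombination K (weightVec ht hq)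

theorem weightSum_apply (a : Equiv.Perm (Fin n) → K) :
    weightSum ht hq n a = ∑ σ, a σ • weightVec ht hq σ := rfl

theorem isWeight_weightSum (a : Equiv.Perm (Fin n) → K) : IsWeight (weightSum ht hq n a) := by
  intro p
  rw [weightSum_apply, Finset.smul_sum, Finset.smul_sum]
  refine Finset.sum_congr rfl fun σ _ => ?_
  rw [smul_comm, isWeight_weightVec, smul_comm]

/-- The coefficients of a vector at the `T_x` with `x` in the stabilizer of `q ^ ρ`. -/
def stabCoord (n : ℕ) [NeZero n] : IndRho n q t →ₗ[K] Equiv.Perm (Fin n) → K where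
  toFun u σ := indCoord ht hq (conjSym n σ) u
  map_add' u u' := funext fun _ => map_add _ u u'
  map_smul' c u := funext fun _ => indCoord_smul ht hq _ c u

theorem stabCoord_weightSum_injective :
    Function.Injective ((stabCoord (K := K) ht hq n).comp (weightSum ht hq n)) := by
  classical
  rw [injective_iff_map_eq_zero]
  intro a ha
  by_contra hne
  obtain ⟨τ₀, hτ₀⟩ := Function.ne_iff.mp hne
  obtain ⟨τ, hτ, hmax⟩ := Finset.exists_max_image
    (Finset.univ.filter fun σ => a σ ≠ 0) (fun σ => len (conjSym n σ)) ⟨τ₀, by simpa using hτ₀⟩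
  have h1 := congrFun ha τ
  change indCoord ht hq (conjSym n τ) (weightSum ht hq n a) = 0 at h1
  rw [weightSum_apply, map_sum, Finset.sum_eq_single τ] at h1
  · rw [indCoord_smul, mul_eq_zero] at h1
    exact h1.elim (Finset.mem_filter.mp hτ).2 ((indCoord_weightVec ht hq τ τ).1 rfl)
  · intro σ _ hσ
    rw [indCoord_smul]
    by_cases h0 : a σ = 0
    · rw [h0, zero_mul]
    · rw [(indCoord_weightVec ht hq τ σ).2 (Ne.symm hσ) (hmax σ (by simpa using h0)), mul_zero]
  · intro h; simp at h

/-- The weight vectors `:ν_{γ⁻¹σγ}: ⊗ v` span the weight space: its coordinates at the stabilizer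
embed it in a space whose dimension is their number. -/
theorem exists_weightSum_eq {u : IndRho n q t} (hu : IsWeight u) :
    ∃ a, weightSum (K := K) ht hq n a = u := by
  obtain ⟨a, ha⟩ := LinearMap.injective_iff_surjective.mp
    (stabCoord_weightSum_injective (K := K) ht hq) (stabCoord ht hq n u)
  refine ⟨a, ?_⟩
  rw [← sub_eq_zero]
  refine eq_zero_of_isWeight ht hq (fun p => ?_) fun σ => ?_
  · rw [smul_sub, smul_sub, hu, isWeight_weightSum]
  · rw [map_sub, sub_eq_zero]
    exact congrFun ha σ

/-- The homomorphism `σ ↦ endPhi σ` to the opposite of the endomorphism algebra. -/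
def phiHom (n : ℕ) [NeZero n] : MonoidAlgebra K (Equiv.Perm (Fin n)) →ₐ[K]
    (Module.End (DAHA n q t) (IndRho n q t))ᵐᵒᵖ :=
  MonoidAlgebra.lift K _ (Equiv.Perm (Fin n))
    { toFun := fun σ => MulOpposite.op (endPhi ht hq σ)
      map_one' := by
        rw [← MulOpposite.op_one]
        refine congrArg _ (end_ext ?_)
        rw [endPhi, indLift_indV, weightVec_one]
        rfl
      map_mul' := fun σ τ => by
        rw [← MulOpposite.op_mul]
        refine congrArg _ (end_ext ?_)
        rw [endPhi, indLift_indV, weightVec_mul, Module.End.mul_apply]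
        refine congrArg _ ?_
        rw [endPhi, indLift_indV] }

theorem phiHom_of (σ : Equiv.Perm (Fin n)) :
    (phiHom ht hq n (MonoidAlgebra.of K _ σ)).unop = endPhi ht hq σ := by
  rw [phiHom, MonoidAlgebra.lift_of]
  rfl

theorem phiHom_indV (a : MonoidAlgebra K (Equiv.Perm (Fin n))) :
    (phiHom ht hq n a).unop (indV n q t) = weightSum ht hq n a.coeff := by
  induction a using MonoidAlgebra.induction_on with
  | of σ =>
    rw [phiHom_of, endPhi, indLift_indV, weightSum_apply, Finset.sum_eq_single σ]
    · simp
    · intro τ _ hτ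
      simp [Finsupp.single_eq_of_ne hτ]
    · simp
  | add a b ha hb =>
    rw [map_add, MulOpposite.unop_add, LinearMap.add_apply, ha, hb, ← map_add]
    rfl
  | smul c a ha =>
    rw [map_smul, MulOpposite.unop_smul, LinearMap.smul_apply, ha, ← map_smul]
    rfl

theorem phiHom_bijective :
    Function.Bijective fun a : (MonoidAlgebra K (Equiv.Perm (Fin n)))ᵐᵒᵖ =>
      (phiHom (K := K) ht hq n a.unop).unop := by
  constructor
  · intro a b h
    have h1 := congrArg (fun Φ => Φ (indV n q t)) h
    simp only [phiHom_indV] at h1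
    have h2 := stabCoord_weightSum_injective (K := K) ht hq (congrArg (stabCoord ht hq n) h1)
    exact MulOpposite.unop_injective (MonoidAlgebra.coeff_injective (DFunLike.coe_injective h2))
  · intro Φ
    obtain ⟨a, ha⟩ := exists_weightSum_eq ht hq (isWeight_apply Φ)
    refine ⟨MulOpposite.op (MonoidAlgebra.ofCoeff (Finsupp.equivFunOnFinite.symm a)), end_ext ?_⟩
    rw [← ha]
    exact phiHom_indV ht hq _

/-- The isomorphism between the group algebra and the endomorphism algebra. -/
def phiEquiv (n : ℕ) [NeZero n] : (MonoidAlgebra K (Equiv.Perm (Fin n)))ᵐᵒᵖ ≃ₐ[K]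
    Module.End (DAHA n q t) (IndRho n q t) :=
  AlgEquiv.ofBijective (AlgHom.opComm (phiHom ht hq n)) (phiHom_bijective ht hq)

theorem phiEquiv_of (σ : Equiv.Perm (Fin n)) :
    phiEquiv ht hq n (MulOpposite.op (MonoidAlgebra.of K _ σ)) = endPhi ht hq σ :=
  phiHom_of ht hq σ

theorem Germ.hasValueAt {g : LaurentLoc n q t} {c : K} (h : Germ q t (locToF ht hq n g) c) :
    HasValueAt (qRho n q) g c := by
  obtain ⟨p, s, hs, hs0, h1, rfl⟩ := h
  refine ⟨p, ⟨s, hs⟩, hs0, locToF_injective ht hq ?_, rfl⟩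
  rw [h1, locToF_mk]

end Generic

end GLDaha

end

theorem mainTheorem6 {K : Type*} [Field K] [CharZero K] (n : ℕ) [NeZero n] (t q : Kˣ)
    (ht : ∀ m : ℕ, 0 < m → t ^ m ≠ 1) (hq : q = t ^ (-2 : ℤ)) :
    ∃ Φ : (MonoidAlgebra K (Equiv.Perm (Fin n)))ᵐᵒᵖ ≃ₐ[K]
        Module.End (GLDaha.DAHA n q t) (GLDaha.Ind q t (GLDaha.qRho n q)),
      ∀ w : Equiv.Perm (Fin n),
        ∃ (g : GLDaha.AffSym n →₀ GLDaha.LaurentLoc n q t) (c : GLDaha.AffSym n → K),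
          GLDaha.IsNormalOrdering
            (GLDaha.nuW q t ((GLDaha.gam n)⁻¹ * GLDaha.finiteSym w * GLDaha.gam n)) g ∧
          (∀ g' : GLDaha.AffSym n →₀ GLDaha.LaurentLoc n q t,
            GLDaha.IsNormalOrdering
              (GLDaha.nuW q t ((GLDaha.gam n)⁻¹ * GLDaha.finiteSym w * GLDaha.gam n)) g' →
            g' = g) ∧
          (∀ x, GLDaha.HasValueAt (GLDaha.qRho n q) (g x) (c x)) ∧
          ∀ h : GLDaha.DAHA n q t,
            Φ (MulOpposite.op (MonoidAlgebra.of K (Equiv.Perm (Fin n)) w))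
                (h ⊗ₜ GLDaha.basisVec (GLDaha.qRho n q)) =
              ∑ x ∈ g.support, c x •
                ((h * GLDaha.TW q t x) ⊗ₜ GLDaha.basisVec (GLDaha.qRho n q)) := by
  refine ⟨GLDaha.phiEquiv ht hq n, fun w => ?_⟩
  obtain ⟨g, hg⟩ := GLDaha.locSum_surjective ht hq
    (GLDaha.nuW q t ((GLDaha.gam n)⁻¹ * GLDaha.finiteSym w * GLDaha.gam n))
  obtain ⟨g', c, hgc, h1, h2⟩ := GLDaha.specRel_normal_form ht hq
    (GLDaha.weightVec_mem (K := K) ht hq w)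
  simp only at h1 h2
  -- the normal ordering in the localized algebra is the one found on rational functions
  have hgg : g.mapRange (GLDaha.locToF ht hq n) (map_zero _) = g' := by
    apply GLDaha.opSum_injective ht hq
    rw [← h1, GLDaha.conjSym_eq, ← GLDaha.rhoLoc_locSum, hg, GLDaha.rhoLoc_nuW]
  have hg' : ∀ x, g' x = GLDaha.locToF ht hq n (g x) := fun x => by
    rw [← hgg, Finsupp.mapRange_apply]
  refine ⟨g, c, (GLDaha.isNormalOrdering_iff _ _).mpr hg.symm, fun k hk => ?_, fun x => ?_,
    fun h => ?_⟩
  · rw [GLDaha.isNormalOrdering_iff, ← hg] at hk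
    exact GLDaha.rhoLoc_locSum_injective ht hq (congrArg _ hk.symm)
  · apply GLDaha.Germ.hasValueAt ht hq
    rw [← hg']
    exact hgc x
  · rw [GLDaha.phiEquiv_of, GLDaha.tmul_basisVec, GLDaha.endPhi, GLDaha.indLift_smul, h2,
      GLDaha.indSum_apply, Finset.smul_sum]
    refine (Finset.sum_congr rfl fun x _ => ?_).trans (Finset.sum_subset ?_ fun x _ hx => ?_)
    · rw [GLDaha.tmul_basisVec, mul_smul, smul_comm]
    · intro x hx
      rw [Finsupp.mem_support_iff] at hx ⊢
      intro h0
      have h3 := hgc x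
      rw [hg', h0, map_zero] at h3
      exact hx (h3.unique .zero)
    · rw [Finsupp.notMem_support_iff] at hx
      rw [hx, zero_smul]
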